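/- Let $G$ be a compact connected Lie group with Lie algebra $\mathfrak g$, let $\xi_1,\dots,\xi_m$ be a basis of $\mathfrak g$ with $[\xi_b,\xi_c]=\sum_a f_{bc}^a\xi_a$, and let $W$ be a compact smooth manifold, possibly with boundary, with a smooth left action of $G$. Let $W^0\subset W$ be the set of points with discrete stabilizer and $W^s=W\setminus W^0$, and assume that $\partial W\subset W^0$. **The Cartan complex.** Let $\Theta^a\in S^1(\mathfrak g^*)$ and $\theta^a\in\Lambda^1(\mathfrak g^*)$ be the dual bases of $(\xi_a)$, and let $\iota_a$ denote the contraction of differential forms on $W$ with the vector field $x\mapsto \frac{d}{dt}\big|_{0}\exp(-t\xi_a)x$. The group $G$ acts on $S(\mathfrak g^*)\otimes\Omega(W)$ by the coadjoint action on the first factor and by $g\cdot\alpha=(g^{-1})^*\alpha$ on the second. Put $\Omega_G(W)=(S(\mathfrak g^*)\otimes\Omega(W))^G$ and $D=1\otimes d-\sum_a\Theta^a\otimes\iota_a$; the equivariant cohomology $H_G^*(W)$ is the cohomology of $(\Omega_G(W),D)$. **The map $r_f^G$.** Let $\omega=\sum_a\omega^a\xi_a$ be a connection on $W^0$: a smooth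 $\mathfrak g$-valued $1$-form on $W^0$ with $\iota_a\omega=\xi_a$ for all $a$ and $\omega_{gx}(dg\,v)=\mathrm{Ad}_g\,\omega_x(v)$ for all $g\in G$, $x\in W^0$, $v\in T_xW$. Let $f:W\to[0,1]$ be a cut-off function: a $G$-invariant smooth function that vanishes on a neighbourhood of $W^s$. Put $\omega_f=f\omega$, extended by $0$ to $W$, and $$(\Omega_f^G)^a=d\omega_f^a+\tfrac12\sum_{b,c}f_{bc}^a\,\omega_f^b\wedge\omega_f^c-(-1+f)\,\Theta^a\ \in\ S(\mathfrak g^*)\otimes\Omega(W).$$ Let $\Psi=\prod_{a=1}^m(1-\theta^a\otimes\iota_a)$ on $\Lambda(\mathfrak g^*)\otimes S(\mathfrak g^*)\otimes\Omega(W)$ (with the usual sign rule: $\iota_a$ anticommutes with the $\theta^b$), let $CW_f:\Lambda(\mathfrak g^*)\otimes S(\mathfrak g^*)\otimes\Omega(W)\to S(\mathfrak g^*)\otimes\Omega(W)$ be the homomorphism with $\theta^a\mapsto\omega_f^a$, $\Theta^a\mapsto(\Omega_f^G)^a$ that is the identity on $\Omega(W)$, and define $$r_f^G(\alpha)=CW_f(\Psi(1\otimes\alpha)),\qquad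 \alpha\in S(\mathfrak g^*)\otimes\Omega(W).$$ **Theorem 2.4.** For every connection $\omega$ on $W^0$ and every cut-off function $f$, the map $r_f^G$ sends $\Omega_G(W)$ to itself and commutes with $D$ there, so that it induces a homomorphism $(r_f^G)_*:H_G^*(W)\to H_G^*(W)$. This homomorphism depends neither on the choice of $\omega$ nor on the choice of $f$: if $\omega_0,\omega_1$ are connections on $W^0$ and $f_0,f_1$ are cut-off functions, then the homomorphisms of $H_G^*(W)$ defined by $(\omega_0,f_0)$ and by $(\omega_1,f_1)$ are equal. -/

import Mathlib

open scoped Manifold ContDiff TensorProduct Topology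

noncomputable section

namespace DegenerateChernWeil

section Forms
set_option linter.unusedSectionVars false

/-- The exterior algebra of the dual of the model space `E`.  In Mathlib the tangent space
`TangentSpace I x` of a manifold modelled on `E` is (by definition) `E` for every `x`, so this is
the fibre `Λ (T*_x M)` at every point, and a function `M → CotangentAlgebra E` is a (not
necessarily smooth, not necessarily homogeneous) differential form on `M`.  The product is the
wedge product. -/
abbrev CotangentAlgebra (E : Type*) [NormedAddCommGroup E] [NormedSpace ℝ E] : Type _ :=
  ExteriorAlgebra ℝ (E →L[ℝ] ℝ)

/-- The algebra homomorphism `Λ (E'*) → Λ (E*)` induced by a linear map `A : E → E'`. -/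
def pullbackCovector {E E' : Type*} [NormedAddCommGroup E] [NormedSpace ℝ E]
    [NormedAddCommGroup E'] [NormedSpace ℝ E'] (A : E →L[ℝ] E') :
    CotangentAlgebra E' →ₐ[ℝ] CotangentAlgebra E :=
  ExteriorAlgebra.map (A.precomp ℝ).toLinearMap

variable {E : Type*} [NormedAddCommGroup E] [NormedSpace ℝ E]
  {H : Type*} [TopologicalSpace H] (I : ModelWithCorners ℝ E H)
  {M : Type*} [TopologicalSpace M] [ChartedSpace H M]

/-- The differential `d_x f : T_x M → ℝ` of a function. -/
def differential (f : M → ℝ) (x : M) : E →L[ℝ] ℝ := mvfderiv I f x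

/-- A function as a form of degree `0`. -/
def funForm (f : M → ℝ) : M → CotangentAlgebra E :=
  fun x => algebraMap ℝ (CotangentAlgebra E) (f x)

/-- The `1`-form `df`. -/
def diffForm (f : M → ℝ) : M → CotangentAlgebra E :=
  fun x => ExteriorAlgebra.ι ℝ (differential I f x)

/-- The algebra generated by the functions `f` and the `1`-forms `df`, where `f` is smooth on `U`:
on `U` its elements are the finite sums of forms `f dg₁ ∧ … ∧ dg_k` with `f`, `g_i` smooth on
`U` (the values outside of `U` are irrelevant). -/
def localForms (U : Set M) : Subalgebra ℝ (M → CotangentAlgebra E) :=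
  Algebra.adjoin ℝ
    ({η | ∃ f : M → ℝ, ContMDiffOn I 𝓘(ℝ, ℝ) ∞ f U ∧ η = funForm f} ∪
      {η | ∃ f : M → ℝ, ContMDiffOn I 𝓘(ℝ, ℝ) ∞ f U ∧ η = diffForm I f})

variable {I} in
lemma funForm_mem {U : Set M} {f : M → ℝ} (hf : ContMDiffOn I 𝓘(ℝ, ℝ) ∞ f U) :
    funForm f ∈ localForms I U :=
  Algebra.subset_adjoin (Or.inl ⟨f, hf, rfl⟩)

variable {I} in
lemma diffForm_mem {U : Set M} {f : M → ℝ} (hf : ContMDiffOn I 𝓘(ℝ, ℝ) ∞ f U) :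
    diffForm I f ∈ localForms I U :=
  Algebra.subset_adjoin (Or.inr ⟨f, hf, rfl⟩)

lemma localForms_mono {U V : Set M} (h : U ⊆ V) : localForms I V ≤ localForms I U := by
  refine Algebra.adjoin_mono (Set.union_subset_union ?_ ?_) <;>
    exact fun η ⟨f, hf, e⟩ => ⟨f, hf.mono h, e⟩

/-- `α` is smooth near `x`: on an open neighbourhood `U` of `x` it is a finite sum of forms
`f dg₁ ∧ … ∧ dg_k` with `f`, `g_i` smooth on `U`.  In a coordinate neighbourhood this says that
the coefficients of `α` with respect to the `dx_J` are smooth near `x`. -/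
def SmoothFormAt (α : M → CotangentAlgebra E) (x : M) : Prop :=
  ∃ U : Set M, IsOpen U ∧ x ∈ U ∧ ∃ β ∈ localForms I U, Set.EqOn α β U

variable (M) in
/-- The algebra `Ω(M)` of smooth differential forms, as a subalgebra of all forms. -/
def forms : Subalgebra ℝ (M → CotangentAlgebra E) where
  carrier := {α | ∀ x, SmoothFormAt I α x}
  mul_mem' := by
    intro a b ha hb x
    obtain ⟨U, hU, xU, α, hα, eα⟩ := ha x
    obtain ⟨V, hV, xV, β, hβ, eβ⟩ := hb x
    exact ⟨U ∩ V, hU.inter hV, ⟨xU, xV⟩, α * β,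
      mul_mem (localForms_mono I Set.inter_subset_left hα)
        (localForms_mono I Set.inter_subset_right hβ),
      fun y hy => by simp [eα hy.1, eβ hy.2]⟩
  add_mem' := by
    intro a b ha hb x
    obtain ⟨U, hU, xU, α, hα, eα⟩ := ha x
    obtain ⟨V, hV, xV, β, hβ, eβ⟩ := hb x
    exact ⟨U ∩ V, hU.inter hV, ⟨xU, xV⟩, α + β,
      add_mem (localForms_mono I Set.inter_subset_left hα)
        (localForms_mono I Set.inter_subset_right hβ),
      fun y hy => by simp [eα hy.1, eβ hy.2]⟩
  algebraMap_mem' := fun r x =>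
    ⟨Set.univ, isOpen_univ, trivial, _, algebraMap_mem _ r, fun _ _ => rfl⟩

/-- The derivative at `x` of the chart centred at `x`. -/
def chartDeriv (x : M) : E →L[ℝ] E := mfderiv I 𝓘(ℝ, E) (extChartAt I x) x

/-- The derivative, at the image of `z`, of the inverse of the chart centred at `x`. -/
def chartSymmDeriv (x z : M) : E →L[ℝ] E :=
  mfderivWithin 𝓘(ℝ, E) I (extChartAt I x).symm (Set.range I) (extChartAt I x z)

variable (M) in
/-- The algebra `Ω(M) = ⨁ Ω^k(M)` of smooth differential forms on `M`. -/
def DifferentialForm : Type _ := forms I M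

namespace DifferentialForm

instance : Ring (DifferentialForm I M) := inferInstanceAs (Ring (forms I M))

instance : Algebra ℝ (DifferentialForm I M) := inferInstanceAs (Algebra ℝ (forms I M))

/-- A pointwise given form that is smooth. -/
def mk (α : M → CotangentAlgebra E) (hα : ∀ x, SmoothFormAt I α x) : DifferentialForm I M :=
  ⟨α, hα⟩

variable {I}

/-- The pointwise values of a differential form. -/
def val : DifferentialForm I M →ₐ[ℝ] (M → CotangentAlgebra E) := (forms I M).val

lemma smoothAt (α : DifferentialForm I M) (x : M) : SmoothFormAt I α.val x :=
  (id α : forms I M).2 x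

@[simp] lemma val_mk (α : M → CotangentAlgebra E) (hα : ∀ x, SmoothFormAt I α x) :
    (mk I α hα).val = α := rfl

lemma val_injective : Function.Injective (val : DifferentialForm I M → M → CotangentAlgebra E) :=
  Subtype.val_injective

lemma ext {α β : DifferentialForm I M} (h : ∀ x, α.val x = β.val x) : α = β :=
  val_injective (funext h)

end DifferentialForm

/-- The form `α` at the point `z`, in the coordinates given by the chart centred at `x`. -/
def inChart (x : M) (α : M → CotangentAlgebra E) (z : M) : CotangentAlgebra E :=
  pullbackCovector (chartSymmDeriv I x z) (α z)

/-- The exterior derivative at `x`.  In the chart centred at `x` write `α = ∑_J α_J e_J` with the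
constant forms `e_J` (the basis of the exterior algebra given by a basis of `E*`); then
`(dα)_x = ∑_J d_x α_J ∧ e_J`. -/
def extDerivAt [FiniteDimensional ℝ E] (α : M → CotangentAlgebra E) (x : M) : CotangentAlgebra E :=
  let e := (Module.finBasis ℝ (E →L[ℝ] ℝ)).ExteriorAlgebra
  ∑ J, diffForm I (fun z => e.coord J (inChart I x α z)) x *
    pullbackCovector (chartDeriv I x) (e J)

/-! ### Properties of the exterior derivative -/

@[simp] lemma pullbackCovector_ι {E E' : Type*} [NormedAddCommGroup E] [NormedSpace ℝ E]
    [NormedAddCommGroup E'] [NormedSpace ℝ E'] (A : E →L[ℝ] E') (l : E' →L[ℝ] ℝ) :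
    pullbackCovector A (ExteriorAlgebra.ι ℝ l) = ExteriorAlgebra.ι ℝ (l ∘L A) := by
  simp [pullbackCovector]

lemma pullbackCovector_comp {E E' E'' : Type*} [NormedAddCommGroup E] [NormedSpace ℝ E]
    [NormedAddCommGroup E'] [NormedSpace ℝ E'] [NormedAddCommGroup E''] [NormedSpace ℝ E'']
    (A : E →L[ℝ] E') (B : E' →L[ℝ] E'') (l : CotangentAlgebra E'') :
    pullbackCovector A (pullbackCovector B l) = pullbackCovector (B ∘L A) l := by
  have : (pullbackCovector A).comp (pullbackCovector B) = pullbackCovector (B ∘L A) := by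
    apply ExteriorAlgebra.hom_ext
    ext l
    simp [ContinuousLinearMap.comp_assoc]
  exact DFunLike.congr_fun this l

lemma pullbackCovector_id (l : CotangentAlgebra E) :
    pullbackCovector (ContinuousLinearMap.id ℝ E) l = l := by
  have : pullbackCovector (ContinuousLinearMap.id ℝ E) = AlgHom.id ℝ _ := by
    apply ExteriorAlgebra.hom_ext
    ext l
    simp
  exact DFunLike.congr_fun this l

lemma ι_mul_eq_involute_mul (v : E →L[ℝ] ℝ) (b : CotangentAlgebra E) :
    ExteriorAlgebra.ι ℝ v * b = CliffordAlgebra.involute b * ExteriorAlgebra.ι ℝ v := by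
  induction b using ExteriorAlgebra.induction with
  | algebraMap r => simp [Algebra.commutes]
  | ι w =>
    have := ExteriorAlgebra.ι_add_mul_swap (R := ℝ) v w
    have h : CliffordAlgebra.involute (ExteriorAlgebra.ι ℝ w) = - ExteriorAlgebra.ι ℝ w :=
      CliffordAlgebra.involute_ι _
    rw [h, neg_mul]
    exact eq_neg_of_add_eq_zero_left this
  | mul a b ha hb => rw [← mul_assoc, ha, mul_assoc, hb, map_mul, mul_assoc]
  | add a b ha hb => rw [mul_add, ha, hb, map_add, add_mul]

lemma contractLeft_mul (d : Module.Dual ℝ (E →L[ℝ] ℝ)) (a b : CotangentAlgebra E) :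
    CliffordAlgebra.contractLeft d (a * b) =
      CliffordAlgebra.contractLeft d a * b +
        CliffordAlgebra.involute a * CliffordAlgebra.contractLeft d b := by
  induction a using ExteriorAlgebra.induction generalizing b with
  | algebraMap r =>
    have h1 : CliffordAlgebra.contractLeft d (algebraMap ℝ (CotangentAlgebra E) r) = 0 :=
      CliffordAlgebra.contractLeft_algebraMap _ d r
    have h2 := CliffordAlgebra.contractLeft_algebraMap_mul d r b
    rw [h1, h2]; simp
  | ι w =>
    have h1 := CliffordAlgebra.contractLeft_ι_mul d w b
    have h2 : CliffordAlgebra.contractLeft d (ExteriorAlgebra.ι ℝ w) =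
      algebraMap ℝ (CotangentAlgebra E) (d w) := CliffordAlgebra.contractLeft_ι _ d w
    have h : CliffordAlgebra.involute (ExteriorAlgebra.ι ℝ w) = - ExteriorAlgebra.ι ℝ w :=
      CliffordAlgebra.involute_ι _
    rw [h2, h, neg_mul, ← sub_eq_add_neg, ← Algebra.smul_def]
    exact h1
  | mul a c ha hc => 
    rw [mul_assoc, ha, hc, ha, map_mul]
    noncomm_ring
  | add a c ha hc => rw [add_mul, map_add, ha, hc, map_add, map_add]; noncomm_ring

variable [FiniteDimensional ℝ E]

/-- The basis of the exterior algebra used in `extDerivAt`. -/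
abbrev covBasis (E : Type*) [NormedAddCommGroup E] [NormedSpace ℝ E] [FiniteDimensional ℝ E] :
    Module.Basis (Finset (Fin (Module.finrank ℝ (E →L[ℝ] ℝ)))) ℝ (CotangentAlgebra E) :=
  (Module.finBasis ℝ (E →L[ℝ] ℝ)).ExteriorAlgebra

/-- The coefficients of `F` are differentiable at `x`. -/
def CoeffDiffAt (F : M → CotangentAlgebra E) (x : M) : Prop :=
  ∀ l : Module.Dual ℝ (CotangentAlgebra E), MDifferentiableAt I 𝓘(ℝ, ℝ) (fun z => l (F z)) x

/-- The expression `∑_J d_x F_J ∧ Q e_J`. -/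
def pd (Q : CotangentAlgebra E →ₐ[ℝ] CotangentAlgebra E) (F : M → CotangentAlgebra E) (x : M) :
    CotangentAlgebra E :=
  ∑ J, diffForm I (fun z => (covBasis E).coord J (F z)) x * Q (covBasis E J)

variable {I}
lemma diffForm_congr {f g : M → ℝ} {x : M} (h : f =ᶠ[𝓝 x] g) :
    diffForm I f x = diffForm I g x := by
  have : differential I f x = differential I g x := by
    simp only [differential, mvfderiv]
    rw [h.mfderiv_eq, h.eq_of_nhds]
  simp only [diffForm, this]

lemma diffForm_add {f g : M → ℝ} {x : M} (hf : MDifferentiableAt I 𝓘(ℝ, ℝ) f x)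
    (hg : MDifferentiableAt I 𝓘(ℝ, ℝ) g x) :
    diffForm I (fun z => f z + g z) x = diffForm I f x + diffForm I g x := by
  simp only [diffForm]
  rw [← map_add]; congr 1
  exact mvfderiv_add hf hg

lemma diffForm_mul {f g : M → ℝ} {x : M} (hf : MDifferentiableAt I 𝓘(ℝ, ℝ) f x)
    (hg : MDifferentiableAt I 𝓘(ℝ, ℝ) g x) :
    diffForm I (fun z => f z * g z) x = f x • diffForm I g x + g x • diffForm I f x := by
  simp only [diffForm]
  rw [← map_smul, ← map_smul, ← map_add]; congr 1
  exact mvfderiv_mul hf hg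

lemma diffForm_const (c : ℝ) (x : M) : diffForm I (fun _ : M => c) x = 0 := by
  simp only [diffForm]
  rw [← map_zero (ExteriorAlgebra.ι (M := E →L[ℝ] ℝ) ℝ)]
  congr 1
  exact mvfderiv_const (I := I) (M := M) c

lemma diffForm_sum {ι : Type*} (s : Finset ι) {f : ι → M → ℝ} {x : M}
    (hf : ∀ i ∈ s, MDifferentiableAt I 𝓘(ℝ, ℝ) (f i) x) :
    MDifferentiableAt I 𝓘(ℝ, ℝ) (fun z => ∑ i ∈ s, f i z) x ∧
    diffForm I (fun z => ∑ i ∈ s, f i z) x = ∑ i ∈ s, diffForm I (f i) x := by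
  classical
  induction s using Finset.induction_on with
  | empty => simpa using ⟨mdifferentiableAt_const, diffForm_const (I := I) (0 : ℝ) x⟩
  | insert a s ha ih =>
    simp only [Finset.sum_insert ha]
    obtain ⟨h1, h2⟩ := ih fun i hi => hf i (Finset.mem_insert_of_mem hi)
    have h0 := hf a (Finset.mem_insert_self _ _)
    refine ⟨h0.add h1, ?_⟩
    rw [diffForm_add h0 h1, h2]

lemma CoeffDiffAt.congr {F F' : M → CotangentAlgebra E} {x : M} (h : CoeffDiffAt I F x)
    (e : F' =ᶠ[𝓝 x] F) : CoeffDiffAt I F' x := fun l =>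
  (h l).congr_of_eventuallyEq (e.mono fun z hz => by simp [hz])

lemma pd_congr {Q : CotangentAlgebra E →ₐ[ℝ] CotangentAlgebra E}
    {F F' : M → CotangentAlgebra E} {x : M} (e : F' =ᶠ[𝓝 x] F) : pd I Q F' x = pd I Q F x := by
  refine Finset.sum_congr rfl fun J _ => ?_
  rw [diffForm_congr (g := fun z => (covBasis E).coord J (F z)) (e.mono fun z hz => by simp [hz])]

lemma CoeffDiffAt.smul_const {c : M → ℝ} {x : M} (hc : MDifferentiableAt I 𝓘(ℝ, ℝ) c x)
    (b : CotangentAlgebra E) : CoeffDiffAt I (fun z => c z • b) x := fun l => by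
  simp only [map_smul, smul_eq_mul]
  exact hc.mul mdifferentiableAt_const

lemma pd_smul_const (Q : CotangentAlgebra E →ₐ[ℝ] CotangentAlgebra E) {c : M → ℝ} {x : M}
    (hc : MDifferentiableAt I 𝓘(ℝ, ℝ) c x)
    (b : CotangentAlgebra E) : pd I Q (fun z => c z • b) x = diffForm I c x * Q b := by
  have : ∀ J, diffForm I (fun z => (covBasis E).coord J (c z • b)) x =
      (covBasis E).coord J b • diffForm I c x := fun J => by
    simp only [map_smul, smul_eq_mul]
    rw [diffForm_mul hc mdifferentiableAt_const, diffForm_const]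
    simp
  simp only [pd, this]
  conv_rhs => rw [← (covBasis E).sum_repr b, map_sum, Finset.mul_sum]
  refine Finset.sum_congr rfl fun J _ => ?_
  simp

lemma CoeffDiffAt.add {F F' : M → CotangentAlgebra E} {x : M} (h : CoeffDiffAt I F x)
    (h' : CoeffDiffAt I F' x) : CoeffDiffAt I (F + F') x := fun l => by
  simp only [Pi.add_apply, map_add]
  exact (h l).add (h' l)

lemma pd_add (Q : CotangentAlgebra E →ₐ[ℝ] CotangentAlgebra E)
    {F F' : M → CotangentAlgebra E} {x : M} (h : CoeffDiffAt I F x)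
    (h' : CoeffDiffAt I F' x) : pd I Q (F + F') x = pd I Q F x + pd I Q F' x := by
  simp only [pd, ← Finset.sum_add_distrib]
  refine Finset.sum_congr rfl fun J _ => ?_
  rw [← add_mul, ← diffForm_add (h _) (h' _)]
  simp

lemma CoeffDiffAt.sum {ι : Type*} (s : Finset ι) {F : ι → M → CotangentAlgebra E} {x : M}
    (h : ∀ i ∈ s, CoeffDiffAt I (F i) x) : CoeffDiffAt I (fun z => ∑ i ∈ s, F i z) x := fun l => by
  simp only [map_sum]
  exact (diffForm_sum s fun i hi => h i hi l).1

lemma pd_sum (Q : CotangentAlgebra E →ₐ[ℝ] CotangentAlgebra E) {ι : Type*} (s : Finset ι)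
    {F : ι → M → CotangentAlgebra E} {x : M}
    (h : ∀ i ∈ s, CoeffDiffAt I (F i) x) :
    pd I Q (fun z => ∑ i ∈ s, F i z) x = ∑ i ∈ s, pd I Q (F i) x := by
  simp only [pd]
  rw [Finset.sum_comm]
  refine Finset.sum_congr rfl fun J _ => ?_
  rw [← Finset.sum_mul, ← (diffForm_sum s fun i hi => h i hi _).2]
  simp

lemma eq_sum_coord (F : M → CotangentAlgebra E) :
    F = fun z => ∑ J, (covBasis E).coord J (F z) • covBasis E J := by
  ext z
  exact ((covBasis E).sum_repr (F z)).symm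

lemma mul_eq_sum_coord (F F' : M → CotangentAlgebra E) :
    F * F' = fun z => ∑ p : _ × _, ((covBasis E).coord p.1 (F z) * (covBasis E).coord p.2 (F' z)) •
      (covBasis E p.1 * covBasis E p.2) := by
  ext z
  conv_lhs => rw [Pi.mul_apply, eq_sum_coord F, eq_sum_coord F']
  rw [Fintype.sum_mul_sum, ← Fintype.sum_prod_type']
  refine Finset.sum_congr rfl fun p _ => ?_
  rw [smul_mul_smul_comm]

lemma CoeffDiffAt.mul {F F' : M → CotangentAlgebra E} {x : M} (h : CoeffDiffAt I F x)
    (h' : CoeffDiffAt I F' x) : CoeffDiffAt I (F * F') x := by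
  rw [mul_eq_sum_coord]
  exact CoeffDiffAt.sum _ fun p _ => CoeffDiffAt.smul_const ((h _).mul (h' _)) _

lemma involute_commutes (Q : CotangentAlgebra E →ₐ[ℝ] CotangentAlgebra E)
    (a : CotangentAlgebra E) (v : E →L[ℝ] ℝ) :
    ExteriorAlgebra.ι ℝ v * Q a = CliffordAlgebra.involute (Q a) * ExteriorAlgebra.ι ℝ v :=
  ι_mul_eq_involute_mul _ _

lemma pd_mul (Q : CotangentAlgebra E →ₐ[ℝ] CotangentAlgebra E)
    {F F' : M → CotangentAlgebra E} {x : M} (h : CoeffDiffAt I F x)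
    (h' : CoeffDiffAt I F' x) :
    pd I Q (F * F') x = pd I Q F x * Q (F' x) +
      CliffordAlgebra.involute (Q (F x)) * pd I Q F' x := by
  have hd : ∀ p : _ × _, MDifferentiableAt I 𝓘(ℝ, ℝ)
      (fun z => (covBasis E).coord p.1 (F z) * (covBasis E).coord p.2 (F' z)) x :=
    fun p => (h _).mul (h' _)
  rw [mul_eq_sum_coord, pd_sum _ _ fun p _ => CoeffDiffAt.smul_const (hd p) _]
  have e1 : pd I Q F x * Q (F' x) = ∑ p : _ × _, diffForm I (fun z => (covBasis E).coord p.1 (F z)) x *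
      Q (covBasis E p.1) * ((covBasis E).coord p.2 (F' x) • Q (covBasis E p.2)) := by
    rw [Fintype.sum_prod_type]
    simp only []
    rw [← Fintype.sum_mul_sum]
    congr 1
    conv_lhs => rw [eq_sum_coord F']
    rw [map_sum]; simp
  have e2 : CliffordAlgebra.involute (Q (F x)) * pd I Q F' x =
      ∑ p : _ × _, ((covBasis E).coord p.1 (F x) • CliffordAlgebra.involute (Q (covBasis E p.1))) *
       (diffForm I (fun z => (covBasis E).coord p.2 (F' z)) x * Q (covBasis E p.2)) := by
    rw [Fintype.sum_prod_type]
    simp only []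
    rw [← Fintype.sum_mul_sum]
    congr 1
    conv_lhs => rw [eq_sum_coord F]
    rw [map_sum, map_sum]; simp
  rw [e1, e2, ← Finset.sum_add_distrib]
  refine Finset.sum_congr rfl fun p _ => ?_
  rw [pd_smul_const _ (hd p), diffForm_mul (h _) (h' _), map_mul, add_mul, add_comm]
  congr 1
  · simp [mul_assoc]
  · simp only [smul_mul_assoc, ← mul_assoc]
    rw [diffForm, ← ι_mul_eq_involute_mul]

section Chart
variable [IsManifold I ∞ M]

lemma differential_comp_symm {g : M → ℝ} {x z : M} (hg : MDifferentiableAt I 𝓘(ℝ, ℝ) g z)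
    (hz : z ∈ (extChartAt I x).source) :
    differential I g z ∘L chartSymmDeriv I x z =
      fderivWithin ℝ (g ∘ (extChartAt I x).symm) (Set.range I) (extChartAt I x z) := by
  have hz' := (extChartAt I x).map_source hz
  have : IsManifold I 1 M := IsManifold.of_le (n := ∞) (by simp)
  have h1 : MDifferentiableWithinAt 𝓘(ℝ, E) I (extChartAt I x).symm (Set.range I)
      (extChartAt I x z) := mdifferentiableWithinAt_extChartAt_symm hz'
  have h2 : UniqueMDiffWithinAt 𝓘(ℝ, E) (Set.range I) (extChartAt I x z) :=
    I.uniqueMDiffOn _ (extChartAt_target_subset_range x hz')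
  have := mfderiv_comp_mfderivWithin_of_eq hg h1 h2 ((extChartAt I x).left_inv hz)
  rw [mfderivWithin_eq_fderivWithin] at this
  exact this.symm

lemma eventually_inChart_diffForm {g : M → ℝ} {x : M} {U : Set M} (hU : IsOpen U) (xU : x ∈ U)
    (hg : ContMDiffOn I 𝓘(ℝ, ℝ) ∞ g U) :
    ∀ᶠ z in 𝓝 x, inChart I x (diffForm I g) z = ExteriorAlgebra.ι ℝ
      (fderivWithin ℝ (g ∘ (extChartAt I x).symm) (Set.range I) (extChartAt I x z)) := by
  filter_upwards [hU.mem_nhds xU, extChartAt_source_mem_nhds (I := I) x] with z zU hz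
  rw [inChart, diffForm, pullbackCovector_ι, differential_comp_symm _ hz]
  exact ((hg z zU).contMDiffAt (hU.mem_nhds zU)).mdifferentiableAt (by simp)

/-- The coordinate covectors of a basis of `E`. -/
def coCov (i : Fin (Module.finrank ℝ E)) : E →L[ℝ] ℝ :=
  LinearMap.toContinuousLinearMap ((Module.finBasis ℝ E).coord i)

lemma eq_sum_coCov (l : E →L[ℝ] ℝ) :
    l = ∑ i, l (Module.finBasis ℝ E i) • coCov (E := E) i := by
  ext v
  conv_lhs => rw [← (Module.finBasis ℝ E).sum_repr v, map_sum]
  simp [coCov, mul_comm]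

lemma contDiffWithinAt_symm {g : M → ℝ} {x : M} {U : Set M} (hU : IsOpen U) (xU : x ∈ U)
    (hg : ContMDiffOn I 𝓘(ℝ, ℝ) ∞ g U) :
    ContDiffWithinAt ℝ ∞ (g ∘ (extChartAt I x).symm) (Set.range I) (extChartAt I x x) := by
  have h := ((hg x xU).contMDiffAt (hU.mem_nhds xU))
  rw [contMDiffAt_iff] at h
  exact h.2

lemma diff_data {g : M → ℝ} {x : M} {U : Set M} (hU : IsOpen U) (xU : x ∈ U)
    (hg : ContMDiffOn I 𝓘(ℝ, ℝ) ∞ g U) (e : E) :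
    MDifferentiableAt I 𝓘(ℝ, ℝ) (fun z => fderivWithin ℝ (g ∘ (extChartAt I x).symm)
      (Set.range I) (extChartAt I x z) e) x ∧
    ∀ v, differential I (fun z => fderivWithin ℝ (g ∘ (extChartAt I x).symm)
      (Set.range I) (extChartAt I x z) e) x v =
      fderivWithin ℝ (fderivWithin ℝ (g ∘ (extChartAt I x).symm) (Set.range I)) (Set.range I)
        (extChartAt I x x) (chartDeriv I x v) e := by
  have h := contDiffWithinAt_symm hU xU hg
  have hm : extChartAt I x x ∈ Set.range I :=
    extChartAt_target_subset_range x (mem_extChartAt_target x)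
  have h1 : DifferentiableWithinAt ℝ (fderivWithin ℝ (g ∘ (extChartAt I x).symm) (Set.range I))
      (Set.range I) (extChartAt I x x) :=
    (h.fderivWithin_right (m := 1) I.uniqueDiffOn (by rw [one_add_one_eq_two]; exact ENat.LEInfty.out) hm).differentiableWithinAt (by simp)
  have h2 := h1.hasFDerivWithinAt
  have h3 : HasFDerivWithinAt (fun y => fderivWithin ℝ (g ∘ (extChartAt I x).symm) (Set.range I) y e)
      ((fderivWithin ℝ (fderivWithin ℝ (g ∘ (extChartAt I x).symm) (Set.range I)) (Set.range I)
        (extChartAt I x x)).flip e) (Set.range I) (extChartAt I x x) := by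
    have h := h2.clm_apply (hasFDerivWithinAt_const e _ _)
    rwa [ContinuousLinearMap.comp_zero, zero_add] at h
  have : IsManifold I 1 M := IsManifold.of_le (n := ∞) (by simp)
  have h4 := (contMDiffAt_extChartAt (I := I) (x := x) (n := 1)).mdifferentiableAt (by simp)
  have h5 := h4.hasMFDerivAt
  have h6 : HasMFDerivAt I 𝓘(ℝ, ℝ) (fun z => fderivWithin ℝ (g ∘ (extChartAt I x).symm)
      (Set.range I) (extChartAt I x z) e) x (ContinuousLinearMap.comp (M₁ := E) (M₂ := E) (M₃ := ℝ)
        ((fderivWithin ℝ (fderivWithin ℝ (g ∘ (extChartAt I x).symm) (Set.range I)) (Set.range I)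
        (extChartAt I x x)).flip e) (chartDeriv I x)) := by
    have := h3.hasMFDerivWithinAt.comp x (s := Set.univ) h5.hasMFDerivWithinAt
      (fun z _ => by simp [extChartAt])
    rw [hasMFDerivWithinAt_univ] at this
    exact this
  refine ⟨h6.mdifferentiableAt, fun v => ?_⟩
  have : differential I (fun z => fderivWithin ℝ (g ∘ (extChartAt I x).symm)
      (Set.range I) (extChartAt I x z) e) x = _ := h6.mfderiv
  rw [this]
  rfl

lemma coeffDiffAt_inChart {x : M} {U : Set M} (hU : IsOpen U) (xU : x ∈ U)
    {β : M → CotangentAlgebra E} (hβ : β ∈ localForms I U) : CoeffDiffAt I (inChart I x β) x := by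
  induction hβ using Algebra.adjoin_induction with
  | mem η h =>
    rcases h with ⟨f, hf, rfl⟩ | ⟨f, hf, rfl⟩
    · have : inChart I x (funForm f) = fun z => f z • (1 : CotangentAlgebra E) := by
        ext z; simp [inChart, funForm, Algebra.algebraMap_eq_smul_one]
      rw [this]
      exact CoeffDiffAt.smul_const
        (((hf x xU).contMDiffAt (hU.mem_nhds xU)).mdifferentiableAt (by simp)) _
    · refine CoeffDiffAt.congr (F := fun z => ∑ i, (fderivWithin ℝ (f ∘ (extChartAt I x).symm)
        (Set.range I) (extChartAt I x z) (Module.finBasis ℝ E i)) •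
          ExteriorAlgebra.ι ℝ (coCov (E := E) i))
        (CoeffDiffAt.sum _ fun i _ => CoeffDiffAt.smul_const (diff_data hU xU hf _).1 _) ?_
      filter_upwards [eventually_inChart_diffForm hU xU hf] with z hz
      rw [hz]
      conv_lhs => rw [eq_sum_coCov (fderivWithin ℝ (f ∘ (extChartAt I x).symm)
        (Set.range I) (extChartAt I x z))]
      simp
  | algebraMap r =>
    have : inChart I x (algebraMap ℝ (M → CotangentAlgebra E) r) =
        fun z => r • (1 : CotangentAlgebra E) := by
      ext z; simp [inChart, Algebra.algebraMap_eq_smul_one]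
    rw [this]
    exact CoeffDiffAt.smul_const mdifferentiableAt_const _
  | add a b _ _ ha hb =>
    have : inChart I x (a + b) = inChart I x a + inChart I x b := by
      ext z; simp [inChart]
    rw [this]; exact ha.add hb
  | mul a b _ _ ha hb =>
    have : inChart I x (a * b) = inChart I x a * inChart I x b := by
      ext z; simp [inChart]
    rw [this]; exact ha.mul hb

lemma extDerivAt_eq (α : M → CotangentAlgebra E) (x : M) :
    extDerivAt I α x = pd I (pullbackCovector (chartDeriv I x)) (inChart I x α) x := rfl

lemma pullback_inChart_self (α : M → CotangentAlgebra E) (x : M) :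
    pullbackCovector (chartDeriv I x) (inChart I x α x) = α x := by
  have : IsManifold I 1 M := IsManifold.of_le (n := ∞) (by simp)
  rw [inChart, pullbackCovector_comp]
  have : chartSymmDeriv I x x ∘L chartDeriv I x = ContinuousLinearMap.id ℝ E :=
    mfderivWithin_extChartAt_symm_comp_mfderiv_extChartAt' (mem_extChartAt_source x)
  rw [this, pullbackCovector_id]

lemma extDerivAt_funForm {f : M → ℝ} {x : M} {U : Set M} (hU : IsOpen U) (xU : x ∈ U)
    (hf : ContMDiffOn I 𝓘(ℝ, ℝ) ∞ f U) : extDerivAt I (funForm f) x = diffForm I f x := by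
  have : inChart I x (funForm f) = fun z => f z • (1 : CotangentAlgebra E) := by
    ext z; simp [inChart, funForm, Algebra.algebraMap_eq_smul_one]
  rw [extDerivAt_eq, this, pd_smul_const, map_one, mul_one]
  exact ((hf x xU).contMDiffAt (hU.mem_nhds xU)).mdifferentiableAt (by simp)

lemma extDerivAt_diffForm {f : M → ℝ} {x : M} {U : Set M} (hU : IsOpen U) (xU : x ∈ U)
    (hf : ContMDiffOn I 𝓘(ℝ, ℝ) ∞ f U) : extDerivAt I (diffForm I f) x = 0 := by
  have hm : extChartAt I x x ∈ Set.range I :=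
    extChartAt_target_subset_range x (mem_extChartAt_target x)
  have hsymm : IsSymmSndFDerivWithinAt ℝ (f ∘ (extChartAt I x).symm) (Set.range I)
      (extChartAt I x x) :=
    (contDiffWithinAt_symm hU xU hf).isSymmSndFDerivWithinAt
      (by simpa using (ENat.LEInfty.out : (2 : WithTop ℕ∞) ≤ ∞))
      I.uniqueDiffOn (I.range_subset_closure_interior hm) hm
  set Q := pullbackCovector (chartDeriv I x)
  set B := fderivWithin ℝ (fderivWithin ℝ (f ∘ (extChartAt I x).symm) (Set.range I)) (Set.range I)
        (extChartAt I x x)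
  rw [extDerivAt_eq, pd_congr (F := fun z => ∑ i, (fderivWithin ℝ (f ∘ (extChartAt I x).symm)
        (Set.range I) (extChartAt I x z) (Module.finBasis ℝ E i)) •
          ExteriorAlgebra.ι ℝ (coCov (E := E) i)), pd_sum _ _
          fun i _ => CoeffDiffAt.smul_const (diff_data hU xU hf _).1 _]
  · have key : ∀ i, pd I Q (fun z => (fderivWithin ℝ (f ∘ (extChartAt I x).symm)
        (Set.range I) (extChartAt I x z) (Module.finBasis ℝ E i)) •
          ExteriorAlgebra.ι ℝ (coCov (E := E) i)) x =
          ∑ k, B (Module.finBasis ℝ E k) (Module.finBasis ℝ E i) •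
            Q (ExteriorAlgebra.ι ℝ (coCov k) * ExteriorAlgebra.ι ℝ (coCov i)) := by
      intro i
      rw [pd_smul_const _ (diff_data hU xU hf _).1]
      have : differential I (fun z => fderivWithin ℝ (f ∘ (extChartAt I x).symm)
          (Set.range I) (extChartAt I x z) (Module.finBasis ℝ E i)) x =
          (B.flip (Module.finBasis ℝ E i)) ∘L (chartDeriv I x) := by
        ext v; exact (diff_data hU xU hf _).2 v
      rw [diffForm, this, ← pullbackCovector_ι, ← map_mul]
      conv_lhs => rw [eq_sum_coCov (B.flip (Module.finBasis ℝ E i))]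
      rw [map_sum, Finset.sum_mul, map_sum]
      simp [Q]
    have h1 : ∀ k i, B (Module.finBasis ℝ E k) (Module.finBasis ℝ E i) =
      B (Module.finBasis ℝ E i) (Module.finBasis ℝ E k) := fun k i => hsymm _ _
    rw [Finset.sum_congr rfl fun i _ => key i]
    set S := ∑ i, ∑ k, B (Module.finBasis ℝ E k) (Module.finBasis ℝ E i) •
            Q (ExteriorAlgebra.ι ℝ (coCov k) * ExteriorAlgebra.ι ℝ (coCov i)) with hS
    have h2 : S + S = 0 := by
      nth_rw 2 [hS]
      rw [Finset.sum_comm, hS, ← Finset.sum_add_distrib]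
      refine Finset.sum_eq_zero fun i _ => ?_
      rw [← Finset.sum_add_distrib]
      refine Finset.sum_eq_zero fun k _ => ?_
      rw [h1 k i, ← smul_add, ← map_add, ExteriorAlgebra.ι_add_mul_swap, map_zero, smul_zero]
    have h3 : (2 : ℝ) • S = 0 := by rw [two_smul, h2]
    exact (smul_eq_zero.mp h3).resolve_left (by norm_num)
  · filter_upwards [eventually_inChart_diffForm hU xU hf] with z hz
    rw [hz]
    conv_lhs => rw [eq_sum_coCov (fderivWithin ℝ (f ∘ (extChartAt I x).symm)
        (Set.range I) (extChartAt I x z))]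
    simp

lemma extDerivAt_congr {α β : M → CotangentAlgebra E} {x : M} (h : α =ᶠ[𝓝 x] β) :
    extDerivAt I α x = extDerivAt I β x := by
  rw [extDerivAt_eq, extDerivAt_eq]
  exact pd_congr (h.mono fun z hz => by simp [inChart, hz])

lemma extDerivAt_add {α β : M → CotangentAlgebra E} {x : M}
    (ha : CoeffDiffAt I (inChart I x α) x) (hb : CoeffDiffAt I (inChart I x β) x) :
    extDerivAt I (α + β) x = extDerivAt I α x + extDerivAt I β x := by
  simp only [extDerivAt_eq]
  rw [← pd_add _ ha hb]
  exact pd_congr (Filter.Eventually.of_forall fun z => by simp [inChart])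

lemma extDerivAt_mul {α β : M → CotangentAlgebra E} {x : M}
    (ha : CoeffDiffAt I (inChart I x α) x) (hb : CoeffDiffAt I (inChart I x β) x) :
    extDerivAt I (α * β) x = extDerivAt I α x * β x +
      CliffordAlgebra.involute (α x) * extDerivAt I β x := by
  simp only [extDerivAt_eq]
  have := pd_mul (pullbackCovector (chartDeriv I x)) ha hb
  rw [pullback_inChart_self, pullback_inChart_self] at this
  rw [← this]
  exact pd_congr (Filter.Eventually.of_forall fun z => by simp [inChart])

lemma extDerivAt_const (r : ℝ) (x : M) :
    extDerivAt I (algebraMap ℝ (M → CotangentAlgebra E) r) x = 0 := by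
  have := extDerivAt_funForm (I := I) (f := fun _ : M => r) isOpen_univ (Set.mem_univ x)
    contMDiffOn_const
  rw [diffForm_const] at this
  exact this

lemma involute_mem_localForms {U : Set M} {β : M → CotangentAlgebra E}
    (hβ : β ∈ localForms I U) :
    (fun z => CliffordAlgebra.involute (β z)) ∈ localForms I U := by
  induction hβ using Algebra.adjoin_induction with
  | mem η h =>
    rcases h with ⟨f, hf, rfl⟩ | ⟨f, hf, rfl⟩
    · have : (fun z => CliffordAlgebra.involute (funForm (E := E) f z)) = funForm f := by
        ext z; simp [funForm]
      rw [this]; exact funForm_mem hf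
    · have : (fun z => CliffordAlgebra.involute (diffForm I f z)) = - diffForm I f := by
        ext z; exact CliffordAlgebra.involute_ι _
      rw [this]; exact neg_mem (diffForm_mem hf)
  | algebraMap r =>
    have : (fun z => CliffordAlgebra.involute (algebraMap ℝ (M → CotangentAlgebra E) r z)) =
      algebraMap ℝ (M → CotangentAlgebra E) r := by ext z; simp
    rw [this]; exact algebraMap_mem _ r
  | add a b _ _ ha hb => 
    convert! add_mem ha hb using 1
    ext z; simp
  | mul a b _ _ ha hb =>
    convert! mul_mem ha hb using 1
    ext z; simp

lemma extDerivAt_mem_localForms {U : Set M} (hU : IsOpen U) {β : M → CotangentAlgebra E}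
    (hβ : β ∈ localForms I U) : ∃ γ ∈ localForms I U, Set.EqOn (extDerivAt I β) γ U := by
  induction hβ using Algebra.adjoin_induction with
  | mem η h =>
    rcases h with ⟨f, hf, rfl⟩ | ⟨f, hf, rfl⟩
    · exact ⟨_, diffForm_mem hf, fun z hz => extDerivAt_funForm hU hz hf⟩
    · exact ⟨0, zero_mem _, fun z hz => extDerivAt_diffForm hU hz hf⟩
  | algebraMap r => exact ⟨0, zero_mem _, fun z _ => extDerivAt_const r z⟩
  | add a b ha' hb' ha hb =>
    obtain ⟨γ, hγ, eγ⟩ := ha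
    obtain ⟨δ, hδ, eδ⟩ := hb
    refine ⟨γ + δ, add_mem hγ hδ, fun z hz => ?_⟩
    rw [extDerivAt_add (coeffDiffAt_inChart hU hz ha') (coeffDiffAt_inChart hU hz hb'),
      eγ hz, eδ hz]; rfl
  | mul a b ha' hb' ha hb =>
    obtain ⟨γ, hγ, eγ⟩ := ha
    obtain ⟨δ, hδ, eδ⟩ := hb
    refine ⟨γ * b + (fun z => CliffordAlgebra.involute (a z)) * δ,
      add_mem (mul_mem hγ hb') (mul_mem (involute_mem_localForms ha') hδ), fun z hz => ?_⟩
    rw [extDerivAt_mul (coeffDiffAt_inChart hU hz ha') (coeffDiffAt_inChart hU hz hb'),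
      eγ hz, eδ hz]; rfl

lemma SmoothFormAt.coeffDiffAt {α : M → CotangentAlgebra E} {x : M} (h : SmoothFormAt I α x) :
    CoeffDiffAt I (inChart I x α) x := by
  obtain ⟨U, hU, xU, β, hβ, e⟩ := h
  refine (coeffDiffAt_inChart hU xU hβ).congr ?_
  filter_upwards [hU.mem_nhds xU] with z hz
  simp [inChart, e hz]

lemma SmoothFormAt.extDerivAt {α : M → CotangentAlgebra E} {x : M} (h : SmoothFormAt I α x) :
    SmoothFormAt I (extDerivAt I α) x := by
  obtain ⟨U, hU, xU, β, hβ, e⟩ := h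
  obtain ⟨γ, hγ, eγ⟩ := extDerivAt_mem_localForms hU hβ
  refine ⟨U, hU, xU, γ, hγ, fun z hz => ?_⟩
  rw [← eγ hz]
  exact extDerivAt_congr (Filter.mem_of_superset (hU.mem_nhds hz) e)

variable (I M) in
/-- The exterior derivative `d : Ω(M) → Ω(M)`. -/
def extDeriv : DifferentialForm I M →ₗ[ℝ] DifferentialForm I M where
  toFun α := .mk I (extDerivAt I α.val) fun x => (α.smoothAt x).extDerivAt
  map_add' α β := DifferentialForm.ext fun x => by
    simp only [DifferentialForm.val_mk, map_add]
    exact extDerivAt_add (α.smoothAt x).coeffDiffAt (β.smoothAt x).coeffDiffAt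
  map_smul' r α := DifferentialForm.ext fun x => by
    have h2 := extDerivAt_mul (α := algebraMap ℝ (M → CotangentAlgebra E) r)
      (SmoothFormAt.coeffDiffAt ((forms I M).algebraMap_mem r x)) (α.smoothAt x).coeffDiffAt
    simp only [DifferentialForm.val_mk, map_smul, RingHom.id_apply]
    rw [Algebra.smul_def, h2, extDerivAt_const, Pi.smul_apply, Algebra.smul_def]
    simp

/-! ### Contraction with a vector field, pull-back -/

/-- The vector field `X` maps smooth functions, defined on open sets, to smooth functions. -/
def SmoothVectorField (X : M → E) : Prop :=
  ∀ (U : Set M) (f : M → ℝ), IsOpen U → ContMDiffOn I 𝓘(ℝ, ℝ) ∞ f U →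
    ContMDiffOn I 𝓘(ℝ, ℝ) ∞ (fun x => differential I f x (X x)) U

/-- The contraction `ι_X α` at `x` (an antiderivation of the wedge product). -/
def contractAt (X : M → E) (α : M → CotangentAlgebra E) (x : M) : CotangentAlgebra E :=
  CliffordAlgebra.contractLeft (ContinuousLinearMap.apply ℝ ℝ (X x)).toLinearMap (α x)

lemma contractAt_mem_localForms {X : M → E} (hX : SmoothVectorField (I := I) X) {U : Set M}
    (hU : IsOpen U) {β : M → CotangentAlgebra E} (hβ : β ∈ localForms I U) :
    contractAt X β ∈ localForms I U := by
  induction hβ using Algebra.adjoin_induction with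
  | mem η h =>
    rcases h with ⟨f, hf, rfl⟩ | ⟨f, hf, rfl⟩
    · have : contractAt X (funForm (E := E) f) = 0 := by
        ext z; exact CliffordAlgebra.contractLeft_algebraMap _ _ _
      rw [this]; exact zero_mem _
    · have : contractAt X (diffForm I f) = funForm (fun x => differential I f x (X x)) := by
        ext z; exact CliffordAlgebra.contractLeft_ι _ _ _
      rw [this]; exact funForm_mem (hX U f hU hf)
  | algebraMap r =>
    have : contractAt X (algebraMap ℝ (M → CotangentAlgebra E) r) = 0 := by
      ext z; exact CliffordAlgebra.contractLeft_algebraMap _ _ _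
    rw [this]; exact zero_mem _
  | add a b _ _ ha hb =>
    convert! add_mem ha hb using 1
    ext z; exact map_add _ _ _
  | mul a b ha' hb' ha hb =>
    convert! add_mem (mul_mem ha hb') (mul_mem (involute_mem_localForms ha') hb) using 1
    ext z; exact contractLeft_mul _ _ _

/-- The contraction `ι_X : Ω(M) → Ω(M)` with a smooth vector field. -/
def contract (X : M → E) (hX : SmoothVectorField (I := I) X) :
    DifferentialForm I M →ₗ[ℝ] DifferentialForm I M where
  toFun α := .mk I (contractAt X α.val) fun x => by
    obtain ⟨U, hU, xU, β, hβ, e⟩ := α.smoothAt x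
    exact ⟨U, hU, xU, _, contractAt_mem_localForms hX hU hβ, fun z hz => by
      simp only [contractAt, e hz]⟩
  map_add' α β := DifferentialForm.ext fun x => by
    simp only [DifferentialForm.val_mk, map_add]
    exact map_add _ _ _
  map_smul' r α := DifferentialForm.ext fun x => by
    simp only [DifferentialForm.val_mk, map_smul, RingHom.id_apply]
    exact LinearMap.map_smul (CliffordAlgebra.contractLeft
      (ContinuousLinearMap.apply ℝ ℝ (X x)).toLinearMap) r (α.val x)

variable (I) in
/-- The derivative `T_x M → T_{φ x} M` of a map. -/
def tangentMapAt (φ : M → M) (x : M) : E →L[ℝ] E := mfderiv I I φ x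

variable (I) in
/-- The pull-back `φ^* α` at `x`. -/
def pullbackAt (φ : M → M) (α : M → CotangentAlgebra E) (x : M) : CotangentAlgebra E :=
  pullbackCovector (tangentMapAt I φ x) (α (φ x))

lemma pullbackAt_mem_localForms {φ : M → M} (hφ : ContMDiff I I ∞ φ) {U : Set M}
    (hU : IsOpen U) {β : M → CotangentAlgebra E} (hβ : β ∈ localForms I U) :
    ∃ γ ∈ localForms I (φ ⁻¹' U), Set.EqOn (pullbackAt I φ β) γ (φ ⁻¹' U) := by
  induction hβ using Algebra.adjoin_induction with
  | mem η h =>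
    rcases h with ⟨f, hf, rfl⟩ | ⟨f, hf, rfl⟩
    · exact ⟨_, funForm_mem (hf.comp hφ.contMDiffOn fun _ h => h), fun z hz => by
        simp [pullbackAt, funForm]⟩
    · refine ⟨_, diffForm_mem (hf.comp hφ.contMDiffOn fun _ h => h), fun z hz => ?_⟩
      simp only [pullbackAt, diffForm, pullbackCovector_ι]
      congr 1
      exact (mfderiv_comp z
        (((hf _ hz).contMDiffAt (hU.mem_nhds hz)).mdifferentiableAt (by simp))
        (hφ.contMDiffAt.mdifferentiableAt (by simp))).symm
  | algebraMap r =>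
    exact ⟨_, algebraMap_mem _ r, fun z _ => by simp [pullbackAt]⟩
  | add a b ha' hb' ha hb =>
    obtain ⟨γ, hγ, eγ⟩ := ha
    obtain ⟨δ, hδ, eδ⟩ := hb
    refine ⟨γ + δ, add_mem hγ hδ, fun z hz => ?_⟩
    rw [Pi.add_apply, ← eγ hz, ← eδ hz]; exact map_add _ _ _
  | mul a b ha' hb' ha hb =>
    obtain ⟨γ, hγ, eγ⟩ := ha
    obtain ⟨δ, hδ, eδ⟩ := hb
    refine ⟨γ * δ, mul_mem hγ hδ, fun z hz => ?_⟩
    rw [Pi.mul_apply, ← eγ hz, ← eδ hz]; exact map_mul _ _ _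

/-- The pull-back `φ^* : Ω(M) → Ω(M)` along a smooth map. -/
def pullback (φ : M → M) (hφ : ContMDiff I I ∞ φ) :
    DifferentialForm I M →ₐ[ℝ] DifferentialForm I M where
  toFun α := .mk I (pullbackAt I φ α.val) fun x => by
    obtain ⟨U, hU, xU, β, hβ, e⟩ := α.smoothAt (φ x)
    obtain ⟨γ, hγ, eγ⟩ := pullbackAt_mem_localForms hφ hU hβ
    refine ⟨_, hU.preimage hφ.continuous, xU, γ, hγ, fun z hz => ?_⟩
    rw [← eγ hz]
    simp only [pullbackAt, e hz]
  map_one' := DifferentialForm.ext fun x => by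
    simp only [DifferentialForm.val_mk, map_one]; exact map_one _
  map_mul' α β := DifferentialForm.ext fun x => by
    simp only [DifferentialForm.val_mk, map_mul]; exact map_mul _ _ _
  map_zero' := DifferentialForm.ext fun x => by
    simp only [DifferentialForm.val_mk, map_zero]; exact map_zero _
  map_add' α β := DifferentialForm.ext fun x => by
    simp only [DifferentialForm.val_mk, map_add]; exact map_add _ _ _
  commutes' r := DifferentialForm.ext fun x => by
    simp only [DifferentialForm.val_mk, AlgHom.commutes]; exact AlgHom.commutes _ _

end Chart

end Forms

section Group
set_option linter.unusedSectionVars false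

variable {EG : Type*} [NormedAddCommGroup EG] [NormedSpace ℝ EG]
  {G : Type*} [TopologicalSpace G] [ChartedSpace EG G] [Group G]
  {E : Type*} [NormedAddCommGroup E] [NormedSpace ℝ E] [FiniteDimensional ℝ E]
  {H : Type*} [TopologicalSpace H] (I : ModelWithCorners ℝ E H)
  {W : Type*} [TopologicalSpace W] [ChartedSpace H W] [MulAction G W]

variable (EG G) in
/-- The Lie algebra `𝔤 = T_1 G` (bracket of left invariant vector fields). -/
abbrev LieAlg : Type _ := GroupLieAlgebra 𝓘(ℝ, EG) G

/-- The vector field on `W` corresponding to `ξ ∈ 𝔤`: the derivative at `g = 1` of `g ↦ g⁻¹ • x`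
in the direction `ξ`, that is, `d/dt|₀ exp(-t ξ) • x`.  With this sign the map from `𝔤` to the
vector fields on `W` is a homomorphism of Lie algebras. -/
def fundamentalField (ξ : LieAlg EG G) (x : W) : E :=
  (mfderiv 𝓘(ℝ, EG) I (fun g : G => g⁻¹ • x) 1 : EG →L[ℝ] E) ξ

lemma smoothVectorField_fundamentalField [IsManifold I ∞ W] [LieGroup 𝓘(ℝ, EG) ∞ G]
    [ContMDiffSMul 𝓘(ℝ, EG) I ∞ G W] (ξ : LieAlg EG G) :
    SmoothVectorField (I := I) (fundamentalField I ξ : W → E) := by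
  intro U f hU hf z hz
  have hact : ContMDiff (I.prod 𝓘(ℝ, EG)) I ∞ (fun p : W × G => p.2⁻¹ • p.1) :=
    (contMDiff_smul (I := 𝓘(ℝ, EG)) (I' := I) (n := ∞) (G := G) (M := W)).comp
      (contMDiff_snd.inv.prodMk contMDiff_fst)
  have hF : ContMDiffAt (I.prod 𝓘(ℝ, EG)) 𝓘(ℝ, ℝ) ∞
      (Function.uncurry fun (x : W) (g : G) => f (g⁻¹ • x)) (z, 1) := by
    refine ContMDiffAt.comp (z, (1 : G)) (g := f) (f := fun p : W × G => p.2⁻¹ • p.1) ?_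
      hact.contMDiffAt
    have : (1 : G)⁻¹ • z = z := by simp
    simp only [this]
    exact (hf z hz).contMDiffAt (hU.mem_nhds hz)
  have key := ContMDiffAt.mfderiv_apply (I := 𝓘(ℝ, EG)) (I' := 𝓘(ℝ, ℝ)) (J := I) (J' := I) (m := ∞) (n := ∞) (x₀ := z)
    (fun (x : W) (g : G) => f (g⁻¹ • x)) (fun _ => 1) id (fun _ => (ξ : EG)) hF
    contMDiffAt_const contMDiffAt_id contMDiffAt_const (by simp)
  refine ContMDiffAt.contMDiffWithinAt (key.congr_of_eventuallyEq ?_)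
  filter_upwards [hU.mem_nhds hz] with y hy
  have : (mfderiv 𝓘(ℝ, EG) 𝓘(ℝ, ℝ) (fun g : G => f (g⁻¹ • y)) 1 : EG →L[ℝ] ℝ) ξ =
    differential I f y (fundamentalField I ξ y) := by
    have h1 : MDifferentiableAt I 𝓘(ℝ, ℝ) f y :=
      ((hf y hy).contMDiffAt (hU.mem_nhds hy)).mdifferentiableAt (by simp)
    have h2 : MDifferentiableAt 𝓘(ℝ, EG) I (fun g : G => g⁻¹ • y) 1 :=
      ((hact.comp (contMDiff_const.prodMk contMDiff_id)).contMDiffAt (x := (1 : G))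
        (f := fun g : G => g⁻¹ • y)).mdifferentiableAt (by simp)
    have h3 := mfderiv_comp_of_eq (f := fun g : G => g⁻¹ • y) (x := 1) h1 h2 (by simp)
    have h4 : (1 : G)⁻¹ • y = y := by simp
    have h5 : ∀ w, w = y → (mfderiv I 𝓘(ℝ, ℝ) f w : E →L[ℝ] ℝ) = differential I f y := by
      rintro _ rfl; rfl
    exact (DFunLike.congr_fun h3 ξ).trans (DFunLike.congr_fun (h5 _ h4) (fundamentalField I ξ y))
  have e := inTangentCoordinates_eq (I := 𝓘(ℝ, EG)) (I' := 𝓘(ℝ, ℝ)) (fun _ : W => (1 : G))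
    (fun x : W => f ((1 : G)⁻¹ • x))
    (fun x : W => (mfderiv 𝓘(ℝ, EG) 𝓘(ℝ, ℝ) (fun g : G => f (g⁻¹ • x)) 1 : EG →L[ℝ] ℝ))
    (x₀ := z) (x := y) (mem_chart_source EG 1) (by rw [chartAt_self_eq]; trivial)
  refine this.symm.trans (Eq.trans ?_ (DFunLike.congr_fun e ξ).symm)
  simp only [tangentBundleCore_coordChange_model_space]
  exact (congrArg (mfderiv 𝓘(ℝ, EG) 𝓘(ℝ, ℝ) (fun g : G => f (g⁻¹ • y)) 1 : EG →L[ℝ] ℝ)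
    ((tangentBundleCore 𝓘(ℝ, EG) G).coordChange_self (achart EG 1) 1
      (mem_chart_source EG 1) ξ)).symm


/-! ### The Cartan complex, connections, the degenerate Chern-Weil construction -/

/-- The adjoint representation of `G` on `𝔤`. -/
def Ad (g : G) : LieAlg EG G →ₗ[ℝ] LieAlg EG G :=
  (mfderiv 𝓘(ℝ, EG) 𝓘(ℝ, EG) (fun h : G => g * h * g⁻¹) 1 : EG →L[ℝ] EG).toLinearMap

variable (EG G) in
/-- The algebra `S(𝔤*)`. -/
abbrev SymDual : Type _ := SymmetricAlgebra ℝ (Module.Dual ℝ (LieAlg EG G))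

/-- The coadjoint action of `g` on `S(𝔤*)`: on `𝔤*` it is `l ↦ l ∘ Ad(g⁻¹)`. -/
def coadjoint (g : G) : SymDual EG G →ₐ[ℝ] SymDual EG G :=
  SymmetricAlgebra.lift (SymmetricAlgebra.ι ℝ _ ∘ₗ (Ad g⁻¹).dualMap)

variable (G W) in
/-- The locally free part `W⁰`: the points whose stabilizer is discrete (has dimension `0`).
Its complement is the singular set `W^s`. -/
def freeLocus : Set W := {x | DiscreteTopology (MulAction.stabilizer G x)}

variable (EG G W) in
/-- The algebra `S(𝔤*) ⊗ Ω(W)`. -/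
abbrev PolyForms : Type _ := SymDual EG G ⊗[ℝ] DifferentialForm I W

instance : AddCommGroup (PolyForms EG G I W) := TensorProduct.addCommGroup

/-- For a `𝔤`-valued `1`-form `η` and `l ∈ 𝔤*`, the `1`-form `l ∘ η`; for the coordinate
function `l` of a basis vector `ξ_a` this is the component `η^a`. -/
def lieForm (η : W → E →ₗ[ℝ] LieAlg EG G) (l : Module.Dual ℝ (LieAlg EG G)) (x : W) :
    CotangentAlgebra E :=
  ExteriorAlgebra.ι ℝ (LinearMap.toContinuousLinearMap (l ∘ₗ η x))

variable (EG G W) in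
/-- A connection on the locally free part `W⁰`: a smooth `𝔤`-valued `1`-form on `W⁰` that
reproduces the generators of the vector fields of the action, and is equivariant.  Its values
outside of `W⁰` are unconstrained, and never matter. -/
structure Connection where
  toFun : W → E →ₗ[ℝ] LieAlg EG G
  smooth : ∀ l, ∀ x ∈ freeLocus G W, SmoothFormAt I (lieForm toFun l) x
  vertical : ∀ x ∈ freeLocus G W, ∀ ζ : LieAlg EG G, toFun x (fundamentalField I ζ x) = ζ
  equivariant : ∀ x ∈ freeLocus G W, ∀ (g : G) (v : E),
    toFun (g • x) (tangentMapAt I (fun y : W => g • y) x v) = Ad g (toFun x v)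

variable (G W) in
/-- A cut-off function: a `G`-invariant smooth function `W → [0, 1]` that vanishes on a
neighbourhood of the singular set. -/
structure CutOff where
  toFun : W → ℝ
  smooth : ContMDiff I 𝓘(ℝ, ℝ) ∞ toFun
  mem_Icc : ∀ x, toFun x ∈ Set.Icc (0 : ℝ) 1
  invariant : ∀ (g : G) (x : W), toFun (g • x) = toFun x
  vanishes : ∃ U : Set W, IsOpen U ∧ (freeLocus G W)ᶜ ⊆ U ∧ ∀ x ∈ U, toFun x = 0

variable {I}

/-- A cut-off function as a form of degree `0`. -/
def CutOff.form (f : CutOff G I W) : DifferentialForm I W :=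
  .mk I (funForm f.toFun) fun _ => ⟨Set.univ, isOpen_univ, trivial, _,
    funForm_mem f.smooth.contMDiffOn, fun _ _ => rfl⟩

/-- The degenerate connection `ω_f = f ω`, extended by `0` over the singular set, given through its
components `l ∘ ω_f ∈ Ω(W)`, `l ∈ 𝔤*`.  It is smooth on all of `W`. -/
def degenerateConnection (η : Connection EG G I W) (f : CutOff G I W) :
    Module.Dual ℝ (LieAlg EG G) →ₗ[ℝ] DifferentialForm I W where
  toFun l := .mk I (fun x => f.toFun x • lieForm η.toFun l x) fun x => by
    by_cases hx : x ∈ freeLocus G W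
    · obtain ⟨U, hU, xU, β, hβ, e⟩ := η.smooth l x hx
      refine ⟨U, hU, xU, funForm f.toFun * β,
        mul_mem (funForm_mem f.smooth.contMDiffOn) hβ, fun z hz => ?_⟩
      simp only [e hz, Pi.mul_apply, funForm, Algebra.smul_def]
    · obtain ⟨U, hU, hs, h0⟩ := f.vanishes
      exact ⟨U, hU, hs hx, 0, zero_mem _, fun z hz => by simp [h0 z hz]⟩
  map_add' l l' := DifferentialForm.ext fun x => by
    simp only [DifferentialForm.val_mk, map_add, Pi.add_apply, ← smul_add]
    congr 1
    simp only [lieForm]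
    rw [← map_add]
    rfl
  map_smul' r l := DifferentialForm.ext fun x => by
    simp only [DifferentialForm.val_mk, map_smul, Pi.smul_apply, RingHom.id_apply]
    rw [smul_comm r]
    congr 1
    simp only [lieForm]
    rw [← map_smul]
    rfl

lemma degenerateConnection_mul_self (η : Connection EG G I W) (f : CutOff G I W)
    (l : Module.Dual ℝ (LieAlg EG G)) :
    degenerateConnection η f l * degenerateConnection η f l = 0 :=
  DifferentialForm.ext fun x => by
    simp only [map_mul, map_zero]
    change (f.toFun x • lieForm η.toFun l x) * (f.toFun x • lieForm η.toFun l x) = 0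
    rw [smul_mul_smul_comm, lieForm, ExteriorAlgebra.ι_sq_zero, smul_zero]

variable [IsManifold I ∞ W] [LieGroup 𝓘(ℝ, EG) ∞ G] [ContMDiffSMul 𝓘(ℝ, EG) I ∞ G W]

variable (I) in
/-- The contraction with the vector field of `ζ ∈ 𝔤`. -/
def fundamentalContract (ζ : LieAlg EG G) : DifferentialForm I W →ₗ[ℝ] DifferentialForm I W :=
  contract (fundamentalField I ζ) (smoothVectorField_fundamentalField I ζ)

variable (EG I W) in
/-- The left action of `g` on `Ω(W)`: pull-back along `x ↦ g⁻¹ • x`. -/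
def translateForm (g : G) : DifferentialForm I W →ₐ[ℝ] DifferentialForm I W :=
  pullback (fun x : W => g⁻¹ • x)
    ((contMDiff_smul (I := 𝓘(ℝ, EG)) (I' := I) (n := ∞) (G := G) (M := W)).comp
      (contMDiff_const.prodMk contMDiff_id))

variable (EG I W) in
/-- The diagonal action of `g` on `S(𝔤*) ⊗ Ω(W)`. -/
def translate (g : G) : PolyForms EG G I W →ₐ[ℝ] PolyForms EG G I W :=
  Algebra.TensorProduct.map (coadjoint g) (translateForm EG I W g)

variable (EG G I W) in
/-- The equivariant forms `Ω_G(W) = (S(𝔤*) ⊗ Ω(W))^G`. -/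
def equivariantForms : Submodule ℝ (PolyForms EG G I W) where
  carrier := {α | ∀ g : G, translate EG I W g α = α}
  zero_mem' g := map_zero _
  add_mem' ha hb g := by rw [map_add, ha g, hb g]
  smul_mem' r _ ha g := by rw [map_smul, ha g]

variable {m : ℕ} (ξ : Module.Basis (Fin m) ℝ (LieAlg EG G))

/-- The element `Θ^a ∈ S¹(𝔤*)` of the basis dual to `ξ`. -/
def polyGen (a : Fin m) : SymDual EG G := SymmetricAlgebra.ι ℝ _ (ξ.coord a)

variable (I W) in
/-- The Cartan differential `D = 1 ⊗ d - ∑ Θ^a ⊗ ι_a`. -/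
def cartanD : PolyForms EG G I W →ₗ[ℝ] PolyForms EG G I W :=
  TensorProduct.map LinearMap.id (extDeriv I W) -
    ∑ a, TensorProduct.map (LinearMap.mulLeft ℝ (polyGen ξ a)) (fundamentalContract I (ξ a))

variable (I W) in
/-- The equivariantly closed forms. -/
def cocycles : Submodule ℝ (PolyForms EG G I W) :=
  equivariantForms EG G I W ⊓ LinearMap.ker (cartanD I W ξ)

variable (I W) in
/-- The equivariantly exact forms. -/
def coboundaries : Submodule ℝ (PolyForms EG G I W) :=
  (equivariantForms EG G I W).map (cartanD I W ξ)

variable (I W) in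
/-- The equivariant cohomology `H_G^*(W)` (all degrees together), that is, the cohomology of
`(Ω_G(W), D)`. -/
abbrev EquivariantCohomology : Type _ :=
  cocycles I W ξ ⧸ (coboundaries I W ξ).submoduleOf (cocycles I W ξ)

/-- The component `(Ω_f^G)^a` of the degenerate equivariant curvature
`dω_f + ½ [ω_f, ω_f] - (-1 + f) ∑ Θ^a ξ_a`. -/
def degenerateCurvature (η : Connection EG G I W) (f : CutOff G I W) (a : Fin m) :
    PolyForms EG G I W :=
  (1 : SymDual EG G) ⊗ₜ[ℝ] (extDeriv I W (degenerateConnection η f (ξ.coord a)) +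
      (1 / 2 : ℝ) • ∑ b, ∑ c, ξ.coord a ⁅ξ b, ξ c⁆ •
        (degenerateConnection η f (ξ.coord b) * degenerateConnection η f (ξ.coord c))) -
    polyGen ξ a ⊗ₜ[ℝ] (-1 + f.form)

/-- The algebra homomorphism on `Λ(𝔤*)` given by `θ^a ↦ ω_f^a`. -/
def chernWeilExterior (η : Connection EG G I W) (f : CutOff G I W) :
    ExteriorAlgebra ℝ (Module.Dual ℝ (LieAlg EG G)) →ₐ[ℝ] PolyForms EG G I W :=
  ExteriorAlgebra.lift ℝ
    ⟨Algebra.TensorProduct.includeRight.toLinearMap ∘ₗ degenerateConnection η f, fun l => by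
      simp only [LinearMap.comp_apply, AlgHom.toLinearMap_apply]
      rw [← map_mul, degenerateConnection_mul_self, map_zero]⟩

/-- The substitution `Θ^a ↦ (Ω_f^G)^a`, given on the basis of `S(𝔤*)` that consists of the monomials
`∏ (Θ^a)^{K a}`.  The forms `(Ω_f^G)^a` have even degree, so they commute, and this is a
homomorphism of algebras. -/
def chernWeilSym (η : Connection EG G I W) (f : CutOff G I W) :
    SymDual EG G →ₗ[ℝ] PolyForms EG G I W :=
  ξ.dualBasis.symmetricAlgebra.constr ℝ
    fun K : Fin m →₀ ℕ => (List.ofFn fun a => degenerateCurvature ξ η f a ^ K a).prod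

variable (EG G I W) in
/-- The tensor product `W(𝔤) ⊗ Ω(W) = Λ(𝔤*) ⊗ S(𝔤*) ⊗ Ω(W)` with the Weil algebra. -/
abbrev WeilForms : Type _ :=
  ExteriorAlgebra ℝ (Module.Dual ℝ (LieAlg EG G)) ⊗[ℝ] PolyForms EG G I W

/-- The map `Λ(𝔤*) ⊗ S(𝔤*) ⊗ Ω(W) → S(𝔤*) ⊗ Ω(W)` given by `θ^a ↦ ω_f^a`, `Θ^a ↦ (Ω_f^G)^a` and
the identity on `Ω(W)`. -/
def chernWeil (η : Connection EG G I W) (f : CutOff G I W) :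
    WeilForms EG G I W →ₗ[ℝ] PolyForms EG G I W :=
  LinearMap.mul' ℝ _ ∘ₗ TensorProduct.map (chernWeilExterior η f).toLinearMap
    (LinearMap.mul' ℝ _ ∘ₗ TensorProduct.map (chernWeilSym ξ η f)
      Algebra.TensorProduct.includeRight.toLinearMap)

variable (I W) in
/-- The operator `θ^a ⊗ ι_a`.  The odd operator `ι_a` passes the factor in `Λ(𝔤*)`, which gives the
sign `(-1)^j` on `Λ^j(𝔤*)` (the grading involution). -/
def thetaContract (a : Fin m) : Module.End ℝ (WeilForms EG G I W) :=
  TensorProduct.map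
    (LinearMap.mulLeft ℝ (ExteriorAlgebra.ι ℝ (ξ.coord a)) ∘ₗ CliffordAlgebra.involute.toLinearMap)
    (TensorProduct.map LinearMap.id (fundamentalContract I (ξ a)))

variable (I W) in
/-- The operator `Ψ = ∏_a (1 - θ^a ⊗ ι_a)`; its factors commute. -/
def psi : Module.End ℝ (WeilForms EG G I W) :=
  (List.ofFn fun a => 1 - thetaContract I W ξ a).prod

/-- The map `r_f^G = CW ∘ Ψ` on `S(𝔤*) ⊗ Ω(W)`, included in `Λ(𝔤*) ⊗ S(𝔤*) ⊗ Ω(W)` by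
`α ↦ 1 ⊗ α`. -/
def rMap (η : Connection EG G I W) (f : CutOff G I W) :
    PolyForms EG G I W →ₗ[ℝ] PolyForms EG G I W :=
  chernWeil ξ η f ∘ₗ psi I W ξ ∘ₗ TensorProduct.mk ℝ _ _ 1

/-- `r` maps the Cartan complex `(Ω_G(W), D)` to itself and commutes with `D` there. -/
structure IsCochainMap (r : PolyForms EG G I W →ₗ[ℝ] PolyForms EG G I W) : Prop where
  map_mem : ∀ α ∈ equivariantForms EG G I W, r α ∈ equivariantForms EG G I W
  comm : ∀ α ∈ equivariantForms EG G I W, cartanD I W ξ (r α) = r (cartanD I W ξ α)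

variable {ξ}

lemma IsCochainMap.map_cocycles {r : PolyForms EG G I W →ₗ[ℝ] PolyForms EG G I W}
    (hr : IsCochainMap ξ r) : ∀ α ∈ cocycles I W ξ, r α ∈ cocycles I W ξ := fun α h =>
  ⟨hr.map_mem α h.1, by
    have h2 : cartanD I W ξ α = 0 := h.2
    change cartanD I W ξ (r α) = 0
    rw [hr.comm α h.1, h2, map_zero]⟩

/-- The map induced on equivariant cohomology. -/
def IsCochainMap.cohomologyMap {r : PolyForms EG G I W →ₗ[ℝ] PolyForms EG G I W}
    (hr : IsCochainMap ξ r) :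
    EquivariantCohomology I W ξ →ₗ[ℝ] EquivariantCohomology I W ξ :=
  Submodule.mapQ _ _ (r.restrict hr.map_cocycles) (by
    rintro ⟨_, hα⟩ ⟨β, hβ, rfl⟩
    exact ⟨r β, hr.map_mem β hβ, hr.comm β hβ⟩)

end Group
end DegenerateChernWeil

end

open DegenerateChernWeil

noncomputable section

namespace DegenerateChernWeil

section GradedAlgebra

variable {A T : Type*} [Ring A] [Algebra ℝ A] [Ring T] [Algebra ℝ T]

/-- Two maps that satisfy the same twisted Leibniz rule and agree on generators are equal. -/
theorem ext_of_twisted_leibniz {u v : A →ₐ[ℝ] T} {Φ Ψ : A →ₗ[ℝ] T}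
    (hΦ : ∀ x y, Φ (x * y) = Φ x * u y + v x * Φ y)
    (hΨ : ∀ x y, Ψ (x * y) = Ψ x * u y + v x * Ψ y)
    {s : Set A} (hs : Algebra.adjoin ℝ s = ⊤) (h : ∀ x ∈ s, Φ x = Ψ x) : Φ = Ψ := by
  have one : ∀ {Φ : A →ₗ[ℝ] T}, (∀ x y, Φ (x * y) = Φ x * u y + v x * Φ y) → Φ 1 = 0 := by
    intro Φ hΦ
    have := hΦ 1 1
    simpa using this
  ext x
  have hx : x ∈ Algebra.adjoin ℝ s := hs ▸ Algebra.mem_top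
  induction hx using Algebra.adjoin_induction with
  | mem x hx => exact h x hx
  | algebraMap r => rw [Algebra.algebraMap_eq_smul_one, map_smul, map_smul, one hΦ, one hΨ]
  | add x y _ _ hx hy => rw [map_add, map_add, hx, hy]
  | mul x y _ _ hx hy => rw [hΦ, hΨ, hx, hy]

/-- An odd derivation, with respect to the grading involution `τ`. -/
structure IsAntiderivation (τ : A →ₐ[ℝ] A) (D : A →ₗ[ℝ] A) : Prop where
  leibniz : ∀ a b, D (a * b) = D a * b + τ a * D b
  grade : ∀ a, D (τ a) = -τ (D a)

/-- An odd element that commutes in the graded sense with everything. -/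
structure OddElement (τ : A →ₐ[ℝ] A) (x : A) : Prop where
  grade : τ x = -x
  comm : ∀ a, x * a = τ a * x

/-- An even central element. -/
structure EvenElement (τ : A →ₐ[ℝ] A) (x : A) : Prop where
  grade : τ x = x
  comm : ∀ a, x * a = a * x

variable {τ : A →ₐ[ℝ] A} {D : A →ₗ[ℝ] A}

lemma IsAntiderivation.map_one (h : IsAntiderivation τ D) : D 1 = 0 := by
  simpa using h.leibniz 1 1

lemma IsAntiderivation.evenElement (h : IsAntiderivation τ D) (hτ : ∀ a, τ (τ a) = a) {x : A}
    (hx : OddElement τ x) : EvenElement τ (D x) where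
  grade := by
    have := h.grade x
    rw [hx.grade, map_neg, neg_inj] at this
    exact this.symm
  comm a := by
    have h1 := h.leibniz x a
    rw [hx.comm a, h.leibniz, hx.grade, hτ, h.grade, neg_mul, neg_mul, hx.comm (D a),
      add_comm] at h1
    exact (add_right_cancel h1).symm

lemma IsAntiderivation.oddElement (h : IsAntiderivation τ D) {x : A}
    (hx : EvenElement τ x) : OddElement τ (D x) where
  grade := by
    have := h.grade x
    rw [hx.grade] at this
    exact neg_eq_iff_eq_neg.mp this.symm
  comm a := by
    have h1 := h.leibniz x a
    rw [hx.comm a, h.leibniz, hx.grade, hx.comm (D a), add_comm] at h1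
    exact (add_right_cancel h1).symm

lemma IsAntiderivation.mul_left_even (h : IsAntiderivation τ D) {x : A} (hx : EvenElement τ x) :
    IsAntiderivation τ (LinearMap.mulLeft ℝ x ∘ₗ D) where
  leibniz a b := by
    simp only [LinearMap.comp_apply, LinearMap.mulLeft_apply, h.leibniz, mul_add, ← mul_assoc]
    rw [hx.comm (τ a)]
  grade a := by
    simp only [LinearMap.comp_apply, LinearMap.mulLeft_apply, h.grade, map_mul, hx.grade, mul_neg]

lemma IsAntiderivation.add {D' : A →ₗ[ℝ] A} (h : IsAntiderivation τ D)
    (h' : IsAntiderivation τ D') : IsAntiderivation τ (D + D') where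
  leibniz a b := by
    simp only [LinearMap.add_apply, h.leibniz, h'.leibniz]; noncomm_ring
  grade a := by
    simp only [LinearMap.add_apply, h.grade, h'.grade, map_add]; abel

lemma IsAntiderivation.neg (h : IsAntiderivation τ D) : IsAntiderivation τ (-D) where
  leibniz a b := by
    simp only [LinearMap.neg_apply, h.leibniz]; noncomm_ring
  grade a := by
    simp only [LinearMap.neg_apply, h.grade, map_neg]

lemma IsAntiderivation.sum {κ : Type*} (s : Finset κ) {D : κ → A →ₗ[ℝ] A}
    (h : ∀ i ∈ s, IsAntiderivation τ (D i)) : IsAntiderivation τ (∑ i ∈ s, D i) := by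
  classical
  induction s using Finset.induction_on with
  | empty => exact ⟨fun a b => by simp, fun a => by simp⟩
  | insert i s hi ih =>
    rw [Finset.sum_insert hi]
    exact (h i (Finset.mem_insert_self _ _)).add (ih fun j hj => h j (Finset.mem_insert_of_mem hj))

lemma OddElement.mul_anticomm {x y : A} (hx : OddElement τ x) (hy : OddElement τ y) :
    x * y = -(y * x) := by
  rw [hx.comm, hy.grade, neg_mul]

lemma OddElement.mul_self {x : A} (hx : OddElement τ x) : x * x = 0 := by
  have h : x * x = -(x * x) := hx.mul_anticomm hx
  have h2 : (2 : ℝ) • (x * x) = 0 := by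
    rw [two_smul]; nth_rw 1 [h]; simp
  exact (smul_eq_zero.mp h2).resolve_left (by norm_num)

lemma OddElement.mul {x y : A} (hτ : ∀ a, τ (τ a) = a) (hx : OddElement τ x)
    (hy : OddElement τ y) : EvenElement τ (x * y) where
  grade := by rw [map_mul, hx.grade, hy.grade, neg_mul_neg]
  comm a := by rw [mul_assoc, hy.comm, ← mul_assoc, hx.comm, hτ, mul_assoc]

lemma EvenElement.add {x y : A} (hx : EvenElement τ x) (hy : EvenElement τ y) :
    EvenElement τ (x + y) where
  grade := by rw [map_add, hx.grade, hy.grade]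
  comm a := by rw [add_mul, mul_add, hx.comm, hy.comm]

lemma EvenElement.smul {x : A} (r : ℝ) (hx : EvenElement τ x) : EvenElement τ (r • x) where
  grade := by rw [map_smul, hx.grade]
  comm a := by rw [smul_mul_assoc, mul_smul_comm, hx.comm]

lemma EvenElement.zero : EvenElement τ 0 := ⟨map_zero _, fun a => by simp⟩

lemma EvenElement.sum {κ : Type*} (s : Finset κ) {x : κ → A}
    (h : ∀ i ∈ s, EvenElement τ (x i)) : EvenElement τ (∑ i ∈ s, x i) := by
  classical
  induction s using Finset.induction_on with
  | empty => simpa using EvenElement.zero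
  | insert i s hi ih =>
    rw [Finset.sum_insert hi]
    exact (h i (Finset.mem_insert_self _ _)).add (ih fun j hj => h j (Finset.mem_insert_of_mem hj))

end GradedAlgebra

section BaseExtension

variable {P A : Type*} [CommRing P] [Algebra ℝ P] [Ring A] [Algebra ℝ A]
  {τ : A →ₐ[ℝ] A} {D : A →ₗ[ℝ] A}

variable (P) in
/-- The extension of an endomorphism of `A` to `P ⊗ A`. -/
abbrev extendAlg (φ : A →ₐ[ℝ] A) : P ⊗[ℝ] A →ₐ[ℝ] P ⊗[ℝ] A :=
  Algebra.TensorProduct.map (AlgHom.id ℝ P) φ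

lemma tensor_neg_mul (x y : P ⊗[ℝ] A) : -x * y = -(x * y) := by
  rw [eq_neg_iff_add_eq_zero, ← add_mul, neg_add_cancel, zero_mul]

lemma extendAlg_involutive (h : ∀ a, τ (τ a) = a) (z : P ⊗[ℝ] A) :
    extendAlg P τ (extendAlg P τ z) = z := by
  induction z using TensorProduct.induction_on with
  | zero => simp
  | tmul p a => simp [h]
  | add x y hx hy => rw [map_add, map_add, hx, hy]

lemma IsAntiderivation.lTensor (h : IsAntiderivation τ D) :
    IsAntiderivation (extendAlg P τ) (D.lTensor P) where
  leibniz x y := by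
    induction x using TensorProduct.induction_on with
    | zero => simp
    | add x x' hx hx' => simp only [add_mul, map_add, hx, hx']; abel
    | tmul p a =>
      induction y using TensorProduct.induction_on with
      | zero => simp
      | add y y' hy hy' => simp only [mul_add, map_add, hy, hy']; abel
      | tmul q b => simp [h.leibniz, TensorProduct.tmul_add]
  grade x := by
    induction x using TensorProduct.induction_on with
    | zero => simp
    | add x x' hx hx' => simp only [map_add, hx, hx']; abel
    | tmul p a => simp [h.grade, TensorProduct.tmul_neg]

lemma OddElement.tmul {x : A} (h : OddElement τ x) (p : P) :
    OddElement (extendAlg P τ) (p ⊗ₜ[ℝ] x) where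
  grade := by simp [h.grade, TensorProduct.tmul_neg]
  comm z := by
    induction z using TensorProduct.induction_on with
    | zero => simp
    | add z z' hz hz' => simp only [add_mul, mul_add, map_add, hz, hz']
    | tmul q b => simp [h.comm b, mul_comm p q]

lemma EvenElement.tmul {x : A} (h : EvenElement τ x) (p : P) :
    EvenElement (extendAlg P τ) (p ⊗ₜ[ℝ] x) where
  grade := by simp [h.grade]
  comm z := by
    induction z using TensorProduct.induction_on with
    | zero => simp
    | add z z' hz hz' => simp only [add_mul, mul_add, hz, hz']
    | tmul q b => simp [h.comm b, mul_comm p q]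

lemma leibniz_lTensor {L : A →ₗ[ℝ] A} (h : ∀ a b, L (a * b) = L a * b + a * L b)
    (x y : P ⊗[ℝ] A) :
    L.lTensor P (x * y) = L.lTensor P x * y + x * L.lTensor P y := by
  induction x using TensorProduct.induction_on with
  | zero => simp
  | add x x' hx hx' => simp only [add_mul, map_add, hx, hx']; abel
  | tmul p a =>
    induction y using TensorProduct.induction_on with
    | zero => simp
    | add y y' hy hy' => simp only [mul_add, map_add, hy, hy']; abel
    | tmul q b => simp [h, TensorProduct.tmul_add]

lemma leibniz_rTensor {δ : P →ₗ[ℝ] P} (h : ∀ a b, δ (a * b) = δ a * b + a * δ b)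
    (x y : P ⊗[ℝ] A) :
    δ.rTensor A (x * y) = δ.rTensor A x * y + x * δ.rTensor A y := by
  induction x using TensorProduct.induction_on with
  | zero => simp
  | add x x' hx hx' => simp only [add_mul, map_add, hx, hx']; abel
  | tmul p a =>
    induction y using TensorProduct.induction_on with
    | zero => simp
    | add y y' hy hy' => simp only [mul_add, map_add, hy, hy']; abel
    | tmul q b => simp [h, TensorProduct.add_tmul]

end BaseExtension

section CartanCalculus

/-- The algebraic structure of `S(𝔤*) ⊗ Ω(W)`: the Cartan differential `D`, the contractions `ι a`,
the Lie derivatives `L a` of the diagonal action, the derivations `dd a = ∂/∂Θ^a`, and generators,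
namely the `Θ a`, the functions, and their differentials.  The structure constants are
`[ξ_b, ξ_e] = ∑_a c a b e ξ_a`. -/
structure CartanCalculus (A : Type*) [Ring A] [Algebra ℝ A] (m : ℕ) where
  τ : A →ₐ[ℝ] A
  D : A →ₗ[ℝ] A
  ι : Fin m → A →ₗ[ℝ] A
  L : Fin m → A →ₗ[ℝ] A
  dd : Fin m → A →ₗ[ℝ] A
  Θ : Fin m → A
  c : Fin m → Fin m → Fin m → ℝ
  functions : Set A
  τ_τ : ∀ x, τ (τ x) = x
  antiderivation_D : IsAntiderivation τ D
  antiderivation_ι : ∀ a, IsAntiderivation τ (ι a)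
  leibniz_L : ∀ a x y, L a (x * y) = L a x * y + x * L a y
  leibniz_dd : ∀ a x y, dd a (x * y) = dd a x * y + x * dd a y
  even_Θ : ∀ a, EvenElement τ (Θ a)
  D_Θ : ∀ a, D (Θ a) = 0
  ι_Θ : ∀ b a, ι b (Θ a) = 0
  L_Θ : ∀ b a, L b (Θ a) = -∑ e, c a b e • Θ e
  dd_Θ : ∀ b a, dd b (Θ a) = if b = a then 1 else 0
  even_function : ∀ g ∈ functions, EvenElement τ g
  ι_function : ∀ a, ∀ g ∈ functions, ι a g = 0
  dd_function : ∀ a, ∀ g ∈ functions, dd a g = 0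
  L_function : ∀ a, ∀ g ∈ functions, L a g ∈ functions
  ι_D : ∀ a, ∀ g ∈ functions, ι a (D g) = L a g
  dd_D : ∀ a, ∀ g ∈ functions, dd a (D g) = 0
  L_D : ∀ a, ∀ g ∈ functions, L a (D g) = D (L a g)
  D_D : ∀ g ∈ functions, D (D g) = -∑ a, Θ a * L a g
  L_L : ∀ a b, ∀ g ∈ functions, L a (L b g) - L b (L a g) = ∑ e, c e a b • L e g
  antisymm : ∀ a b e, c a b e = -c a e b
  jacobi : ∀ a b p q, ∑ e, (c a b e * c e p q + c a p e * c e q b + c a q e * c e b p) = 0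
  generates : Algebra.adjoin ℝ (Set.range Θ ∪ functions ∪ D '' functions) = ⊤

namespace CartanCalculus

variable {A : Type*} [Ring A] [Algebra ℝ A] {m : ℕ} (𝒞 : CartanCalculus A m)

lemma eq_of_eq_on_generators {T : Type*} [Ring T] [Algebra ℝ T] {u v : A →ₐ[ℝ] T}
    {Φ Ψ : A →ₗ[ℝ] T}
    (hΦ : ∀ x y, Φ (x * y) = Φ x * u y + v x * Φ y)
    (hΨ : ∀ x y, Ψ (x * y) = Ψ x * u y + v x * Ψ y)
    (hΘ : ∀ a, Φ (𝒞.Θ a) = Ψ (𝒞.Θ a)) (h0 : ∀ g ∈ 𝒞.functions, Φ g = Ψ g)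
    (h1 : ∀ g ∈ 𝒞.functions, Φ (𝒞.D g) = Ψ (𝒞.D g)) (x : A) : Φ x = Ψ x := by
  refine LinearMap.congr_fun (ext_of_twisted_leibniz hΦ hΨ 𝒞.generates ?_) x
  rintro _ ((⟨a, rfl⟩ | hg) | ⟨g, hg, rfl⟩)
  · exact hΘ a
  · exact h0 _ hg
  · exact h1 g hg

lemma algHom_ext {T : Type*} [Ring T] [Algebra ℝ T] {φ ψ : A →ₐ[ℝ] T}
    (hΘ : ∀ a, φ (𝒞.Θ a) = ψ (𝒞.Θ a)) (h0 : ∀ g ∈ 𝒞.functions, φ g = ψ g)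
    (h1 : ∀ g ∈ 𝒞.functions, φ (𝒞.D g) = ψ (𝒞.D g)) : φ = ψ := by
  refine AlgHom.ext_of_adjoin_eq_top 𝒞.generates ?_
  rintro _ ((⟨a, rfl⟩ | hg) | ⟨g, hg, rfl⟩)
  · exact hΘ a
  · exact h0 _ hg
  · exact h1 g hg

lemma odd_D {g : A} (hg : g ∈ 𝒞.functions) : OddElement 𝒞.τ (𝒞.D g) :=
  𝒞.antiderivation_D.oddElement (𝒞.even_function g hg)

lemma sum_c_Θ_mul_Θ (a : Fin m) : ∑ b, ∑ e, 𝒞.c a b e • (𝒞.Θ b * 𝒞.Θ e) = 0 := by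
  set S := ∑ b, ∑ e, 𝒞.c a b e • (𝒞.Θ b * 𝒞.Θ e) with hS
  have h : S = -S := by
    nth_rw 1 [hS]
    rw [Finset.sum_comm, hS, ← Finset.sum_neg_distrib]
    refine Finset.sum_congr rfl fun b _ => ?_
    rw [← Finset.sum_neg_distrib]
    refine Finset.sum_congr rfl fun e _ => ?_
    rw [𝒞.antisymm, (𝒞.even_Θ b).comm, neg_smul]
  have h2 : (2 : ℝ) • S = 0 := by
    rw [two_smul]; nth_rw 1 [h]; simp
  exact (smul_eq_zero.mp h2).resolve_left (by norm_num)

/-- `[∂/∂Θ^a, D] = -ι_a`. -/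
lemma dd_comm_D (a : Fin m) (x : A) : 𝒞.dd a (𝒞.D x) = 𝒞.D (𝒞.dd a x) - 𝒞.ι a x := by
  have h := 𝒞.eq_of_eq_on_generators (u := AlgHom.id ℝ A) (v := 𝒞.τ)
    (Φ := 𝒞.dd a ∘ₗ 𝒞.D - 𝒞.D ∘ₗ 𝒞.dd a) (Ψ := - 𝒞.ι a) ?_ ?_ ?_ ?_ ?_ x
  · simp only [LinearMap.sub_apply, LinearMap.comp_apply, LinearMap.neg_apply] at h
    rw [sub_eq_iff_eq_add] at h
    rw [h]; abel
  · intro x y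
    have : ∀ x, 𝒞.dd a (𝒞.τ x) = 𝒞.τ (𝒞.dd a x) := fun x => by
      refine 𝒞.eq_of_eq_on_generators (u := 𝒞.τ) (v := 𝒞.τ) (Φ := 𝒞.dd a ∘ₗ 𝒞.τ.toLinearMap)
        (Ψ := 𝒞.τ.toLinearMap ∘ₗ 𝒞.dd a) ?_ ?_ ?_ ?_ ?_ x
      · intro x y; simp [𝒞.leibniz_dd]
      · intro x y; simp [𝒞.leibniz_dd]
      · intro b; simp [(𝒞.even_Θ b).grade, 𝒞.dd_Θ, apply_ite 𝒞.τ]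
      · intro g hg; simp [(𝒞.even_function g hg).grade, 𝒞.dd_function a g hg]
      · intro g hg; simp [(𝒞.odd_D hg).grade, 𝒞.dd_D a g hg]
    simp only [LinearMap.sub_apply, LinearMap.comp_apply, 𝒞.antiderivation_D.leibniz,
      𝒞.leibniz_dd, map_add, this, AlgHom.id_apply]
    noncomm_ring
  · intro x y
    simp only [LinearMap.neg_apply, (𝒞.antiderivation_ι a).leibniz, AlgHom.id_apply]
    noncomm_ring
  · intro b
    simp [𝒞.D_Θ, 𝒞.dd_Θ, 𝒞.ι_Θ, apply_ite 𝒞.D, 𝒞.antiderivation_D.map_one]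
  · intro g hg
    simp [𝒞.dd_D a g hg, 𝒞.dd_function a g hg, 𝒞.ι_function a g hg]
  · intro g hg
    simp [𝒞.dd_D a g hg, 𝒞.D_D g hg, 𝒞.ι_D a g hg, 𝒞.leibniz_dd, 𝒞.dd_Θ,
      fun b => 𝒞.dd_function a _ (𝒞.L_function b g hg)]

/-- `[L_b, ∂/∂Θ^a] = ∑_e c_{ba}^e ∂/∂Θ^e`. -/
lemma L_comm_dd (a b : Fin m) (x : A) :
    𝒞.L b (𝒞.dd a x) = 𝒞.dd a (𝒞.L b x) + ∑ e, 𝒞.c e b a • 𝒞.dd e x := by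
  have h := 𝒞.eq_of_eq_on_generators (u := AlgHom.id ℝ A) (v := AlgHom.id ℝ A)
    (Φ := 𝒞.L b ∘ₗ 𝒞.dd a - 𝒞.dd a ∘ₗ 𝒞.L b) (Ψ := ∑ e, 𝒞.c e b a • 𝒞.dd e) ?_ ?_ ?_ ?_ ?_ x
  · simp only [LinearMap.sub_apply, LinearMap.comp_apply, LinearMap.sum_apply,
      LinearMap.smul_apply] at h
    rw [sub_eq_iff_eq_add] at h
    rw [h]; abel
  · intro x y
    simp only [LinearMap.sub_apply, LinearMap.comp_apply, 𝒞.leibniz_L,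
      𝒞.leibniz_dd, map_add, AlgHom.id_apply]
    noncomm_ring
  · intro x y
    simp only [LinearMap.sum_apply, LinearMap.smul_apply, 𝒞.leibniz_dd, AlgHom.id_apply,
      Finset.sum_mul, Finset.mul_sum, ← Finset.sum_add_distrib]
    refine Finset.sum_congr rfl fun e _ => ?_
    rw [smul_add, smul_mul_assoc, mul_smul_comm]
  · intro e
    have h1 : 𝒞.L b 1 = 0 := by simpa using 𝒞.leibniz_L b 1 1
    simp [𝒞.dd_Θ, 𝒞.L_Θ, apply_ite (𝒞.L b), h1]
  · intro g hg
    simp [fun a => 𝒞.dd_function a g hg, 𝒞.dd_function a _ (𝒞.L_function b g hg)]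
  · intro g hg
    simp [fun a => 𝒞.dd_D a g hg, 𝒞.L_D b g hg, 𝒞.dd_D a _ (𝒞.L_function b g hg)]

/-- `D² = -∑ Θ^a L_a`. -/
lemma D_sq (x : A) : 𝒞.D (𝒞.D x) = -∑ a, 𝒞.Θ a * 𝒞.L a x := by
  have h := 𝒞.eq_of_eq_on_generators (u := AlgHom.id ℝ A) (v := AlgHom.id ℝ A)
    (Φ := 𝒞.D ∘ₗ 𝒞.D) (Ψ := -∑ a, LinearMap.mulLeft ℝ (𝒞.Θ a) ∘ₗ 𝒞.L a) ?_ ?_ ?_ ?_ ?_ x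
  · simpa using h
  · intro x y
    simp only [LinearMap.comp_apply, 𝒞.antiderivation_D.leibniz, map_add,
      𝒞.antiderivation_D.grade, AlgHom.id_apply, 𝒞.τ_τ]
    noncomm_ring
  · intro x y
    simp only [LinearMap.neg_apply, LinearMap.sum_apply, LinearMap.comp_apply,
      LinearMap.mulLeft_apply, 𝒞.leibniz_L, AlgHom.id_apply, neg_mul, mul_neg, Finset.sum_mul,
      Finset.mul_sum, ← neg_add, ← Finset.sum_add_distrib]
    congr 1
    refine Finset.sum_congr rfl fun e _ => ?_
    rw [mul_add, ← mul_assoc, ← mul_assoc, ← mul_assoc, (𝒞.even_Θ e).comm x]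
  · intro a
    have := 𝒞.sum_c_Θ_mul_Θ a
    simp only [LinearMap.comp_apply, 𝒞.D_Θ, map_zero, LinearMap.neg_apply, LinearMap.sum_apply,
      LinearMap.mulLeft_apply, 𝒞.L_Θ, mul_neg, Finset.sum_neg_distrib, neg_neg, Finset.mul_sum,
      mul_smul_comm, this]
  · intro g hg
    simp [𝒞.D_D g hg]
  · intro g hg
    simp [𝒞.D_D g hg, 𝒞.L_D _ g hg, 𝒞.antiderivation_D.leibniz, 𝒞.D_Θ, (𝒞.even_Θ _).grade]

/-- The components of an equivariant `𝔤`-valued odd element. -/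
structure IsConnectionForm (η : Fin m → A) : Prop where
  odd : ∀ a, OddElement 𝒞.τ (η a)
  L_eq : ∀ b a, 𝒞.L b (η a) = -∑ e, 𝒞.c a b e • η e

open Polynomial in
/-- The algebra homomorphism `A → ℝ[X] ⊗ A` given by `Θ ↦ X Dη + ½ X² [η, η] + Θ`, `g ↦ g`, and
`dg ↦ dg - ∑ X η^a L_a g` for functions `g`. -/
structure IsTwist (η : Fin m → A) (R : A →ₐ[ℝ] ℝ[X] ⊗[ℝ] A) : Prop where
  Θ : ∀ a, R (𝒞.Θ a) = X ⊗ₜ 𝒞.D (η a) +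
    (X ^ 2) ⊗ₜ ((1 / 2 : ℝ) • ∑ b, ∑ e, 𝒞.c a b e • (η b * η e)) + 1 ⊗ₜ 𝒞.Θ a
  function : ∀ g ∈ 𝒞.functions, R g = 1 ⊗ₜ g
  D : ∀ g ∈ 𝒞.functions, R (𝒞.D g) = 1 ⊗ₜ 𝒞.D g - X ⊗ₜ ∑ a, η a * 𝒞.L a g

variable {𝒞} {η : Fin m → A} {R : A →ₐ[ℝ] Polynomial ℝ ⊗[ℝ] A}

lemma IsConnectionForm.even_D (hη : 𝒞.IsConnectionForm η) (a : Fin m) :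
    EvenElement 𝒞.τ (𝒞.D (η a)) :=
  𝒞.antiderivation_D.evenElement 𝒞.τ_τ (hη.odd a)

lemma IsConnectionForm.D_D (hη : 𝒞.IsConnectionForm η) (a : Fin m) :
    𝒞.D (𝒞.D (η a)) = ∑ b, ∑ e, 𝒞.c a b e • (𝒞.Θ b * η e) := by
  simp [D_sq, hη.L_eq, Finset.mul_sum]

lemma IsConnectionForm.even_bracket (hη : 𝒞.IsConnectionForm η) (a : Fin m) :
    EvenElement 𝒞.τ (∑ b, ∑ e, 𝒞.c a b e • (η b * η e)) :=
  .sum _ fun b _ => .sum _ fun e _ => .smul _ ((hη.odd b).mul 𝒞.τ_τ (hη.odd e))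

lemma IsConnectionForm.jacobi (hη : 𝒞.IsConnectionForm η) (a : Fin m) :
    ∑ b, ∑ e, 𝒞.c a b e • (η b * ∑ p, ∑ q, 𝒞.c e p q • (η p * η q)) = 0 := by
  set J : Fin m → Fin m → Fin m → ℝ := fun b p q => ∑ e, 𝒞.c a b e * 𝒞.c e p q with hJ
  set S := ∑ b, ∑ p, ∑ q, J b p q • (η b * (η p * η q)) with hS
  have h0 : ∑ b, ∑ e, 𝒞.c a b e • (η b * ∑ p, ∑ q, 𝒞.c e p q • (η p * η q)) = S := by
    rw [hS]
    refine Finset.sum_congr rfl fun b _ => ?_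
    simp only [Finset.mul_sum, Finset.smul_sum, hJ, Finset.sum_smul, mul_smul_comm, smul_smul]
    rw [Finset.sum_comm]
    refine Finset.sum_congr rfl fun p _ => ?_
    rw [Finset.sum_comm]
  have cyc : ∀ b p q, η p * (η q * η b) = η b * (η p * η q) := fun b p q => by
    rw [← mul_assoc, ((hη.odd p).mul 𝒞.τ_τ (hη.odd q)).comm]
  have rot : ∀ F : Fin m → Fin m → Fin m → A,
      ∑ b, ∑ p, ∑ q, F b p q = ∑ b, ∑ p, ∑ q, F p q b := fun F => by
    symm
    rw [Finset.sum_comm]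
    exact Finset.sum_congr rfl fun p _ => Finset.sum_comm
  have h1 : S = ∑ b, ∑ p, ∑ q, J p q b • (η b * (η p * η q)) := by
    rw [hS, rot]
    simp only [cyc]
  have h2 : S = ∑ b, ∑ p, ∑ q, J q b p • (η b * (η p * η q)) := by
    rw [h1, rot]
    simp only [cyc]
  have h3 : (3 : ℝ) • S = 0 := by
    have : (3 : ℝ) • S = S + S + S := by
      rw [show (3 : ℝ) = 1 + 1 + 1 by norm_num, add_smul, add_smul, one_smul]
    rw [this]
    nth_rw 2 [h1]
    nth_rw 2 [h2]
    rw [hS]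
    simp only [← Finset.sum_add_distrib, ← add_smul]
    refine Finset.sum_eq_zero fun b _ => Finset.sum_eq_zero fun p _ =>
      Finset.sum_eq_zero fun q _ => ?_
    simp only [hJ, ← Finset.sum_add_distrib]
    rw [𝒞.jacobi, zero_smul]
  rw [h0]
  exact (smul_eq_zero.mp h3).resolve_left (by norm_num)

open Polynomial in
lemma IsTwist.grade (hη : 𝒞.IsConnectionForm η) (hR : 𝒞.IsTwist η R) (x : A) :
    R (𝒞.τ x) = extendAlg ℝ[X] 𝒞.τ (R x) := by
  refine DFunLike.congr_fun (𝒞.algHom_ext (φ := R.comp 𝒞.τ)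
    (ψ := (extendAlg ℝ[X] 𝒞.τ).comp R) ?_ ?_ ?_) x
  · intro a
    simp only [AlgHom.comp_apply, (𝒞.even_Θ a).grade, hR.Θ, map_add,
      Algebra.TensorProduct.map_tmul, AlgHom.id_apply, (hη.even_D a).grade,
      ((hη.even_bracket a).smul (1 / 2)).grade]
  · intro g hg
    simp [(𝒞.even_function g hg).grade, hR.function g hg]
  · intro g hg
    simp [(𝒞.odd_D hg).grade, hR.D g hg, fun a => (hη.odd a).grade,
      fun a => (𝒞.even_function _ (𝒞.L_function a g hg)).grade, TensorProduct.tmul_neg]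
    abel

lemma IsConnectionForm.D_bracket (hη : 𝒞.IsConnectionForm η) (a : Fin m) :
    𝒞.D ((1 / 2 : ℝ) • ∑ b, ∑ e, 𝒞.c a b e • (η b * η e)) =
      -∑ b, ∑ e, 𝒞.c a b e • (η b * 𝒞.D (η e)) := by
  have h1 : ∑ b, ∑ e, 𝒞.c a b e • (𝒞.D (η b) * η e) =
      -∑ b, ∑ e, 𝒞.c a b e • (η b * 𝒞.D (η e)) := by
    rw [Finset.sum_comm, ← Finset.sum_neg_distrib]
    refine Finset.sum_congr rfl fun b _ => ?_
    rw [← Finset.sum_neg_distrib]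
    refine Finset.sum_congr rfl fun e _ => ?_
    rw [𝒞.antisymm, (hη.even_D e).comm, neg_smul]
  simp only [map_smul, map_sum, 𝒞.antiderivation_D.leibniz, (hη.odd _).grade, neg_mul, smul_add,
    Finset.sum_add_distrib, h1, smul_neg, Finset.sum_neg_distrib]
  rw [← neg_add, ← add_smul]
  norm_num

open Polynomial in
/-- The failure of the twist to commute with `D` is a combination of Lie derivatives. -/
theorem IsTwist.D_comm (hη : 𝒞.IsConnectionForm η) (hR : 𝒞.IsTwist η R) (x : A) :
    𝒞.D.lTensor ℝ[X] (R x) = R (𝒞.D x) + ∑ a, X ⊗ₜ η a * R (𝒞.L a x) := by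
  have hD := 𝒞.antiderivation_D.lTensor (P := ℝ[X])
  have h := 𝒞.eq_of_eq_on_generators (u := R) (v := R.comp 𝒞.τ)
    (Φ := 𝒞.D.lTensor ℝ[X] ∘ₗ R.toLinearMap - R.toLinearMap ∘ₗ 𝒞.D)
    (Ψ := ∑ a, LinearMap.mulLeft ℝ (X ⊗ₜ η a) ∘ₗ R.toLinearMap ∘ₗ 𝒞.L a) ?_ ?_ ?_ ?_ ?_ x
  · simp only [LinearMap.sub_apply, LinearMap.comp_apply, LinearMap.sum_apply,
      AlgHom.toLinearMap_apply, LinearMap.mulLeft_apply, sub_eq_iff_eq_add'] at h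
    exact h
  · intro x y
    simp only [LinearMap.sub_apply, LinearMap.comp_apply, AlgHom.toLinearMap_apply, map_mul,
      hD.leibniz, 𝒞.antiderivation_D.leibniz, map_add, AlgHom.comp_apply, hR.grade hη,
      sub_mul, mul_sub]
    abel
  · intro x y
    simp only [LinearMap.sum_apply, LinearMap.comp_apply, AlgHom.toLinearMap_apply,
      LinearMap.mulLeft_apply, 𝒞.leibniz_L, map_add, map_mul, AlgHom.comp_apply, hR.grade hη,
      Finset.sum_mul, Finset.mul_sum, ← Finset.sum_add_distrib]
    refine Finset.sum_congr rfl fun a _ => ?_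
    rw [← mul_assoc, ← mul_assoc, ← mul_assoc, ((hη.odd a).tmul (X : ℝ[X])).comm (R x)]
  · intro a
    simp only [LinearMap.sub_apply, LinearMap.sum_apply, LinearMap.comp_apply,
      AlgHom.toLinearMap_apply, LinearMap.mulLeft_apply, 𝒞.D_Θ, map_zero, sub_zero, 𝒞.L_Θ,
      map_neg, map_sum, map_smul, hR.Θ, map_add, LinearMap.lTensor_tmul, hη.D_D,
      TensorProduct.tmul_zero, add_zero, hη.D_bracket]
    have key : ∀ (p : ℝ[X]) (z : Fin m → A), ∑ b, ∑ e, 𝒞.c a b e • (X ⊗ₜ η b * p ⊗ₜ[ℝ] z e) =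
        (X * p) ⊗ₜ[ℝ] ∑ b, ∑ e, 𝒞.c a b e • (η b * z e) := fun p z => by
      simp only [TensorProduct.tmul_sum, TensorProduct.tmul_smul,
        Algebra.TensorProduct.tmul_mul_tmul]
    have e1 : ∑ b, ∑ e, 𝒞.c a b e • (η b * 𝒞.Θ e) =
        -∑ b, ∑ e, 𝒞.c a b e • (𝒞.Θ b * η e) := by
      rw [Finset.sum_comm, ← Finset.sum_neg_distrib]
      refine Finset.sum_congr rfl fun b _ => ?_
      rw [← Finset.sum_neg_distrib]
      refine Finset.sum_congr rfl fun e _ => ?_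
      rw [𝒞.antisymm, (𝒞.even_Θ b).comm, neg_smul]
    have e2 : ∑ b, ∑ e, 𝒞.c a b e • (η b * ((1 / 2 : ℝ) • ∑ p, ∑ q, 𝒞.c e p q • (η p * η q))) =
        0 := by
      have := congrArg ((1 / 2 : ℝ) • ·) (hη.jacobi a)
      simp only [Finset.smul_sum, smul_zero] at this
      rw [← this]
      refine Finset.sum_congr rfl fun b _ => Finset.sum_congr rfl fun e _ => ?_
      rw [smul_comm, mul_smul_comm]
    simp only [smul_add, Finset.sum_add_distrib, key,
      Finset.sum_neg_distrib, e1, e2, TensorProduct.tmul_neg, TensorProduct.tmul_zero]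
    simp only [sq, mul_one, add_zero, neg_add, neg_neg]
    abel
  · intro g hg
    simp [hR.function g hg, hR.D g hg, hR.function _ (𝒞.L_function _ g hg), TensorProduct.tmul_sum]
  · intro g hg
    simp only [LinearMap.sub_apply, LinearMap.sum_apply, LinearMap.comp_apply,
      AlgHom.toLinearMap_apply, LinearMap.mulLeft_apply, 𝒞.D_D g hg, 𝒞.L_D _ g hg, hR.D g hg,
      hR.D _ (𝒞.L_function _ g hg), map_neg, map_sum, map_sub, map_mul,
      hR.Θ, hR.function _ (𝒞.L_function _ g hg), LinearMap.lTensor_tmul,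
      𝒞.antiderivation_D.leibniz, (hη.odd _).grade]
    have key : ∀ (p : ℝ[X]) (z : Fin m → A), ∑ a, X ⊗ₜ η a * p ⊗ₜ[ℝ] z a =
        (X * p) ⊗ₜ[ℝ] ∑ a, η a * z a := fun p z => by
      simp [TensorProduct.tmul_sum]
    have key' : ∀ (p : ℝ[X]) (z : Fin m → A), ∑ a, p ⊗ₜ z a * 1 ⊗ₜ[ℝ] 𝒞.L a g =
        p ⊗ₜ[ℝ] ∑ a, z a * 𝒞.L a g := fun p z => by
      simp [TensorProduct.tmul_sum]
    have e1 : ∑ a, η a * ∑ b, η b * 𝒞.L b (𝒞.L a g) =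
        -∑ a, ((1 / 2 : ℝ) • ∑ b, ∑ e, 𝒞.c a b e • (η b * η e)) * 𝒞.L a g := by
      set S := ∑ a, ∑ b, η a * (η b * 𝒞.L b (𝒞.L a g)) with hS
      have hS' : S = -∑ a, ∑ b, η a * (η b * 𝒞.L a (𝒞.L b g)) := by
        rw [hS, Finset.sum_comm, ← Finset.sum_neg_distrib]
        refine Finset.sum_congr rfl fun a _ => ?_
        rw [← Finset.sum_neg_distrib]
        refine Finset.sum_congr rfl fun b _ => ?_
        rw [← mul_assoc, (hη.odd b).mul_anticomm (hη.odd a), neg_mul, mul_assoc]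
      have h2 : (2 : ℝ) • S = -∑ a, (∑ b, ∑ e, 𝒞.c a b e • (η b * η e)) * 𝒞.L a g := by
        rw [two_smul]
        nth_rw 2 [hS']
        rw [hS, ← sub_eq_add_neg]
        simp only [← Finset.sum_sub_distrib, ← mul_sub]
        have : ∀ a b, 𝒞.L b (𝒞.L a g) - 𝒞.L a (𝒞.L b g) = -∑ e, 𝒞.c e a b • 𝒞.L e g := by
          intro a b
          rw [← 𝒞.L_L a b g hg]; abel
        simp only [this, mul_neg, Finset.sum_neg_distrib, Finset.mul_sum, Finset.sum_mul,
          mul_smul_comm, smul_mul_assoc, mul_assoc]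
        congr 1
        symm
        rw [Finset.sum_comm]
        exact Finset.sum_congr rfl fun b _ => Finset.sum_comm
      have h3 : S = (1 / 2 : ℝ) • (2 : ℝ) • S := by rw [smul_smul]; norm_num
      simp only [Finset.mul_sum]
      rw [← hS, h3, h2, smul_neg, Finset.smul_sum]
      simp only [smul_mul_assoc]
    simp only [Finset.sum_sub_distrib, key, e1, add_mul, Finset.sum_add_distrib, key']
    simp [TensorProduct.tmul_neg, TensorProduct.tmul_add, sq]
    abel

open Polynomial in
/-- The derivative of the twist with respect to the parameter. -/
theorem IsTwist.derivative (hη : 𝒞.IsConnectionForm η) (hR : 𝒞.IsTwist η R) (x : A) :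
    (Polynomial.derivative (R := ℝ)).rTensor A (R x) =
      ∑ a, (1 ⊗ₜ 𝒞.D (η a) + X ⊗ₜ ∑ b, ∑ e, 𝒞.c a b e • (η b * η e)) * R (𝒞.dd a x) -
      ∑ a, (1 : ℝ[X]) ⊗ₜ η a * R (𝒞.ι a x) := by
  have hδ := leibniz_rTensor (A := A) (δ := (Polynomial.derivative (R := ℝ)))
    (fun a b => by rw [Polynomial.derivative_mul])
  have h := 𝒞.eq_of_eq_on_generators (u := R) (v := R)
    (Φ := (Polynomial.derivative (R := ℝ)).rTensor A ∘ₗ R.toLinearMap)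
    (Ψ := ∑ a, LinearMap.mulLeft ℝ
        (1 ⊗ₜ 𝒞.D (η a) + X ⊗ₜ ∑ b, ∑ e, 𝒞.c a b e • (η b * η e)) ∘ₗ R.toLinearMap ∘ₗ 𝒞.dd a -
      ∑ a, LinearMap.mulLeft ℝ ((1 : ℝ[X]) ⊗ₜ η a) ∘ₗ R.toLinearMap ∘ₗ 𝒞.ι a) ?_ ?_ ?_ ?_ ?_ x
  · simpa only [LinearMap.sub_apply, LinearMap.comp_apply, LinearMap.sum_apply,
      AlgHom.toLinearMap_apply, LinearMap.mulLeft_apply] using h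
  · intro x y
    simp only [LinearMap.comp_apply, AlgHom.toLinearMap_apply, map_mul, hδ]
  · intro x y
    simp only [LinearMap.sub_apply, LinearMap.comp_apply, LinearMap.sum_apply,
      AlgHom.toLinearMap_apply, LinearMap.mulLeft_apply]
    have e1 : ∀ a, ((1 : ℝ[X]) ⊗ₜ 𝒞.D (η a) + X ⊗ₜ ∑ b, ∑ e, 𝒞.c a b e • (η b * η e)) *
        R (𝒞.dd a (x * y)) =
        (1 ⊗ₜ 𝒞.D (η a) + X ⊗ₜ ∑ b, ∑ e, 𝒞.c a b e • (η b * η e)) * R (𝒞.dd a x) * R y +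
        R x * ((1 ⊗ₜ 𝒞.D (η a) + X ⊗ₜ ∑ b, ∑ e, 𝒞.c a b e • (η b * η e)) * R (𝒞.dd a y)) := by
      intro a
      have h1 := (((hη.even_D a).tmul (1 : ℝ[X])).add ((hη.even_bracket a).tmul X)).comm (R x)
      rw [𝒞.leibniz_dd, map_add, map_mul, map_mul, mul_add, ← mul_assoc, ← mul_assoc, h1,
        ← mul_assoc]
    have e2 : ∀ a, (1 : ℝ[X]) ⊗ₜ η a * R (𝒞.ι a (x * y)) =
        (1 : ℝ[X]) ⊗ₜ η a * R (𝒞.ι a x) * R y + R x * ((1 : ℝ[X]) ⊗ₜ η a * R (𝒞.ι a y)) := by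
      intro a
      have h1 := ((hη.odd a).tmul (1 : ℝ[X])).comm (R (𝒞.τ x))
      rw [← hR.grade hη, 𝒞.τ_τ] at h1
      rw [(𝒞.antiderivation_ι a).leibniz, map_add, map_mul, map_mul, mul_add, ← mul_assoc,
        ← mul_assoc, h1, ← mul_assoc]
    simp only [e1, e2, Finset.sum_add_distrib, sub_mul, mul_sub, Finset.sum_mul, Finset.mul_sum]
    abel
  · intro a
    have e : Polynomial.derivative (X ^ 2 : ℝ[X]) = (2 : ℝ) • X := by
      rw [Polynomial.derivative_X_pow, Polynomial.smul_eq_C_mul]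
      simp
    simp only [LinearMap.comp_apply, AlgHom.toLinearMap_apply, LinearMap.sub_apply,
      LinearMap.sum_apply, LinearMap.mulLeft_apply, 𝒞.dd_Θ, 𝒞.ι_Θ, hR.Θ, apply_ite R, map_add,
      LinearMap.rTensor_tmul, e, Polynomial.derivative_X, Polynomial.derivative_one, map_one,
      map_zero, mul_ite, mul_one, mul_zero, TensorProduct.zero_tmul, Finset.sum_const_zero,
      Finset.sum_ite_eq', Finset.mem_univ, if_true, TensorProduct.smul_tmul, smul_smul]
    norm_num
  · intro g hg
    simp [hR.function g hg, 𝒞.dd_function _ g hg, 𝒞.ι_function _ g hg]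
  · intro g hg
    simp [hR.D g hg, 𝒞.dd_D _ g hg, 𝒞.ι_D _ g hg, hR.function _ (𝒞.L_function _ g hg),
      TensorProduct.tmul_sum]

end CartanCalculus

open Polynomial in
/-- The evaluation `ℝ[X] ⊗ A → A` at a real number. -/
def evalAt (A : Type*) [Ring A] [Algebra ℝ A] (t : ℝ) : ℝ[X] ⊗[ℝ] A →ₐ[ℝ] A :=
  (Algebra.TensorProduct.lid ℝ A).toAlgHom.comp
    (Algebra.TensorProduct.map (Polynomial.aeval t) (AlgHom.id ℝ A))

open Polynomial in
/-- The integral of a polynomial over the unit interval. -/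
def unitIntegral : ℝ[X] →ₗ[ℝ] ℝ :=
  (Polynomial.basisMonomials ℝ).constr ℝ fun n : ℕ => ((n : ℝ) + 1)⁻¹

open Polynomial in
/-- The integration `ℝ[X] ⊗ A → A` over the unit interval. -/
def integrate (A : Type*) [Ring A] [Algebra ℝ A] : ℝ[X] ⊗[ℝ] A →ₗ[ℝ] A :=
  (TensorProduct.lid ℝ A).toLinearMap ∘ₗ unitIntegral.rTensor A

section Integrate
open Polynomial
variable {A : Type*} [Ring A] [Algebra ℝ A]

@[simp] lemma evalAt_tmul (t : ℝ) (p : ℝ[X]) (a : A) : evalAt A t (p ⊗ₜ a) = p.eval t • a := by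
  simp [evalAt, Polynomial.aeval_def, Polynomial.eval₂_eq_eval_map]

@[simp] lemma integrate_tmul (p : ℝ[X]) (a : A) :
    integrate A (p ⊗ₜ a) = unitIntegral p • a := by
  simp [integrate]

lemma unitIntegral_derivative (p : ℝ[X]) :
    unitIntegral (Polynomial.derivative p) = p.eval 1 - p.eval 0 := by
  have : unitIntegral ∘ₗ (Polynomial.derivative (R := ℝ)) =
      Polynomial.leval 1 - Polynomial.leval 0 := by
    refine (Polynomial.basisMonomials ℝ).ext fun n => ?_
    have h : ∀ (k : ℕ) (r : ℝ), unitIntegral (Polynomial.monomial k r) = r * ((k : ℝ) + 1)⁻¹ := by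
      intro k r
      have : Polynomial.monomial k r = r • Polynomial.basisMonomials ℝ k := by
        simp [Polynomial.smul_monomial]
      rw [this, map_smul, unitIntegral, Module.Basis.constr_basis, smul_eq_mul]
    rcases n with _ | n
    · simp
    · simp only [Polynomial.coe_basisMonomials, LinearMap.comp_apply,
        Polynomial.derivative_monomial, h, LinearMap.sub_apply, Polynomial.leval_apply,
        Polynomial.eval_monomial]
      have : (n : ℝ) + 1 ≠ 0 := by positivity
      simp [this]
  exact LinearMap.congr_fun this p

lemma integrate_derivative (z : ℝ[X] ⊗[ℝ] A) :
    integrate A ((Polynomial.derivative (R := ℝ)).rTensor A z) = evalAt A 1 z - evalAt A 0 z := by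
  induction z using TensorProduct.induction_on with
  | zero => simp
  | add x y hx hy => rw [map_add, map_add, map_add, map_add, hx, hy]; abel
  | tmul p a => simp [unitIntegral_derivative, sub_smul]

lemma integrate_lTensor (D : A →ₗ[ℝ] A) (z : ℝ[X] ⊗[ℝ] A) :
    integrate A (D.lTensor ℝ[X] z) = D (integrate A z) := by
  induction z using TensorProduct.induction_on with
  | zero => simp
  | add x y hx hy => rw [map_add, map_add, map_add, map_add, hx, hy]
  | tmul p a => simp

lemma evalAt_lTensor (t : ℝ) (D : A →ₗ[ℝ] A) (z : ℝ[X] ⊗[ℝ] A) :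
    evalAt A t (D.lTensor ℝ[X] z) = D (evalAt A t z) := by
  induction z using TensorProduct.induction_on with
  | zero => simp
  | add x y hx hy => rw [map_add, map_add, map_add, map_add, hx, hy]
  | tmul p a => simp

end Integrate

namespace CartanCalculus

variable {A : Type*} [Ring A] [Algebra ℝ A] {m : ℕ} {𝒞 : CartanCalculus A m}
 {η : Fin m → A} {R : A →ₐ[ℝ] Polynomial ℝ ⊗[ℝ] A}

lemma IsTwist.evalAt_zero (hR : 𝒞.IsTwist η R) (x : A) : evalAt A 0 (R x) = x := by
  refine DFunLike.congr_fun (𝒞.algHom_ext (φ := (evalAt A 0).comp R) (ψ := AlgHom.id ℝ A)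
    ?_ ?_ ?_) x
  · intro a; simp [hR.Θ]
  · intro g hg; simp [hR.function g hg]
  · intro g hg; simp [hR.D g hg]

lemma IsTwist.evalAt_D_comm (hη : 𝒞.IsConnectionForm η) (hR : 𝒞.IsTwist η R) (t : ℝ) {x : A}
    (hx : ∀ a, 𝒞.L a x = 0) : 𝒞.D (evalAt A t (R x)) = evalAt A t (R (𝒞.D x)) := by
  rw [← evalAt_lTensor, hR.D_comm hη]
  simp [hx]

/-- The integrand of the homotopy between the identity and the twist. -/
def homotopyIntegrand (𝒞 : CartanCalculus A m) (η : Fin m → A)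
    (R : A →ₐ[ℝ] Polynomial ℝ ⊗[ℝ] A) : A →ₗ[ℝ] Polynomial ℝ ⊗[ℝ] A :=
  ∑ a, LinearMap.mulLeft ℝ ((1 : Polynomial ℝ) ⊗ₜ η a) ∘ₗ R.toLinearMap ∘ₗ 𝒞.dd a

lemma homotopyIntegrand_apply (x : A) :
    𝒞.homotopyIntegrand η R x = ∑ a, (1 : Polynomial ℝ) ⊗ₜ η a * R (𝒞.dd a x) := by
  simp [homotopyIntegrand]

open Polynomial in
lemma IsTwist.derivative_eq (hη : 𝒞.IsConnectionForm η) (hR : 𝒞.IsTwist η R) {x : A}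
    (hx : ∀ a, 𝒞.L a x = 0) :
    (Polynomial.derivative (R := ℝ)).rTensor A (R x) =
      𝒞.D.lTensor ℝ[X] (𝒞.homotopyIntegrand η R x) + 𝒞.homotopyIntegrand η R (𝒞.D x) := by
  have hD := 𝒞.antiderivation_D.lTensor (P := ℝ[X])
  have e1 : ∀ a, 𝒞.D.lTensor ℝ[X] ((1 : ℝ[X]) ⊗ₜ η a * R (𝒞.dd a x)) =
      1 ⊗ₜ 𝒞.D (η a) * R (𝒞.dd a x) - 1 ⊗ₜ η a * R (𝒞.D (𝒞.dd a x)) -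
        ∑ b, ∑ e, 𝒞.c e b a • (X ⊗ₜ (η a * η b) * R (𝒞.dd e x)) := by
    intro a
    rw [hD.leibniz, ((hη.odd a).tmul _).grade, tensor_neg_mul, hR.D_comm hη, mul_add, neg_add,
      ← sub_eq_add_neg, ← add_sub_assoc, ← sub_eq_add_neg]
    simp only [LinearMap.lTensor_tmul, L_comm_dd, hx, map_zero, zero_add, map_sum, map_smul,
      Finset.mul_sum, ← mul_assoc, mul_smul_comm, Algebra.TensorProduct.tmul_mul_tmul, one_mul]
  simp only [hR.derivative hη, homotopyIntegrand_apply, map_sum, e1, dd_comm_D, map_sub, mul_sub,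
    Finset.sum_sub_distrib, add_mul, Finset.sum_add_distrib]
  have e2 : ∑ a, (X : ℝ[X]) ⊗ₜ[ℝ] (∑ b, ∑ e, 𝒞.c a b e • (η b * η e)) * R (𝒞.dd a x) =
      -∑ a, ∑ b, ∑ e, 𝒞.c e b a • ((X : ℝ[X]) ⊗ₜ (η a * η b) * R (𝒞.dd e x)) := by
    simp only [TensorProduct.tmul_sum, TensorProduct.tmul_smul, Finset.sum_mul, smul_mul_assoc]
    rw [Finset.sum_comm, eq_comm, Finset.sum_comm, ← Finset.sum_neg_distrib]
    refine Finset.sum_congr rfl fun b _ => ?_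
    rw [Finset.sum_comm, ← Finset.sum_neg_distrib]
    refine Finset.sum_congr rfl fun a _ => ?_
    rw [← Finset.sum_neg_distrib]
    refine Finset.sum_congr rfl fun e _ => ?_
    rw [(hη.odd e).mul_anticomm (hη.odd b), TensorProduct.tmul_neg, tensor_neg_mul, smul_neg,
      neg_neg]
  rw [e2]
  abel

/-- On elements annihilated by the Lie derivatives, the twist is homotopic to the identity. -/
theorem IsTwist.homotopy (hη : 𝒞.IsConnectionForm η) (hR : 𝒞.IsTwist η R) {x : A}
    (hx : ∀ a, 𝒞.L a x = 0) :
    evalAt A 1 (R x) - x = 𝒞.D (integrate A (𝒞.homotopyIntegrand η R x)) +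
      integrate A (𝒞.homotopyIntegrand η R (𝒞.D x)) := by
  rw [← integrate_lTensor, ← map_add, ← hR.derivative_eq hη hx, integrate_derivative,
    hR.evalAt_zero]

end CartanCalculus

end CartanCalculus

namespace CartanCalculus

variable {A : Type*} [Ring A] [Algebra ℝ A] {m : ℕ} {𝒞 : CartanCalculus A m}
 {η : Fin m → A} {R : A →ₐ[ℝ] Polynomial ℝ ⊗[ℝ] A}

/-- The compatibility of an endomorphism of `A` with the structure of a Cartan calculus; `M` is the
matrix of the coadjoint action. -/
structure IsSymmetry (𝒞 : CartanCalculus A m) (η : Fin m → A) (M : Fin m → Fin m → ℝ)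
    (φ : A →ₐ[ℝ] A) : Prop where
  D : ∀ x, φ (𝒞.D x) = 𝒞.D (φ x)
  Θ : ∀ a, φ (𝒞.Θ a) = ∑ b, M a b • 𝒞.Θ b
  connection : ∀ a, φ (η a) = ∑ b, M a b • η b
  mem_functions : ∀ g ∈ 𝒞.functions, φ g ∈ 𝒞.functions
  L : ∀ a, ∀ g ∈ 𝒞.functions, 𝒞.L a (φ g) = ∑ b, M b a • φ (𝒞.L b g)
  dd : ∀ a x, 𝒞.dd a (φ x) = ∑ b, M b a • φ (𝒞.dd b x)
  bracket : ∀ a p q, ∑ b, ∑ e, 𝒞.c a b e * (M b p * M e q) = ∑ d, M a d * 𝒞.c d p q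

variable {M : Fin m → Fin m → ℝ} {φ : A →ₐ[ℝ] A}

lemma IsSymmetry.map_bracket (h : 𝒞.IsSymmetry η M φ) (a : Fin m) :
    φ (∑ b, ∑ e, 𝒞.c a b e • (η b * η e)) =
      ∑ d, M a d • ∑ p, ∑ q, 𝒞.c d p q • (η p * η q) := by
  have e1 : ∀ b e, 𝒞.c a b e • (φ (η b) * φ (η e)) =
      ∑ p, ∑ q, (𝒞.c a b e * (M b p * M e q)) • (η p * η q) := fun b e => by
    simp only [h.connection, Finset.sum_mul_sum, Finset.smul_sum, smul_mul_smul_comm, smul_smul]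
  have e2 : ∑ b, ∑ e, ∑ p, ∑ q, (𝒞.c a b e * (M b p * M e q)) • (η p * η q) =
      ∑ p, ∑ q, ∑ b, ∑ e, (𝒞.c a b e * (M b p * M e q)) • (η p * η q) := by
    calc _ = ∑ b, ∑ p, ∑ e, ∑ q, (𝒞.c a b e * (M b p * M e q)) • (η p * η q) :=
          Finset.sum_congr rfl fun b _ => Finset.sum_comm
      _ = ∑ p, ∑ b, ∑ e, ∑ q, (𝒞.c a b e * (M b p * M e q)) • (η p * η q) := Finset.sum_comm
      _ = ∑ p, ∑ b, ∑ q, ∑ e, (𝒞.c a b e * (M b p * M e q)) • (η p * η q) :=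
          Finset.sum_congr rfl fun p _ => Finset.sum_congr rfl fun b _ => Finset.sum_comm
      _ = _ := Finset.sum_congr rfl fun p _ => Finset.sum_comm
  have e3 : ∑ d, M a d • ∑ p, ∑ q, 𝒞.c d p q • (η p * η q) =
      ∑ p, ∑ q, ∑ d, (M a d * 𝒞.c d p q) • (η p * η q) := by
    simp only [Finset.smul_sum, smul_smul]
    rw [Finset.sum_comm]
    exact Finset.sum_congr rfl fun p _ => Finset.sum_comm
  simp only [map_sum, map_smul, map_mul, e1]
  rw [e2, e3]
  refine Finset.sum_congr rfl fun p _ => Finset.sum_congr rfl fun q _ => ?_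
  simp only [← Finset.sum_smul]
  rw [h.bracket]

lemma IsSymmetry.sum_connection_mul (h : 𝒞.IsSymmetry η M φ) (u v : Fin m → A)
    (huv : ∀ a, u a = ∑ b, M b a • φ (v b)) : ∑ a, η a * u a = φ (∑ a, η a * v a) := by
  simp only [map_sum, map_mul, h.connection, huv, Finset.mul_sum, Finset.sum_mul, mul_smul_comm,
    smul_mul_assoc]
  exact Finset.sum_comm

open Polynomial in
lemma IsSymmetry.twist_comm (h : 𝒞.IsSymmetry η M φ) (hR : 𝒞.IsTwist η R) (x : A) :
    R (φ x) = φ.toLinearMap.lTensor ℝ[X] (R x) := by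
  change _ = extendAlg ℝ[X] φ (R x)
  refine DFunLike.congr_fun (𝒞.algHom_ext (φ := R.comp φ) (ψ := (extendAlg ℝ[X] φ).comp R)
    ?_ ?_ ?_) x
  · intro a
    rw [AlgHom.comp_apply, AlgHom.comp_apply, h.Θ, hR.Θ, map_add, map_add,
      Algebra.TensorProduct.map_tmul, Algebra.TensorProduct.map_tmul,
      Algebra.TensorProduct.map_tmul, map_smul φ, h.map_bracket, h.D, h.connection, h.Θ]
    simp only [map_sum, map_smul, hR.Θ, AlgHom.id_apply, map_one, smul_add,
      Finset.sum_add_distrib, TensorProduct.tmul_sum, TensorProduct.tmul_smul, Finset.smul_sum]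
    simp only [smul_comm (1 / 2 : ℝ)]
  · intro g hg
    simp [hR.function g hg, hR.function _ (h.mem_functions g hg)]
  · intro g hg
    simp only [AlgHom.comp_apply, h.D, hR.D g hg, hR.D _ (h.mem_functions g hg), map_sub,
      Algebra.TensorProduct.map_tmul, AlgHom.id_apply]
    rw [h.sum_connection_mul _ _ fun a => h.L a g hg]

lemma IsSymmetry.evalAt_comm (h : 𝒞.IsSymmetry η M φ) (hR : 𝒞.IsTwist η R) (t : ℝ) (x : A) :
    evalAt A t (R (φ x)) = φ (evalAt A t (R x)) := by
  rw [h.twist_comm hR, evalAt_lTensor]; rfl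

open Polynomial in
lemma IsSymmetry.homotopy_comm (h : 𝒞.IsSymmetry η M φ) (hR : 𝒞.IsTwist η R) (x : A) :
    integrate A (𝒞.homotopyIntegrand η R (φ x)) =
      φ (integrate A (𝒞.homotopyIntegrand η R x)) := by
  refine Eq.trans ?_ (integrate_lTensor φ.toLinearMap _)
  congr 1
  change _ = extendAlg ℝ[X] φ _
  have e : ∀ x, R (φ x) = extendAlg ℝ[X] φ (R x) := h.twist_comm hR
  simp only [homotopyIntegrand_apply, map_sum, map_mul, Algebra.TensorProduct.map_tmul,
    AlgHom.id_apply, h.connection, h.dd, map_smul, e, TensorProduct.tmul_sum,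
    TensorProduct.tmul_smul, Finset.sum_mul, Finset.mul_sum, smul_mul_assoc, mul_smul_comm]
  exact Finset.sum_comm

end CartanCalculus

section FormCalculus
set_option linter.unusedSectionVars false

variable {E : Type*} [NormedAddCommGroup E] [NormedSpace ℝ E] [FiniteDimensional ℝ E]
  {H : Type*} [TopologicalSpace H] {I : ModelWithCorners ℝ E H}
  {M : Type*} [TopologicalSpace M] [ChartedSpace H M] [IsManifold I ∞ M]

/-- A smooth function as a differential form of degree `0`. -/
def ofFun (g : M → ℝ) (hg : ContMDiff I 𝓘(ℝ, ℝ) ∞ g) : DifferentialForm I M :=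
  .mk I (funForm g) fun _ => ⟨Set.univ, isOpen_univ, trivial, _,
    funForm_mem hg.contMDiffOn, fun _ _ => rfl⟩

@[simp] lemma val_ofFun (g : M → ℝ) (hg : ContMDiff I 𝓘(ℝ, ℝ) ∞ g) :
    (ofFun g hg).val = funForm g := rfl

variable (I M) in
/-- The grading involution of `Ω(M)`. -/
def grading : DifferentialForm I M →ₐ[ℝ] DifferentialForm I M where
  toFun α := .mk I (fun x => CliffordAlgebra.involute (α.val x)) fun x => by
    obtain ⟨U, hU, xU, β, hβ, e⟩ := α.smoothAt x
    exact ⟨U, hU, xU, _, involute_mem_localForms hβ, fun z hz => by simp only [e hz]⟩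
  map_one' := DifferentialForm.ext fun x => by
    simp only [DifferentialForm.val_mk, map_one, Pi.one_apply]
  map_mul' α β := DifferentialForm.ext fun x => by
    simp only [DifferentialForm.val_mk, map_mul, Pi.mul_apply]
  map_zero' := DifferentialForm.ext fun x => by
    simp only [DifferentialForm.val_mk, map_zero, Pi.zero_apply]
  map_add' α β := DifferentialForm.ext fun x => by
    simp only [DifferentialForm.val_mk, map_add, Pi.add_apply]
  commutes' r := DifferentialForm.ext fun x => by
    simp only [DifferentialForm.val_mk, AlgHom.commutes, Pi.algebraMap_apply]

lemma val_grading (α : DifferentialForm I M) (x : M) :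
    (grading I M α).val x = CliffordAlgebra.involute (α.val x) := rfl

lemma grading_grading (α : DifferentialForm I M) : grading I M (grading I M α) = α :=
  DifferentialForm.ext fun x => by
    rw [val_grading, val_grading, CliffordAlgebra.involute_involute]

lemma extDeriv_mul (α β : DifferentialForm I M) :
    extDeriv I M (α * β) = extDeriv I M α * β + grading I M α * extDeriv I M β :=
  DifferentialForm.ext fun x => by
    change extDerivAt I (α * β).val x = _
    simp only [map_add, map_mul]
    exact extDerivAt_mul (α.smoothAt x).coeffDiffAt (β.smoothAt x).coeffDiffAt

lemma val_extDeriv_ofFun (g : M → ℝ) (hg : ContMDiff I 𝓘(ℝ, ℝ) ∞ g) :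
    (extDeriv I M (ofFun g hg)).val = diffForm I g :=
  funext fun x => extDerivAt_funForm isOpen_univ (Set.mem_univ x) hg.contMDiffOn

lemma extDeriv_extDeriv_ofFun (g : M → ℝ) (hg : ContMDiff I 𝓘(ℝ, ℝ) ∞ g) :
    extDeriv I M (extDeriv I M (ofFun g hg)) = 0 :=
  DifferentialForm.ext fun x => by
    change extDerivAt I (extDeriv I M (ofFun g hg)).val x = _
    rw [val_extDeriv_ofFun, extDerivAt_diffForm isOpen_univ (Set.mem_univ x) hg.contMDiffOn]
    simp

lemma even_ofFun (g : M → ℝ) (hg : ContMDiff I 𝓘(ℝ, ℝ) ∞ g) :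
    EvenElement (grading I M) (ofFun g hg) where
  grade := DifferentialForm.ext fun x => by
    rw [val_grading, val_ofFun, funForm, AlgHom.commutes]
  comm α := DifferentialForm.ext fun x => by
    rw [map_mul, map_mul]
    exact Algebra.commutes (g x) (α.val x)

/-- Forms of degree `1` are odd. -/
lemma odd_of_degree_one {α : DifferentialForm I M}
    (h : ∀ x, ∃ l : E →L[ℝ] ℝ, α.val x = ExteriorAlgebra.ι ℝ l) :
    OddElement (grading I M) α where
  grade := DifferentialForm.ext fun x => by
    obtain ⟨l, hl⟩ := h x
    rw [val_grading, hl, map_neg, Pi.neg_apply, hl]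
    exact CliffordAlgebra.involute_ι _
  comm β := DifferentialForm.ext fun x => by
    obtain ⟨l, hl⟩ := h x
    rw [map_mul, map_mul, Pi.mul_apply, Pi.mul_apply, val_grading, hl]
    exact ι_mul_eq_involute_mul l _

lemma contractLeft_involute (d : Module.Dual ℝ (E →L[ℝ] ℝ)) (a : CotangentAlgebra E) :
    CliffordAlgebra.contractLeft d (CliffordAlgebra.involute a) =
      -CliffordAlgebra.involute (CliffordAlgebra.contractLeft d a) := by
  induction a using ExteriorAlgebra.induction with
  | algebraMap r =>
    have h1 : CliffordAlgebra.contractLeft d (algebraMap ℝ (CotangentAlgebra E) r) = 0 :=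
      CliffordAlgebra.contractLeft_algebraMap _ d r
    rw [AlgHom.commutes, h1]; simp
  | ι w =>
    have h2 : CliffordAlgebra.contractLeft d (ExteriorAlgebra.ι ℝ w) =
      algebraMap ℝ (CotangentAlgebra E) (d w) := CliffordAlgebra.contractLeft_ι _ d w
    have h : CliffordAlgebra.involute (ExteriorAlgebra.ι ℝ w) = - ExteriorAlgebra.ι ℝ w :=
      CliffordAlgebra.involute_ι _
    rw [h, map_neg, h2, AlgHom.commutes]
  | mul a b ha hb =>
    rw [map_mul, contractLeft_mul, contractLeft_mul, ha, hb, map_add, map_mul, map_mul]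
    noncomm_ring
  | add a b ha hb => simp only [map_add, ha, hb]; abel

lemma antiderivation_contract {X : M → E} (hX : SmoothVectorField (I := I) X) :
    IsAntiderivation (grading I M) (contract X hX) where
  leibniz α β := DifferentialForm.ext fun x => by
    change contractAt X (α * β).val x = _
    simp only [map_add, map_mul]
    exact contractLeft_mul _ _ _
  grade α := DifferentialForm.ext fun x => by
    rw [map_neg]
    exact contractLeft_involute _ _

lemma contract_ofFun {X : M → E} (hX : SmoothVectorField (I := I) X) (g : M → ℝ)
    (hg : ContMDiff I 𝓘(ℝ, ℝ) ∞ g) : contract X hX (ofFun g hg) = 0 :=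
  DifferentialForm.ext fun x => by
    rw [map_zero]
    exact CliffordAlgebra.contractLeft_algebraMap _ _ _

lemma SmoothVectorField.contMDiff {X : M → E} (hX : SmoothVectorField (I := I) X) {g : M → ℝ}
    (hg : ContMDiff I 𝓘(ℝ, ℝ) ∞ g) :
    ContMDiff I 𝓘(ℝ, ℝ) ∞ (fun x => differential I g x (X x)) :=
  contMDiffOn_univ.mp (hX _ g isOpen_univ hg.contMDiffOn)

lemma contract_extDeriv_ofFun {X : M → E} (hX : SmoothVectorField (I := I) X) (g : M → ℝ)
    (hg : ContMDiff I 𝓘(ℝ, ℝ) ∞ g) : contract X hX (extDeriv I M (ofFun g hg)) =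
      ofFun (fun x => differential I g x (X x)) (hX.contMDiff hg) :=
  DifferentialForm.ext fun x => by
    change contractAt X (extDeriv I M (ofFun g hg)).val x = _
    rw [val_extDeriv_ofFun]
    exact CliffordAlgebra.contractLeft_ι _ _ _

lemma pullback_ofFun {φ : M → M} (hφ : ContMDiff I I ∞ φ) (g : M → ℝ)
    (hg : ContMDiff I 𝓘(ℝ, ℝ) ∞ g) :
    pullback φ hφ (ofFun g hg) = ofFun (g ∘ φ) (hg.comp hφ) :=
  DifferentialForm.ext fun _ => AlgHom.commutes _ _

lemma pullback_extDeriv_ofFun {φ : M → M} (hφ : ContMDiff I I ∞ φ) (g : M → ℝ)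
    (hg : ContMDiff I 𝓘(ℝ, ℝ) ∞ g) :
    pullback φ hφ (extDeriv I M (ofFun g hg)) = extDeriv I M (ofFun (g ∘ φ) (hg.comp hφ)) :=
  DifferentialForm.ext fun x => by
    change pullbackAt I φ (extDeriv I M (ofFun g hg)).val x = _
    rw [val_extDeriv_ofFun, val_extDeriv_ofFun, pullbackAt, diffForm, pullbackCovector_ι, diffForm]
    congr 1
    exact (mfderiv_comp x (hg.contMDiffAt.mdifferentiableAt (by simp))
        (hφ.contMDiffAt.mdifferentiableAt (by simp))).symm

variable (I M) in
/-- The smooth functions, as forms of degree `0`. -/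
def functionForms : Set (DifferentialForm I M) :=
  {α | ∃ (g : M → ℝ) (hg : ContMDiff I 𝓘(ℝ, ℝ) ∞ g), α = ofFun g hg}

section Generation

variable [T2Space M]

lemma exists_global_function {U : Set M} (hU : IsOpen U) {x : M} (hx : x ∈ U) {f : M → ℝ}
    (hf : ContMDiffOn I 𝓘(ℝ, ℝ) ∞ f U) :
    ∃ g : M → ℝ, ContMDiff I 𝓘(ℝ, ℝ) ∞ g ∧ g =ᶠ[𝓝 x] f := by
  obtain ⟨χ, -, hχ⟩ := (SmoothBumpFunction.nhds_basis_tsupport (I := I) x).mem_iff.mp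
    (hU.mem_nhds hx)
  refine ⟨fun z => χ z * f z, contMDiff_of_tsupport fun z hz => ?_, ?_⟩
  · have hz' := hχ (tsupport_mul_subset_left hz)
    exact χ.contMDiff.contMDiffAt.mul ((hf z hz').contMDiffAt (hU.mem_nhds hz'))
  · filter_upwards [χ.eventuallyEq_one] with z hz
    simp [hz]

lemma diffForm_eventuallyEq {f g : M → ℝ} {x : M} (h : g =ᶠ[𝓝 x] f) :
    diffForm I g =ᶠ[𝓝 x] diffForm I f :=
  h.eventuallyEq_nhds.mono fun _ hz => diffForm_congr hz

lemma localForms_eventuallyEq_adjoin {U : Set M} (hU : IsOpen U) {x : M} (hx : x ∈ U)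
    {β : M → CotangentAlgebra E} (hβ : β ∈ localForms I U) :
    ∃ γ ∈ Algebra.adjoin ℝ (functionForms I M ∪ extDeriv I M '' functionForms I M),
      γ.val =ᶠ[𝓝 x] β := by
  induction hβ using Algebra.adjoin_induction with
  | mem η h =>
    rcases h with ⟨f, hf, rfl⟩ | ⟨f, hf, rfl⟩
    · obtain ⟨g, hg, e⟩ := exists_global_function hU hx hf
      refine ⟨ofFun g hg, Algebra.subset_adjoin (Or.inl ⟨g, hg, rfl⟩), ?_⟩
      filter_upwards [e] with z hz
      simp [funForm, hz]
    · obtain ⟨g, hg, e⟩ := exists_global_function hU hx hf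
      refine ⟨_, Algebra.subset_adjoin (Or.inr ⟨_, ⟨g, hg, rfl⟩, rfl⟩), ?_⟩
      rw [val_extDeriv_ofFun]
      exact diffForm_eventuallyEq e
  | algebraMap r =>
    exact ⟨algebraMap ℝ _ r, algebraMap_mem _ r, by rw [AlgHom.commutes]⟩
  | add a b _ _ ha hb =>
    obtain ⟨γ, hγ, eγ⟩ := ha
    obtain ⟨δ, hδ, eδ⟩ := hb
    exact ⟨γ + δ, add_mem hγ hδ, by rw [map_add]; exact eγ.add eδ⟩
  | mul a b _ _ ha hb =>
    obtain ⟨γ, hγ, eγ⟩ := ha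
    obtain ⟨δ, hδ, eδ⟩ := hb
    exact ⟨γ * δ, mul_mem hγ hδ, by rw [map_mul]; exact eγ.mul eδ⟩

variable [CompactSpace M]

variable (I M) in
/-- On a compact manifold the algebra of forms is generated by the functions and their
differentials. -/
theorem adjoin_functionForms :
    Algebra.adjoin ℝ (functionForms I M ∪ extDeriv I M '' functionForms I M) = ⊤ := by
  rw [eq_top_iff]
  rintro α -
  have h : ∀ x, ∃ γ ∈ Algebra.adjoin ℝ (functionForms I M ∪ extDeriv I M '' functionForms I M),
      ∃ V : Set M, IsOpen V ∧ x ∈ V ∧ Set.EqOn γ.val α.val V := by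
    intro x
    obtain ⟨U, hU, xU, β, hβ, e⟩ := α.smoothAt x
    obtain ⟨γ, hγ, e'⟩ := localForms_eventuallyEq_adjoin hU xU hβ
    have h2 : ∀ᶠ z in 𝓝 x, γ.val z = α.val z := by
      filter_upwards [e', hU.mem_nhds xU] with z hz zU
      rw [hz, e zU]
    obtain ⟨V, hV, V_open, xV⟩ := mem_nhds_iff.mp h2
    exact ⟨γ, hγ, V, V_open, xV, hV⟩
  choose γ hγ V hV xV e using h
  obtain ⟨t, ht⟩ := isCompact_univ.elim_finite_subcover V hV
    (fun x _ => Set.mem_iUnion.mpr ⟨x, xV x⟩)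
  obtain ⟨ρ, hρ⟩ := SmoothPartitionOfUnity.exists_isSubordinate I (isClosed_univ (X := M))
    (fun i : t => V i) (fun i => hV i) (by
      intro x hx
      obtain ⟨i, hi, hx'⟩ := Set.mem_iUnion₂.mp (ht hx)
      exact Set.mem_iUnion.mpr ⟨⟨i, hi⟩, hx'⟩)
  have key : α = ∑ i : t, ofFun (ρ i) (ρ i).contMDiff * γ i := by
    refine DifferentialForm.ext fun x => ?_
    have h1 := ρ.sum_eq_one (Set.mem_univ x)
    rw [finsum_eq_sum_of_fintype] at h1
    have h2 : ∀ i : t, (ofFun (ρ i) (ρ i).contMDiff * γ i).val x = ρ i x • α.val x := by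
      intro i
      rw [map_mul, Pi.mul_apply, val_ofFun, funForm, ← Algebra.smul_def]
      by_cases hx : x ∈ V i
      · rw [e i hx]
      · have : ρ i x = 0 := by
          by_contra h0
          exact hx (hρ i (subset_tsupport _ h0))
        rw [this, zero_smul, zero_smul]
    rw [map_sum, Finset.sum_apply, Finset.sum_congr rfl fun i _ => h2 i, ← Finset.sum_smul, h1,
      one_smul]
  rw [key]
  exact sum_mem fun i _ => mul_mem (Algebra.subset_adjoin (Or.inl ⟨_, _, rfl⟩)) (hγ i)

lemma forms_ext_of_twisted_leibniz {T : Type*} [Ring T] [Algebra ℝ T]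
    {u v : DifferentialForm I M →ₐ[ℝ] T} {Φ Ψ : DifferentialForm I M →ₗ[ℝ] T}
    (hΦ : ∀ x y, Φ (x * y) = Φ x * u y + v x * Φ y)
    (hΨ : ∀ x y, Ψ (x * y) = Ψ x * u y + v x * Ψ y)
    (h0 : ∀ g hg, Φ (ofFun g hg) = Ψ (ofFun g hg))
    (h1 : ∀ g hg, Φ (extDeriv I M (ofFun g hg)) = Ψ (extDeriv I M (ofFun g hg)))
    (α : DifferentialForm I M) : Φ α = Ψ α := by
  refine LinearMap.congr_fun (ext_of_twisted_leibniz hΦ hΨ (adjoin_functionForms I M) ?_) α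
  rintro _ (⟨g, hg, rfl⟩ | ⟨_, ⟨g, hg, rfl⟩, rfl⟩)
  · exact h0 g hg
  · exact h1 g hg

variable (I M) in
lemma antiderivation_extDeriv : IsAntiderivation (grading I M) (extDeriv I M) where
  leibniz := extDeriv_mul
  grade α := by
    have hodd : ∀ g hg, grading I M (extDeriv I M (ofFun g hg)) =
        -extDeriv I M (ofFun g hg) := fun g hg =>
      (odd_of_degree_one fun x => ⟨_, congrFun (val_extDeriv_ofFun g hg) x⟩).grade
    refine forms_ext_of_twisted_leibniz (u := grading I M) (v := AlgHom.id ℝ _)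
      (Φ := extDeriv I M ∘ₗ (grading I M).toLinearMap)
      (Ψ := -((grading I M).toLinearMap ∘ₗ extDeriv I M)) ?_ ?_ ?_ ?_ α
    · intro x y
      simp [extDeriv_mul, grading_grading]
    · intro x y
      simp only [LinearMap.neg_apply, LinearMap.comp_apply, AlgHom.toLinearMap_apply,
        extDeriv_mul, map_add, map_mul, grading_grading, AlgHom.id_apply]
      noncomm_ring
    · intro g hg
      simp [(even_ofFun g hg).grade, hodd]
    · intro g hg
      simp [hodd, extDeriv_extDeriv_ofFun]

lemma extDeriv_extDeriv (α : DifferentialForm I M) : extDeriv I M (extDeriv I M α) = 0 := by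
  have hd := antiderivation_extDeriv I M
  refine forms_ext_of_twisted_leibniz (u := AlgHom.id ℝ _) (v := AlgHom.id ℝ _)
    (Φ := extDeriv I M ∘ₗ extDeriv I M) (Ψ := 0) ?_ ?_ ?_ ?_ α
  · intro x y
    simp [hd.leibniz, hd.grade, grading_grading]
  · intro x y; simp
  · intro g hg
    simp [extDeriv_extDeriv_ofFun]
  · intro g hg
    simp [extDeriv_extDeriv_ofFun]

lemma pullback_grading {φ : M → M} (hφ : ContMDiff I I ∞ φ) (α : DifferentialForm I M) :
    pullback φ hφ (grading I M α) = grading I M (pullback φ hφ α) := by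
  refine DFunLike.congr_fun (AlgHom.ext_of_adjoin_eq_top (adjoin_functionForms I M)
    (φ₁ := (pullback φ hφ).comp (grading I M)) (φ₂ := (grading I M).comp (pullback φ hφ)) ?_) α
  have hodd : ∀ g hg, grading I M (extDeriv I M (ofFun g hg)) =
      -extDeriv I M (ofFun g hg) := fun g hg =>
    ((antiderivation_extDeriv I M).oddElement (even_ofFun g hg)).grade
  rintro _ (⟨g, hg, rfl⟩ | ⟨_, ⟨g, hg, rfl⟩, rfl⟩)
  · simp [(even_ofFun _ _).grade, pullback_ofFun]
  · simp [hodd, pullback_extDeriv_ofFun]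

lemma pullback_extDeriv {φ : M → M} (hφ : ContMDiff I I ∞ φ) (α : DifferentialForm I M) :
    pullback φ hφ (extDeriv I M α) = extDeriv I M (pullback φ hφ α) := by
  refine forms_ext_of_twisted_leibniz (u := pullback φ hφ)
    (v := (pullback φ hφ).comp (grading I M))
    (Φ := (pullback φ hφ).toLinearMap ∘ₗ extDeriv I M)
    (Ψ := extDeriv I M ∘ₗ (pullback φ hφ).toLinearMap) ?_ ?_ ?_ ?_ α
  · intro x y; simp [extDeriv_mul]
  · intro x y; simp [extDeriv_mul, pullback_grading]
  · intro g hg; simp [pullback_ofFun, pullback_extDeriv_ofFun]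
  · intro g hg; simp [pullback_extDeriv_ofFun, extDeriv_extDeriv_ofFun]

end Generation

end FormCalculus

section MixedPartials
set_option linter.unusedSectionVars false

variable {E : Type*} [NormedAddCommGroup E] [NormedSpace ℝ E]
  {H : Type*} [TopologicalSpace H] {I : ModelWithCorners ℝ E H}
  {M : Type*} [TopologicalSpace M] [ChartedSpace H M]
  {E' : Type*} [NormedAddCommGroup E'] [NormedSpace ℝ E']
  {H' : Type*} [TopologicalSpace H'] {J : ModelWithCorners ℝ E' H'}
  {N : Type*} [TopologicalSpace N] [ChartedSpace H' N]

/-- The chain rule. -/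
lemma differential_comp {f : N → ℝ} {φ : M → N} {x : M} {y : N} (hy : φ x = y)
    (hf : MDifferentiableAt J 𝓘(ℝ, ℝ) f y) (hφ : MDifferentiableAt I J φ x) (v : E) :
    differential I (fun z => f (φ z)) x v =
      differential J f y ((mfderiv I J φ x : E →L[ℝ] E') v) :=
  mvfderiv_comp_apply_of_eq x hf hφ hy v

lemma differential_congr {f g : M → ℝ} {x : M} (h : f =ᶠ[𝓝 x] g) :
    differential I f x = differential I g x := by
  simp only [differential, mvfderiv]
  rw [h.mfderiv_eq, h.eq_of_nhds]

lemma differential_add {f g : M → ℝ} {x : M} (hf : MDifferentiableAt I 𝓘(ℝ, ℝ) f x)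
    (hg : MDifferentiableAt I 𝓘(ℝ, ℝ) g x) (v : E) :
    differential I (fun z => f z + g z) x v = differential I f x v + differential I g x v :=
  DFunLike.congr_fun (mvfderiv_add hf hg) v

lemma differential_const (r : ℝ) (x : M) : differential I (fun _ : M => r) x = 0 :=
  mvfderiv_const (I := I) (M := M) r

lemma chartDeriv_eq_id [IsManifold I ∞ M] (x : M) :
    chartDeriv I x = ContinuousLinearMap.id ℝ E :=
  have : IsManifold I 1 M := IsManifold.of_le (n := ∞) (by simp)
  mfderiv_extChartAt_self

/-- The second derivative of a function in the chart centred at `x`. -/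
def chartHessian (I : ModelWithCorners ℝ E H) (K : M → ℝ) (x : M) : E →L[ℝ] E →L[ℝ] ℝ :=
  fderivWithin ℝ (fderivWithin ℝ (K ∘ (extChartAt I x).symm) (Set.range I)) (Set.range I)
    (extChartAt I x x)

lemma chartHessian_symm [FiniteDimensional ℝ E] [IsManifold I ∞ M] {K : M → ℝ} (hK : ContMDiff I 𝓘(ℝ, ℝ) ∞ K) (x : M)
    (v w : E) : chartHessian I K x v w = chartHessian I K x w v := by
  have hm : extChartAt I x x ∈ Set.range I :=
    extChartAt_target_subset_range x (mem_extChartAt_target x)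
  have hsymm : IsSymmSndFDerivWithinAt ℝ (K ∘ (extChartAt I x).symm) (Set.range I)
      (extChartAt I x x) :=
    (contDiffWithinAt_symm isOpen_univ (Set.mem_univ x) hK.contMDiffOn).isSymmSndFDerivWithinAt
      (by simpa using (ENat.LEInfty.out : (2 : WithTop ℕ∞) ≤ ∞))
      I.uniqueDiffOn (I.range_subset_closure_interior hm) hm
  exact hsymm v w

/-- The derivative along `ψ : N → M` of `dK(e)`, where the vector `e` is constant along `ψ` in the
chart. -/
lemma differential_differential_apply [FiniteDimensional ℝ E] [IsManifold I ∞ M] {K : M → ℝ}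
    (hK : ContMDiff I 𝓘(ℝ, ℝ) ∞ K) {ψ : N → M} {y : N} {x : M} (hy : ψ y = x)
    (hψ : MDifferentiableAt J I ψ y) (e : E)
    (he : ∀ᶠ z in 𝓝 y, (mfderiv I 𝓘(ℝ, E) (extChartAt I x) (ψ z) : E →L[ℝ] E) e = e) :
    MDifferentiableAt J 𝓘(ℝ, ℝ) (fun z => differential I K (ψ z) e) y ∧
    ∀ v, differential J (fun z => differential I K (ψ z) e) y v =
      chartHessian I K x ((mfderiv J I ψ y : E' →L[ℝ] E) v) e := by
  have i1 : IsManifold I 1 M := IsManifold.of_le (n := ∞) (by simp)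
  obtain ⟨d1, d2⟩ := diff_data (I := I) (x := x) isOpen_univ (Set.mem_univ _)
    hK.contMDiffOn e
  set F : M → ℝ := fun z => fderivWithin ℝ (K ∘ (extChartAt I x).symm)
    (Set.range I) (extChartAt I x z) e with hF
  have key : (fun z => differential I K (ψ z) e) =ᶠ[𝓝 y] fun z => F (ψ z) := by
    have hc : ∀ᶠ z in 𝓝 y, ψ z ∈ (extChartAt I x).source :=
      hψ.continuousAt.eventually (by rw [hy]; exact extChartAt_source_mem_nhds (I := I) x)
    filter_upwards [he, hc] with z h1 hz
    have h2 := DFunLike.congr_fun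
      (differential_comp_symm (hK.contMDiffAt.mdifferentiableAt (by simp)) hz) e
    have h3 : chartSymmDeriv I x (ψ z)
        ((mfderiv I 𝓘(ℝ, E) (extChartAt I x) (ψ z) : E →L[ℝ] E) e) = e :=
      DFunLike.congr_fun
        (mfderivWithin_extChartAt_symm_comp_mfderiv_extChartAt' (I := I) hz) e
    rw [h1] at h3
    rw [ContinuousLinearMap.comp_apply, h3] at h2
    exact h2
  have d1' : MDifferentiableAt I 𝓘(ℝ, ℝ) F (ψ y) := by rw [hy]; exact d1
  refine ⟨(d1'.comp y hψ).congr_of_eventuallyEq key, fun v => ?_⟩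
  rw [differential_congr key]
  refine (differential_comp hy d1 hψ v).trans ((d2 _).trans ?_)
  rw [chartDeriv_eq_id]
  rfl

lemma mfderiv_mk_left (x : M) (y : N) (v : E) :
    (mfderiv I (I.prod J) (fun x : M => (x, y)) x : E →L[ℝ] E × E') v = (v, 0) :=
  DFunLike.congr_fun (mfderiv_prod_left (I := I) (I' := J) (x₀ := x) (y₀ := y)) v

lemma mfderiv_mk_right (x : M) (y : N) (w : E') :
    (mfderiv J (I.prod J) (fun y : N => (x, y)) y : E' →L[ℝ] E × E') w = (0, w) :=
  DFunLike.congr_fun (mfderiv_prod_right (I := I) (I' := J) (x₀ := x) (y₀ := y)) w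

lemma mdifferentiableAt_mk_left (x : M) (y : N) :
    MDifferentiableAt I (I.prod J) (fun x : M => (x, y)) x :=
  mdifferentiableAt_id.prodMk mdifferentiableAt_const

lemma mdifferentiableAt_mk_right (x : M) (y : N) :
    MDifferentiableAt J (I.prod J) (fun y : N => (x, y)) y :=
  mdifferentiableAt_const.prodMk mdifferentiableAt_id

lemma differential_left {K : M × N → ℝ} (x : M) (y : N)
    (hK : MDifferentiableAt (I.prod J) 𝓘(ℝ, ℝ) K (x, y)) (v : E) :
    differential I (fun x => K (x, y)) x v = differential (I.prod J) K (x, y) (v, 0) := by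
  refine (differential_comp (I := I) (J := I.prod J) (φ := fun x : M => (x, y)) rfl hK
    (mdifferentiableAt_mk_left x y) v).trans ?_
  rw [mfderiv_mk_left]

lemma differential_right {K : M × N → ℝ} (x : M) (y : N)
    (hK : MDifferentiableAt (I.prod J) 𝓘(ℝ, ℝ) K (x, y)) (w : E') :
    differential J (fun y => K (x, y)) y w = differential (I.prod J) K (x, y) (0, w) := by
  refine (differential_comp (I := J) (J := I.prod J) (φ := fun y : N => (x, y)) rfl hK
    (mdifferentiableAt_mk_right x y) w).trans ?_
  rw [mfderiv_mk_right]

variable [IsManifold I ∞ M] [IsManifold J ∞ N]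

lemma mfderiv_extChartAt_prod {x₀ x : M} {y₀ y : N} (hx : x ∈ (extChartAt I x₀).source)
    (hy : y ∈ (extChartAt J y₀).source) (v : E) (w : E') :
    (mfderiv (I.prod J) 𝓘(ℝ, E × E') (extChartAt (I.prod J) (x₀, y₀)) (x, y) :
      E × E' →L[ℝ] E × E') (v, w) =
      ((mfderiv I 𝓘(ℝ, E) (extChartAt I x₀) x : E →L[ℝ] E) v,
        (mfderiv J 𝓘(ℝ, E') (extChartAt J y₀) y : E' →L[ℝ] E') w) := by
  have i1 : IsManifold I 1 M := IsManifold.of_le (n := ∞) (by simp)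
  have i2 : IsManifold J 1 N := IsManifold.of_le (n := ∞) (by simp)
  have h1 : MDifferentiableAt I 𝓘(ℝ, E) (extChartAt I x₀) x :=
    (contMDiffAt_extChartAt' (I := I) (n := 1) (by simpa using hx)).mdifferentiableAt (by simp)
  have h2 : MDifferentiableAt J 𝓘(ℝ, E') (extChartAt J y₀) y :=
    (contMDiffAt_extChartAt' (I := J) (n := 1) (by simpa using hy)).mdifferentiableAt (by simp)
  have h3 : HasMFDerivAt (I.prod J) 𝓘(ℝ, E × E') (extChartAt (I.prod J) (x₀, y₀)) (x, y)
      (((mfderiv I 𝓘(ℝ, E) (extChartAt I x₀) x : E →L[ℝ] E).comp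
        (ContinuousLinearMap.fst ℝ E E')).prod
        ((mfderiv J 𝓘(ℝ, E') (extChartAt J y₀) y : E' →L[ℝ] E').comp
        (ContinuousLinearMap.snd ℝ E E'))) := by
    have h4 := HasMFDerivAt.comp (x, y) (g := extChartAt I x₀) (f := (Prod.fst : M × N → M))
      h1.hasMFDerivAt (hasMFDerivAt_fst (I := I) (I' := J) (x := (x, y)))
    have h5 := HasMFDerivAt.comp (x, y) (g := extChartAt J y₀) (f := (Prod.snd : M × N → N))
      h2.hasMFDerivAt (hasMFDerivAt_snd (I := I) (I' := J) (x := (x, y)))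
    rw [extChartAt_prod]
    exact ⟨h4.1.prodMk h5.1, h4.2.prodMk h5.2⟩
  exact DFunLike.congr_fun h3.mfderiv (v, w)

variable [FiniteDimensional ℝ E] [FiniteDimensional ℝ E']

lemma partial_right_data {K : M × N → ℝ} (hK : ContMDiff (I.prod J) 𝓘(ℝ, ℝ) ∞ K) (x₀ : M) (y₀ : N)
    (w : E') :
    MDifferentiableAt I 𝓘(ℝ, ℝ) (fun x => differential J (fun y => K (x, y)) y₀ w) x₀ ∧
    ∀ v, differential I (fun x => differential J (fun y => K (x, y)) y₀ w) x₀ v =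
      chartHessian (I.prod J) K (x₀, y₀) (v, 0) (0, w) := by
  have e : (fun x => differential J (fun y => K (x, y)) y₀ w) =
      fun x => differential (I.prod J) K (x, y₀) (0, w) :=
    funext fun x => differential_right x y₀ (hK.contMDiffAt.mdifferentiableAt (by simp)) w
  rw [e]
  have := differential_differential_apply hK (ψ := fun x => (x, y₀)) (y := x₀) rfl
    (mdifferentiableAt_mk_left x₀ y₀) ((0, w) : E × E') (by
      filter_upwards [extChartAt_source_mem_nhds (I := I) x₀] with x hx
      exact (mfderiv_extChartAt_prod hx (mem_extChartAt_source y₀) 0 w).trans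
        (Prod.ext (ContinuousLinearMap.map_zero _) (DFunLike.congr_fun (chartDeriv_eq_id y₀) w)))
  refine ⟨this.1, fun v => ?_⟩
  rw [this.2, mfderiv_mk_left]

lemma partial_left_data {K : M × N → ℝ} (hK : ContMDiff (I.prod J) 𝓘(ℝ, ℝ) ∞ K) (x₀ : M) (y₀ : N)
    (v : E) :
    MDifferentiableAt J 𝓘(ℝ, ℝ) (fun y => differential I (fun x => K (x, y)) x₀ v) y₀ ∧
    ∀ w, differential J (fun y => differential I (fun x => K (x, y)) x₀ v) y₀ w =
      chartHessian (I.prod J) K (x₀, y₀) (0, w) (v, 0) := by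
  have e : (fun y => differential I (fun x => K (x, y)) x₀ v) =
      fun y => differential (I.prod J) K (x₀, y) (v, 0) :=
    funext fun y => differential_left x₀ y (hK.contMDiffAt.mdifferentiableAt (by simp)) v
  rw [e]
  have := differential_differential_apply hK (ψ := fun y => (x₀, y)) (y := y₀) rfl
    (mdifferentiableAt_mk_right x₀ y₀) ((v, 0) : E × E') (by
      filter_upwards [extChartAt_source_mem_nhds (I := J) y₀] with y hy
      exact (mfderiv_extChartAt_prod (mem_extChartAt_source x₀) hy v 0).trans
        (Prod.ext (DFunLike.congr_fun (chartDeriv_eq_id x₀) v) (ContinuousLinearMap.map_zero _)))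
  refine ⟨this.1, fun v => ?_⟩
  rw [this.2, mfderiv_mk_right]

/-- The mixed partial derivatives of a smooth function on a product commute. -/
theorem mixed_partials {K : M × N → ℝ} (hK : ContMDiff (I.prod J) 𝓘(ℝ, ℝ) ∞ K) (x₀ : M) (y₀ : N)
    (v : E) (w : E') :
    differential I (fun x => differential J (fun y => K (x, y)) y₀ w) x₀ v =
      differential J (fun y => differential I (fun x => K (x, y)) x₀ v) y₀ w := by
  rw [(partial_right_data hK x₀ y₀ w).2, (partial_left_data hK x₀ y₀ v).2, chartHessian_symm hK]

/-- The derivative along the diagonal is the sum of the partial derivatives. -/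
lemma differential_diagonal {K : M × M → ℝ} (x : M)
    (hK : MDifferentiableAt (I.prod I) 𝓘(ℝ, ℝ) K (x, x)) (v : E) :
    differential I (fun x => K (x, x)) x v =
      differential I (fun y => K (y, x)) x v + differential I (fun y => K (x, y)) x v := by
  have h1 : (mfderiv I (I.prod I) (fun x : M => (x, x)) x : E →L[ℝ] E × E) v = (v, v) := by
    have := mfderiv_prodMk (I := I) (I' := I) (I'' := I) (mdifferentiableAt_id (x := x))
      (mdifferentiableAt_id (x := x))
    rw [mfderiv_id] at this
    exact DFunLike.congr_fun this v
  rw [differential_left x x hK, differential_right x x hK, ← map_add]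
  refine (differential_comp (φ := fun x : M => (x, x)) rfl hK
    (mdifferentiableAt_id.prodMk mdifferentiableAt_id) v).trans ?_
  rw [h1]
  simp

end MixedPartials

section Bracket
set_option linter.unusedSectionVars false

variable {E : Type*} [NormedAddCommGroup E] [NormedSpace ℝ E] [FiniteDimensional ℝ E]
  {H : Type*} [TopologicalSpace H] {I : ModelWithCorners ℝ E H}
  {M : Type*} [TopologicalSpace M] [ChartedSpace H M] [IsManifold I ∞ M]

lemma differential_comp_extChartAt {P : E → ℝ} {P' : E →L[ℝ] ℝ} {x : M}
    (hP : HasFDerivWithinAt P P' (Set.range I) (extChartAt I x x)) (v : E) :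
    differential I (fun z => P (extChartAt I x z)) x v = P' v := by
  have i1 : IsManifold I 1 M := IsManifold.of_le (n := ∞) (by simp)
  have h3 : HasMFDerivWithinAt 𝓘(ℝ, E) 𝓘(ℝ, ℝ) P (Set.range I) (extChartAt I x x) P' :=
    hP.hasMFDerivWithinAt
  have h4 : MDifferentiableAt I 𝓘(ℝ, E) (extChartAt I x) x :=
    (contMDiffAt_extChartAt (I := I) (n := 1)).mdifferentiableAt (by simp)
  have h6 : HasMFDerivAt I 𝓘(ℝ, ℝ) (fun z => P (extChartAt I x z)) x
      (ContinuousLinearMap.comp (M₁ := E) (M₂ := E) (M₃ := ℝ) P' (chartDeriv I x)) := by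
    have := h3.comp x (s := Set.univ) h4.hasMFDerivAt.hasMFDerivWithinAt
      (fun z _ => by simp [extChartAt])
    rw [hasMFDerivWithinAt_univ] at this
    exact this
  have h7 : differential I (fun z => P (extChartAt I x z)) x = P'.comp (chartDeriv I x) := h6.mfderiv
  rw [h7, chartDeriv_eq_id, ContinuousLinearMap.comp_id]

lemma chartSymmDeriv_self (x : M) : chartSymmDeriv I x x = ContinuousLinearMap.id ℝ E := by
  have i1 : IsManifold I 1 M := IsManifold.of_le (n := ∞) (by simp)
  have h : chartSymmDeriv I x x ∘L chartDeriv I x = ContinuousLinearMap.id ℝ E :=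
    mfderivWithin_extChartAt_symm_comp_mfderiv_extChartAt' (mem_extChartAt_source x)
  rwa [chartDeriv_eq_id, ContinuousLinearMap.comp_id] at h

/-- A vector field in the chart centred at `x`. -/
def fieldInChart (I : ModelWithCorners ℝ E H) (x : M) (V : M → E) : E → E :=
  VectorField.mpullbackWithin 𝓘(ℝ, E) I (extChartAt I x).symm V (Set.range I)

lemma chartSymmDeriv_fieldInChart (V : M → E) {x z : M} (hz : z ∈ (extChartAt I x).source) :
    chartSymmDeriv I x z (fieldInChart I x V (extChartAt I x z)) = V z := by
  have i1 : IsManifold I 1 M := IsManifold.of_le (n := ∞) (by simp)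
  have hi : (chartSymmDeriv I x z).IsInvertible :=
    isInvertible_mfderivWithin_extChartAt_symm ((extChartAt I x).map_source hz)
  have h : fieldInChart I x V (extChartAt I x z) = (chartSymmDeriv I x z).inverse
      (V ((extChartAt I x).symm (extChartAt I x z))) := rfl
  rw [h, (extChartAt I x).left_inv hz]
  exact DFunLike.congr_fun hi.self_comp_inverse (V z)

lemma fieldInChart_self (V : M → E) (x : M) : fieldInChart I x V (extChartAt I x x) = V x := by
  have h := chartSymmDeriv_fieldInChart (I := I) V (mem_extChartAt_source (I := I) x)
  rwa [chartSymmDeriv_self] at h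

lemma differential_differential_field {h : M → ℝ} (hh : ContMDiff I 𝓘(ℝ, ℝ) ∞ h) (V : M → E)
    (x : M) (hV : DifferentiableWithinAt ℝ (fieldInChart I x V) (Set.range I) (extChartAt I x x))
    (v : E) :
    differential I (fun z => differential I h z (V z)) x v = chartHessian I h x v (V x) +
      differential I h x (fderivWithin ℝ (fieldInChart I x V) (Set.range I) (extChartAt I x x) v) := by
  set hc := h ∘ (extChartAt I x).symm with hhc
  have key : (fun z => differential I h z (V z)) =ᶠ[𝓝 x] fun z =>
      (fun y => fderivWithin ℝ hc (Set.range I) y (fieldInChart I x V y)) (extChartAt I x z) := by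
    filter_upwards [extChartAt_source_mem_nhds (I := I) x] with z hz
    have h2 := DFunLike.congr_fun
      (differential_comp_symm (hh.contMDiffAt.mdifferentiableAt (by simp)) hz)
      (fieldInChart I x V (extChartAt I x z))
    rw [ContinuousLinearMap.comp_apply, chartSymmDeriv_fieldInChart V hz] at h2
    exact h2
  have hm : extChartAt I x x ∈ Set.range I :=
    extChartAt_target_subset_range x (mem_extChartAt_target x)
  have h1 : ContDiffWithinAt ℝ ∞ hc (Set.range I) (extChartAt I x x) :=
    contDiffWithinAt_symm isOpen_univ (Set.mem_univ x) hh.contMDiffOn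
  have h2 : DifferentiableWithinAt ℝ (fderivWithin ℝ hc (Set.range I)) (Set.range I)
      (extChartAt I x x) :=
    (h1.fderivWithin_right (m := 1) I.uniqueDiffOn
      (by rw [one_add_one_eq_two]; exact ENat.LEInfty.out) hm).differentiableWithinAt (by simp)
  have h3 := h2.hasFDerivWithinAt.clm_apply hV.hasFDerivWithinAt
  rw [differential_congr key, differential_comp_extChartAt h3]
  have h4 := differential_comp_symm (hh.contMDiffAt.mdifferentiableAt (by simp))
    (mem_extChartAt_source (I := I) x)
  rw [chartSymmDeriv_self, ContinuousLinearMap.comp_id] at h4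
  rw [h4]
  simp only [add_apply, ContinuousLinearMap.comp_apply, ContinuousLinearMap.flip_apply,
    fieldInChart_self]
  rw [add_comm]
  rfl

/-- The Lie bracket of vector fields, as a commutator of derivations. -/
theorem differential_mlieBracket {h : M → ℝ} (hh : ContMDiff I 𝓘(ℝ, ℝ) ∞ h) {V W : M → E} {x : M}
    (hV : DifferentiableWithinAt ℝ (fieldInChart I x V) (Set.range I) (extChartAt I x x))
    (hW : DifferentiableWithinAt ℝ (fieldInChart I x W) (Set.range I) (extChartAt I x x)) :
    differential I h x (VectorField.mlieBracket I V W x) =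
      differential I (fun z => differential I h z (W z)) x (V x) -
        differential I (fun z => differential I h z (V z)) x (W x) := by
  rw [differential_differential_field hh W x hW, differential_differential_field hh V x hV,
    chartHessian_symm hh x (V x)]
  have e : VectorField.mlieBracket I V W x =
      fderivWithin ℝ (fieldInChart I x W) (Set.range I) (extChartAt I x x) (V x) -
        fderivWithin ℝ (fieldInChart I x V) (Set.range I) (extChartAt I x x) (W x) := by
    have h1 : VectorField.mlieBracket I V W x = (chartDeriv I x).inverse
        (VectorField.lieBracketWithin ℝ (fieldInChart I x V) (fieldInChart I x W)
          ((extChartAt I x).symm ⁻¹' Set.univ ∩ Set.range I) (extChartAt I x x)) := rfl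
    rw [chartDeriv_eq_id, ContinuousLinearMap.inverse_id, Set.preimage_univ, Set.univ_inter,
      VectorField.lieBracketWithin_eq] at h1
    refine h1.trans ?_
    change fderivWithin ℝ (fieldInChart I x W) (Set.range I) (extChartAt I x x)
        (fieldInChart I x V (extChartAt I x x)) -
      fderivWithin ℝ (fieldInChart I x V) (Set.range I) (extChartAt I x x)
        (fieldInChart I x W (extChartAt I x x)) = _
    rw [fieldInChart_self, fieldInChart_self]
  rw [e]
  refine (map_sub (differential I h x) _ _).trans ?_
  ring

end Bracket

section LieGroup
set_option linter.unusedSectionVars false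

variable {EG : Type*} [NormedAddCommGroup EG] [NormedSpace ℝ EG] [FiniteDimensional ℝ EG]
  {G : Type*} [TopologicalSpace G] [ChartedSpace EG G] [Group G] [LieGroup 𝓘(ℝ, EG) ∞ G]

variable (EG) in
/-- The derivative at `1` of a function on `G`. -/
abbrev derivOne (h : G → ℝ) : EG →L[ℝ] ℝ := differential 𝓘(ℝ, EG) h 1

lemma contMDiff_mul_left' (x : G) : ContMDiff 𝓘(ℝ, EG) 𝓘(ℝ, EG) ∞ (fun y : G => x * y) :=
  contMDiff_mul_left

lemma differential_invariantField {h : G → ℝ} (hh : ContMDiff 𝓘(ℝ, EG) 𝓘(ℝ, ℝ) ∞ h) (x : G)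
    (ζ : LieAlg EG G) :
    differential 𝓘(ℝ, EG) h x (mulInvariantVectorField ζ x) = derivOne EG (fun y => h (x * y)) ζ :=
  (differential_comp (mul_one x) (hh.contMDiffAt.mdifferentiableAt (by simp))
    ((contMDiff_mul_left' x).contMDiffAt.mdifferentiableAt (by simp)) ζ).symm

/-- The bracket of the Lie algebra, as a commutator of left invariant derivations. -/
theorem derivOne_lie {h : G → ℝ} (hh : ContMDiff 𝓘(ℝ, EG) 𝓘(ℝ, ℝ) ∞ h) (ζ χ : LieAlg EG G) :
    derivOne EG h (⁅ζ, χ⁆ : LieAlg EG G) = derivOne EG (fun x => derivOne EG (fun y => h (x * y)) χ) ζ -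
      derivOne EG (fun x => derivOne EG (fun y => h (x * y)) ζ) χ := by
  have : CompleteSpace EG := FiniteDimensional.complete ℝ EG
  have i3 : LieGroup 𝓘(ℝ, EG) (minSmoothness ℝ 3) G :=
    LieGroup.of_le (n := ∞) (by simp only [minSmoothness_of_isRCLikeNormedField]; exact ENat.LEInfty.out)
  have i2 : IsManifold 𝓘(ℝ, EG) 2 G := IsManifold.of_le (n := ∞) ENat.LEInfty.out
  have hd : ∀ ζ : LieAlg EG G, DifferentiableWithinAt ℝ
      (fieldInChart 𝓘(ℝ, EG) (1 : G) (mulInvariantVectorField ζ)) (Set.range 𝓘(ℝ, EG))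
      (extChartAt 𝓘(ℝ, EG) (1 : G) 1) := fun ζ => by
    have := MDifferentiableWithinAt.differentiableWithinAt_mpullbackWithin_vectorField
      (s := Set.univ) (mdifferentiableAt_mulInvariantVectorField ζ (g := 1)).mdifferentiableWithinAt
    rwa [Set.preimage_univ, Set.univ_inter] at this
  have key := differential_mlieBracket hh (hd ζ) (hd χ)
  have h1 : ∀ ζ : LieAlg EG G, mulInvariantVectorField ζ (1 : G) = ζ := fun ζ => by
    have : (fun y : G => 1 * y) = id := funext one_mul
    rw [mulInvariantVectorField, this, mfderiv_id]
    rfl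
  simp only [differential_invariantField hh] at key
  refine key.trans ?_
  rw [h1, h1]

lemma derivOne_inv {f : G → ℝ} (hf : MDifferentiableAt 𝓘(ℝ, EG) 𝓘(ℝ, ℝ) f 1) (ζ : LieAlg EG G) :
    derivOne EG (fun x => f x⁻¹) ζ = -derivOne EG f ζ := by
  have hm : ContMDiff (𝓘(ℝ, EG).prod 𝓘(ℝ, EG)) 𝓘(ℝ, EG) ∞ (fun p : G × G => p.1 * p.2⁻¹) :=
    contMDiff_fst.mul contMDiff_snd.inv
  have hK : MDifferentiableAt (𝓘(ℝ, EG).prod 𝓘(ℝ, EG)) 𝓘(ℝ, ℝ) (fun p : G × G => f (p.1 * p.2⁻¹))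
      (1, 1) :=
    MDifferentiableAt.comp_of_eq (g := f) (f := fun p : G × G => p.1 * p.2⁻¹) (1, 1) hf
      (hm.contMDiffAt.mdifferentiableAt (by simp)) (by simp)
  have h := differential_diagonal (1 : G) hK ζ
  simp only [mul_inv_cancel, differential_const, inv_one, mul_one, one_mul] at h
  exact (neg_eq_of_add_eq_zero_right h.symm).symm

lemma contMDiff_conj (g : G) : ContMDiff 𝓘(ℝ, EG) 𝓘(ℝ, EG) ∞ (fun y : G => g * y * g⁻¹) :=
  (contMDiff_const.mul contMDiff_id).mul contMDiff_const

lemma derivOne_Ad {h : G → ℝ} (hh : MDifferentiableAt 𝓘(ℝ, EG) 𝓘(ℝ, ℝ) h 1) (g : G)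
    (ζ : LieAlg EG G) : derivOne EG h (Ad g ζ) = derivOne EG (fun y => h (g * y * g⁻¹)) ζ :=
  (differential_comp (φ := fun y : G => g * y * g⁻¹) (by simp) hh
    ((contMDiff_conj g).contMDiffAt.mdifferentiableAt (by simp)) ζ).symm

lemma exists_derivOne_eq [T2Space G] (l : EG →L[ℝ] ℝ) :
    ∃ h : G → ℝ, ContMDiff 𝓘(ℝ, EG) 𝓘(ℝ, ℝ) ∞ h ∧ derivOne EG h = l := by
  have hf : ContMDiffOn 𝓘(ℝ, EG) 𝓘(ℝ, ℝ) ∞ (fun z => l (extChartAt 𝓘(ℝ, EG) (1 : G) z))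
      (chartAt EG (1 : G)).source :=
    l.contMDiff.comp_contMDiffOn contMDiffOn_extChartAt
  obtain ⟨h, hs, e⟩ := exists_global_function (chartAt EG (1 : G)).open_source
    (mem_chart_source EG (1 : G)) hf
  refine ⟨h, hs, ContinuousLinearMap.ext fun v => ?_⟩
  rw [derivOne, differential_congr e]
  exact differential_comp_extChartAt (P := l) l.hasFDerivAt.hasFDerivWithinAt v

lemma eq_of_derivOne_eq [T2Space G] {ζ χ : LieAlg EG G}
    (H : ∀ h : G → ℝ, ContMDiff 𝓘(ℝ, EG) 𝓘(ℝ, ℝ) ∞ h → derivOne EG h ζ = derivOne EG h χ) :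
    ζ = χ := by
  refine (SeparatingDual.eq_iff_forall_dual_eq (R := ℝ) (V := EG)).mpr fun l => ?_
  obtain ⟨h, hs, e⟩ := exists_derivOne_eq (G := G) l
  rw [← e]
  exact H h hs

section Ad
variable [T2Space G]

lemma Ad_one (ζ : LieAlg EG G) : Ad (1 : G) ζ = ζ :=
  eq_of_derivOne_eq fun h hh => by
    rw [derivOne_Ad (hh.contMDiffAt.mdifferentiableAt (by simp))]
    simp

lemma contMDiff_comp_mul {h : G → ℝ} (hh : ContMDiff 𝓘(ℝ, EG) 𝓘(ℝ, ℝ) ∞ h) :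
    ContMDiff (𝓘(ℝ, EG).prod 𝓘(ℝ, EG)) 𝓘(ℝ, ℝ) ∞ (fun p : G × G => h (p.1 * p.2)) :=
  hh.comp (contMDiff_fst.mul contMDiff_snd)

lemma contMDiff_translate_right {h : G → ℝ} (hh : ContMDiff 𝓘(ℝ, EG) 𝓘(ℝ, ℝ) ∞ h) (x : G) :
    ContMDiff 𝓘(ℝ, EG) 𝓘(ℝ, ℝ) ∞ (fun y => h (x * y)) :=
  hh.comp (contMDiff_mul_left' x)

lemma Ad_lie (g : G) (ζ χ : LieAlg EG G) : Ad g ⁅ζ, χ⁆ = ⁅Ad g ζ, Ad g χ⁆ :=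
  eq_of_derivOne_eq fun h hh => by
    have key : ∀ ζ χ : LieAlg EG G,
        derivOne EG (fun x => derivOne EG (fun y => h (x * y)) (Ad g χ)) (Ad g ζ) =
        derivOne EG (fun x => derivOne EG (fun y => h (g * (x * y) * g⁻¹)) χ) ζ := fun ζ χ => by
      rw [derivOne_Ad (partial_right_data (contMDiff_comp_mul hh) 1 1 (Ad g χ)).1]
      congr 2
      ext x
      rw [derivOne_Ad ((contMDiff_translate_right hh _).contMDiffAt.mdifferentiableAt (by simp))]
      congr 2
      ext y
      congr 1
      group
    rw [derivOne_Ad (hh.contMDiffAt.mdifferentiableAt (by simp)), derivOne_lie hh, key, key]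
    exact derivOne_lie (hh.comp (contMDiff_conj g)) ζ χ

/-- The derivative of the adjoint representation is the bracket. -/
theorem derivOne_Ad_apply (l : EG →L[ℝ] ℝ) (ζ χ : LieAlg EG G) :
    MDifferentiableAt 𝓘(ℝ, EG) 𝓘(ℝ, ℝ) (fun g : G => l (Ad g χ)) 1 ∧
      derivOne EG (fun g : G => l (Ad g χ)) ζ = l (⁅ζ, χ⁆ : LieAlg EG G) := by
  obtain ⟨h, hh, rfl⟩ := exists_derivOne_eq (G := G) l
  have e : (fun g : G => derivOne EG h (Ad g χ)) =
      fun g => derivOne EG (fun y => h (g * y * g⁻¹)) χ :=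
    funext fun g => derivOne_Ad (hh.contMDiffAt.mdifferentiableAt (by simp)) g χ
  have hK : ContMDiff (𝓘(ℝ, EG).prod 𝓘(ℝ, EG)) 𝓘(ℝ, ℝ) ∞
      (fun p : G × G => h (p.1 * p.2 * p.1⁻¹)) :=
    hh.comp ((contMDiff_fst.mul contMDiff_snd).mul contMDiff_fst.inv)
  have e2 : (fun y => derivOne EG (fun g => h (g * y * g⁻¹)) ζ) =
      fun y => derivOne EG (fun g => h (g * y)) ζ + -derivOne EG (fun g => h (y * g)) ζ := by
    ext y
    have h1 : ContMDiff (𝓘(ℝ, EG).prod 𝓘(ℝ, EG)) 𝓘(ℝ, ℝ) ∞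
        (fun p : G × G => h (p.1 * y * p.2⁻¹)) :=
      hh.comp ((contMDiff_fst.mul contMDiff_const).mul contMDiff_snd.inv)
    refine (differential_diagonal (1 : G)
      (h1.contMDiffAt.mdifferentiableAt (by simp)) ζ).trans ?_
    simp only [inv_one, mul_one, one_mul]
    congr 1
    exact derivOne_inv ((contMDiff_translate_right hh y).contMDiffAt.mdifferentiableAt (by simp)) ζ
  have hm := contMDiff_comp_mul hh
  have hm' : ContMDiff (𝓘(ℝ, EG).prod 𝓘(ℝ, EG)) 𝓘(ℝ, ℝ) ∞ (fun p : G × G => h (p.2 * p.1)) :=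
    hh.comp (contMDiff_snd.mul contMDiff_fst)
  rw [e]
  refine ⟨(partial_right_data hK 1 1 χ).1, ?_⟩
  refine (mixed_partials hK 1 1 ζ χ).trans ?_
  have d1 := (partial_left_data hm 1 1 ζ).1
  have d2 := (partial_left_data hm' 1 1 ζ).1
  have e3 : derivOne EG (fun y : G => -derivOne EG (fun g => h (y * g)) ζ) χ =
      -derivOne EG (fun y : G => derivOne EG (fun g => h (y * g)) ζ) χ :=
    DFunLike.congr_fun (mvfderiv_neg (I := 𝓘(ℝ, EG)) (g := fun y : G => derivOne EG (fun g => h (y * g)) ζ) (x := 1)) χ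
  change derivOne EG (fun y => derivOne EG (fun g => h (g * y * g⁻¹)) ζ) χ = _
  rw [e2, derivOne_lie hh]
  refine (differential_add d1 d2.neg χ).trans ?_
  rw [sub_eq_add_neg]
  refine congrArg₂ (· + ·) ?_ e3
  exact (mixed_partials hm 1 1 ζ χ).symm

theorem derivOne_Ad_inv_apply (l : EG →L[ℝ] ℝ) (ζ χ : LieAlg EG G) :
    MDifferentiableAt 𝓘(ℝ, EG) 𝓘(ℝ, ℝ) (fun g : G => l (Ad g⁻¹ χ)) 1 ∧
      derivOne EG (fun g : G => l (Ad g⁻¹ χ)) ζ = -l (⁅ζ, χ⁆ : LieAlg EG G) := by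
  obtain ⟨h1, h2⟩ := derivOne_Ad_apply l ζ χ
  refine ⟨MDifferentiableAt.comp_of_eq (g := fun g : G => l (Ad g χ)) (f := fun g : G => g⁻¹) 1 h1
    ((contMDiff_inv 𝓘(ℝ, EG) ∞).contMDiffAt.mdifferentiableAt (by simp)) (by simp), ?_⟩
  rw [← h2]
  exact derivOne_inv h1 ζ

end Ad

end LieGroup

section WeakDerivative
set_option linter.unusedSectionVars false

variable {EG : Type*} [NormedAddCommGroup EG] [NormedSpace ℝ EG]
  {G : Type*} [TopologicalSpace G] [ChartedSpace EG G] [Group G]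
  {V V' : Type*} [AddCommGroup V] [Module ℝ V] [AddCommGroup V'] [Module ℝ V']

/-- `F'` is the derivative at `1`, in the direction `ζ`, of `F : G → V`, tested on all linear
functionals on `V`. -/
def HasDerivOne (F : G → V) (F' : V) (ζ : LieAlg EG G) : Prop :=
  ∀ μ : Module.Dual ℝ V, MDifferentiableAt 𝓘(ℝ, EG) 𝓘(ℝ, ℝ) (fun g => μ (F g)) 1 ∧
    differential 𝓘(ℝ, EG) (fun g => μ (F g)) 1 ζ = μ F'

namespace HasDerivOne

variable {ζ : LieAlg EG G}

lemma const (v : V) : HasDerivOne (fun _ : G => v) 0 ζ := fun μ =>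
  ⟨mdifferentiableAt_const, by rw [differential_const, map_zero]; rfl⟩

lemma add {F K : G → V} {F' K' : V} (hF : HasDerivOne F F' ζ) (hK : HasDerivOne K K' ζ) :
    HasDerivOne (fun g => F g + K g) (F' + K') ζ := fun μ => by
  simp only [map_add]
  refine ⟨(hF μ).1.add (hK μ).1, ?_⟩
  rw [← (hF μ).2, ← (hK μ).2]
  exact differential_add (hF μ).1 (hK μ).1 ζ

lemma sum {ι : Type*} (s : Finset ι) {F : ι → G → V} {F' : ι → V}
    (hF : ∀ i ∈ s, HasDerivOne (F i) (F' i) ζ) :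
    HasDerivOne (fun g => ∑ i ∈ s, F i g) (∑ i ∈ s, F' i) ζ := by
  classical
  induction s using Finset.induction_on with
  | empty => simpa using const (0 : V)
  | insert a s ha ih =>
    simp only [Finset.sum_insert ha]
    exact (hF a (Finset.mem_insert_self _ _)).add
      (ih fun i hi => hF i (Finset.mem_insert_of_mem hi))

lemma map {F : G → V} {F' : V} (hF : HasDerivOne F F' ζ) (A : V →ₗ[ℝ] V') :
    HasDerivOne (fun g => A (F g)) (A F') ζ := fun μ => hF (μ ∘ₗ A)

lemma real {f : G → ℝ} {r : ℝ} (hf : MDifferentiableAt 𝓘(ℝ, EG) 𝓘(ℝ, ℝ) f 1)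
    (h : differential 𝓘(ℝ, EG) f 1 ζ = r) : HasDerivOne f r ζ := fun μ => by
  have e : ∀ t : ℝ, μ t = t * μ 1 := fun t => by
    rw [← smul_eq_mul, ← map_smul, smul_eq_mul, mul_one]
  simp only [e (f _), e r]
  refine ⟨hf.mul mdifferentiableAt_const, ?_⟩
  have h1 : differential 𝓘(ℝ, EG) (fun g => f g * μ 1) 1 =
      f 1 • differential 𝓘(ℝ, EG) (fun _ : G => μ 1) 1 + μ 1 • differential 𝓘(ℝ, EG) f 1 :=
    mvfderiv_mul hf mdifferentiableAt_const
  rw [h1, differential_const, ← h, smul_zero, zero_add, mul_comm]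
  rfl

lemma unique {F : G → V} {v w : V} (hv : HasDerivOne F v ζ) (hw : HasDerivOne F w ζ) : v = w :=
  sub_eq_zero.mp <| Module.forall_dual_apply_eq_zero_iff ℝ (v - w) |>.mp fun μ => by
    rw [map_sub, ← (hv μ).2, ← (hw μ).2, sub_self]

lemma smul {c : G → ℝ} {c' : ℝ} {F : G → V} {F' : V} (hc : HasDerivOne c c' ζ)
    (hF : HasDerivOne F F' ζ) :
    HasDerivOne (fun g => c g • F g) (c' • F 1 + c 1 • F') ζ := fun μ => by
  have h0 := hc LinearMap.id
  simp only [map_smul, map_add, smul_eq_mul]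
  refine ⟨h0.1.mul (hF μ).1, ?_⟩
  have h1 : differential 𝓘(ℝ, EG) (fun g => c g * μ (F g)) 1 =
      c 1 • differential 𝓘(ℝ, EG) (fun g => μ (F g)) 1 +
        μ (F 1) • differential 𝓘(ℝ, EG) c 1 := mvfderiv_mul h0.1 (hF μ).1
  have h2 : differential 𝓘(ℝ, EG) c 1 ζ = c' := h0.2
  refine (DFunLike.congr_fun h1 ζ).trans ?_
  change c 1 * differential 𝓘(ℝ, EG) (fun g => μ (F g)) 1 ζ +
    μ (F 1) * differential 𝓘(ℝ, EG) c 1 ζ = _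
  rw [(hF μ).2, h2]
  ring

lemma mul {A : Type*} [Ring A] [Algebra ℝ A] [Module.Finite ℝ A] {F K : G → A} {F' K' : A}
    (hF : HasDerivOne F F' ζ) (hK : HasDerivOne K K' ζ) :
    HasDerivOne (fun g => F g * K g) (F' * K 1 + F 1 * K') ζ := by
  let b := Module.finBasis ℝ A
  have e : ∀ x y : A, x * y = ∑ i, b.coord i x • (LinearMap.mulLeft ℝ (b i) y) := fun x y => by
    conv_lhs => rw [← b.sum_repr x, Finset.sum_mul]
    simp
  simp only [e (F _), e F', ← Finset.sum_add_distrib]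
  exact sum _ fun i _ => (hF.map (b.coord i)).smul (hK.map _)

end HasDerivOne

end WeakDerivative

section Action
set_option linter.unusedSectionVars false

variable {EG : Type*} [NormedAddCommGroup EG] [NormedSpace ℝ EG] [FiniteDimensional ℝ EG]
  {G : Type*} [TopologicalSpace G] [ChartedSpace EG G] [Group G] [LieGroup 𝓘(ℝ, EG) ∞ G]
  {E : Type*} [NormedAddCommGroup E] [NormedSpace ℝ E] [FiniteDimensional ℝ E]
  {H : Type*} [TopologicalSpace H] {I : ModelWithCorners ℝ E H}
  {W : Type*} [TopologicalSpace W] [ChartedSpace H W] [IsManifold I ∞ W]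
  [MulAction G W] [ContMDiffSMul 𝓘(ℝ, EG) I ∞ G W]

lemma contMDiff_inv_smul :
    ContMDiff (𝓘(ℝ, EG).prod I) I ∞ (fun p : G × W => p.1⁻¹ • p.2) :=
  (contMDiff_smul (I := 𝓘(ℝ, EG)) (I' := I) (n := ∞) (G := G) (M := W)).comp
    (contMDiff_fst.inv.prodMk contMDiff_snd)

lemma contMDiff_const_smul' (EG : Type*) [NormedAddCommGroup EG] [NormedSpace ℝ EG]
    {G : Type*} [TopologicalSpace G] [ChartedSpace EG G] [Group G] [MulAction G W]
    [ContMDiffSMul 𝓘(ℝ, EG) I ∞ G W] (g : G) : ContMDiff I I ∞ (fun x : W => g • x) :=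
  (contMDiff_smul (I := 𝓘(ℝ, EG)) (I' := I) (n := ∞) (G := G) (M := W)).comp
    (contMDiff_const.prodMk contMDiff_id)

lemma contMDiff_orbit (x : W) : ContMDiff 𝓘(ℝ, EG) I ∞ (fun g : G => g⁻¹ • x) :=
  contMDiff_inv_smul.comp (contMDiff_id.prodMk contMDiff_const)

lemma differential_fundamentalField {h : W → ℝ} (hh : ContMDiff I 𝓘(ℝ, ℝ) ∞ h)
    (ζ : LieAlg EG G) (x : W) : differential I h x (fundamentalField I ζ x) =
      derivOne EG (fun g : G => h (g⁻¹ • x)) ζ :=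
  (differential_comp (I := 𝓘(ℝ, EG)) (J := I) (φ := fun g : G => g⁻¹ • x) (by simp)
    (hh.contMDiffAt.mdifferentiableAt (by simp))
    ((contMDiff_orbit x).contMDiffAt.mdifferentiableAt (by simp)) ζ).symm

/-- The fundamental vector fields form a representation of the Lie algebra. -/
theorem fundamentalField_lie {h : W → ℝ} (hh : ContMDiff I 𝓘(ℝ, ℝ) ∞ h) (ζ χ : LieAlg EG G)
    (x : W) : differential I h x (fundamentalField I ⁅ζ, χ⁆ x) =
      differential I (fun z => differential I h z (fundamentalField I χ z)) x
          (fundamentalField I ζ x) -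
        differential I (fun z => differential I h z (fundamentalField I ζ z)) x
          (fundamentalField I χ x) := by
  have hs := fun ζ : LieAlg EG G =>
    (smoothVectorField_fundamentalField (W := W) I ζ).contMDiff hh
  rw [differential_fundamentalField hh, differential_fundamentalField (hs χ),
    differential_fundamentalField (hs ζ)]
  simp only [differential_fundamentalField hh]
  refine (derivOne_lie (hh.comp (contMDiff_orbit x)) ζ χ).trans ?_
  simp only [Function.comp_apply, mul_inv_rev, mul_smul]

lemma fundamentalField_equivariant {h : W → ℝ} (hh : ContMDiff I 𝓘(ℝ, ℝ) ∞ h) (g : G)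
    (ζ : LieAlg EG G) (x : W) :
    differential I (fun z => h (g⁻¹ • z)) x (fundamentalField I ζ x) =
      differential I h (g⁻¹ • x) (fundamentalField I (Ad g⁻¹ ζ) (g⁻¹ • x)) := by
  rw [differential_fundamentalField hh]
  refine (differential_fundamentalField (hh.comp (contMDiff_const_smul' EG g⁻¹)) ζ x).trans
    (Eq.trans ?_ (derivOne_Ad ((hh.comp
      (contMDiff_orbit (g⁻¹ • x))).contMDiffAt.mdifferentiableAt (by simp)) g⁻¹ ζ).symm)
  congr 2
  ext k
  simp only [Function.comp_apply, mul_inv_rev, inv_inv, mul_smul, smul_inv_smul]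

lemma translateForm_ofFun (g : G) (h : W → ℝ) (hh : ContMDiff I 𝓘(ℝ, ℝ) ∞ h) :
    translateForm EG I W g (ofFun h hh) =
      ofFun (fun x => h (g⁻¹ • x)) (hh.comp (contMDiff_const_smul' EG g⁻¹)) :=
  pullback_ofFun _ _ _

lemma translateForm_extDeriv_ofFun (g : G) (h : W → ℝ) (hh : ContMDiff I 𝓘(ℝ, ℝ) ∞ h) :
    translateForm EG I W g (extDeriv I W (ofFun h hh)) =
      extDeriv I W (ofFun (fun x => h (g⁻¹ • x)) (hh.comp (contMDiff_const_smul' EG g⁻¹))) :=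
  pullback_extDeriv_ofFun _ _ _

variable (I W) in
/-- The Lie derivative of forms along a fundamental vector field. -/
def lieDeriv (ζ : LieAlg EG G) : DifferentialForm I W →ₗ[ℝ] DifferentialForm I W :=
  extDeriv I W ∘ₗ fundamentalContract I ζ + fundamentalContract I ζ ∘ₗ extDeriv I W

variable [T2Space W] [CompactSpace W]

lemma translateForm_one (α : DifferentialForm I W) : translateForm EG I W (1 : G) α = α := by
  refine DFunLike.congr_fun (AlgHom.ext_of_adjoin_eq_top (adjoin_functionForms I W)
    (φ₁ := translateForm EG I W (1 : G)) (φ₂ := AlgHom.id ℝ _) ?_) α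
  rintro _ (⟨h, hh, rfl⟩ | ⟨_, ⟨h, hh, rfl⟩, rfl⟩)
  · rw [translateForm_ofFun]; simp
  · rw [translateForm_extDeriv_ofFun]; simp

lemma antiderivation_fundamentalContract (ζ : LieAlg EG G) :
    IsAntiderivation (grading I W) (fundamentalContract I ζ) :=
  antiderivation_contract _

lemma lieDeriv_mul (ζ : LieAlg EG G) (α β : DifferentialForm I W) :
    lieDeriv I W ζ (α * β) = lieDeriv I W ζ α * β + α * lieDeriv I W ζ β := by
  have hd := antiderivation_extDeriv I W
  have hi := antiderivation_fundamentalContract (I := I) (W := W) ζ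
  simp only [lieDeriv, LinearMap.add_apply, LinearMap.comp_apply, hd.leibniz, hi.leibniz, map_add,
    hd.grade, hi.grade, grading_grading]
  noncomm_ring

lemma hasDerivOne_ι {F : G → E →L[ℝ] ℝ} {F' : E →L[ℝ] ℝ} {ζ : LieAlg EG G}
    (h : ∀ v, HasDerivOne (fun g => F g v) (F' v) ζ) :
    HasDerivOne (fun g => (ExteriorAlgebra.ι ℝ (F g) : CotangentAlgebra E))
      (ExteriorAlgebra.ι ℝ F') ζ := by
  have e : ∀ l : E →L[ℝ] ℝ, (ExteriorAlgebra.ι ℝ l : CotangentAlgebra E) = ∑ i,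
      (LinearMap.toSpanSingleton ℝ (CotangentAlgebra E) (ExteriorAlgebra.ι ℝ (coCov (E := E) i)))
        (l (Module.finBasis ℝ E i)) := fun l => by
    conv_lhs => rw [eq_sum_coCov l, map_sum]
    simp
  simp only [e (F _), e F']
  exact HasDerivOne.sum _ fun i _ => (h _).map _

/-- The action of the Lie algebra on forms is given by the Lie derivative. -/
theorem hasDerivOne_translateForm (ζ : LieAlg EG G) (α : DifferentialForm I W) (x : W) :
    HasDerivOne (fun g : G => (translateForm EG I W g α).val x) ((lieDeriv I W ζ α).val x) ζ := by
  have hfin : Module.Finite ℝ (CotangentAlgebra E) := Module.Finite.of_basis (covBasis E)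
  have hα : α ∈ Algebra.adjoin ℝ (functionForms I W ∪ extDeriv I W '' functionForms I W) := by
    rw [adjoin_functionForms]; trivial
  induction hα using Algebra.adjoin_induction with
  | mem α h =>
    have hK : ∀ {h : W → ℝ}, ContMDiff I 𝓘(ℝ, ℝ) ∞ h → ContMDiff (𝓘(ℝ, EG).prod I) 𝓘(ℝ, ℝ) ∞
      (fun p : G × W => h (p.1⁻¹ • p.2)) := fun hh => hh.comp contMDiff_inv_smul
    rcases h with ⟨h, hh, rfl⟩ | ⟨_, ⟨h, hh, rfl⟩, rfl⟩
    · have e : (lieDeriv I W ζ (ofFun h hh)).val x =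
          algebraMap ℝ _ (derivOne EG (fun g : G => h (g⁻¹ • x)) ζ) := by
        rw [lieDeriv, LinearMap.add_apply, LinearMap.comp_apply, LinearMap.comp_apply,
          fundamentalContract, contract_ofFun, contract_extDeriv_ofFun, map_zero, zero_add,
          val_ofFun, funForm, differential_fundamentalField hh]
      rw [e]
      simp only [translateForm_ofFun, val_ofFun, funForm]
      exact (HasDerivOne.real
        ((hh.comp (contMDiff_orbit x)).contMDiffAt.mdifferentiableAt (by simp)) rfl).map
        (Algebra.linearMap ℝ (CotangentAlgebra E))
    · have e : (lieDeriv I W ζ (extDeriv I W (ofFun h hh))).val x = ExteriorAlgebra.ι ℝ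
          (differential I (fun z => derivOne EG (fun g : G => h (g⁻¹ • z)) ζ) x) := by
        rw [lieDeriv, LinearMap.add_apply, LinearMap.comp_apply, LinearMap.comp_apply,
          fundamentalContract, extDeriv_extDeriv, contract_extDeriv_ofFun, map_zero, add_zero,
          val_extDeriv_ofFun, diffForm]
        simp only [differential_fundamentalField hh]
      rw [e]
      simp only [translateForm_extDeriv_ofFun, val_extDeriv_ofFun, diffForm]
      exact hasDerivOne_ι fun v => HasDerivOne.real (partial_right_data (hK hh) 1 x v).1
        (mixed_partials (hK hh) 1 x ζ v)
  | algebraMap r =>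
    have e : lieDeriv I W ζ (algebraMap ℝ _ r) = 0 := by
      have hd := antiderivation_extDeriv I W
      have hi := antiderivation_fundamentalContract (I := I) (W := W) ζ
      rw [Algebra.algebraMap_eq_smul_one, map_smul, lieDeriv, LinearMap.add_apply,
        LinearMap.comp_apply, LinearMap.comp_apply, hd.map_one, hi.map_one]
      simp
    rw [e, map_zero]
    simp only [AlgHom.commutes]
    exact HasDerivOne.const _
  | add α β _ _ ha hb => simpa only [map_add, Pi.add_apply] using ha.add hb
  | mul α β _ _ ha hb =>
    rw [lieDeriv_mul]
    have := ha.mul hb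
    simp only [translateForm_one] at this
    simpa only [map_add, map_mul, Pi.add_apply, Pi.mul_apply] using this

section Connection

variable (η : Connection EG G I W) (f : CutOff G I W)

lemma val_degenerateConnection (l : Module.Dual ℝ (LieAlg EG G)) (x : W) :
    (degenerateConnection η f l).val x = f.toFun x • lieForm η.toFun l x := rfl

lemma odd_degenerateConnection (l : Module.Dual ℝ (LieAlg EG G)) :
    OddElement (grading I W) (degenerateConnection η f l) :=
  odd_of_degree_one fun x => ⟨f.toFun x • LinearMap.toContinuousLinearMap (l ∘ₗ η.toFun x), by
    rw [val_degenerateConnection, lieForm, map_smul]⟩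

lemma CutOff.eq_zero {x : W} (hx : x ∉ freeLocus G W) : f.toFun x = 0 := by
  obtain ⟨U, -, hU, h0⟩ := f.vanishes
  exact h0 x (hU hx)

lemma contract_degenerateConnection (ζ : LieAlg EG G) (l : Module.Dual ℝ (LieAlg EG G)) :
    fundamentalContract I ζ (degenerateConnection η f l) = l ζ • f.form :=
  DifferentialForm.ext fun x => by
    change CliffordAlgebra.contractLeft _ ((degenerateConnection η f l).val x) = _
    rw [val_degenerateConnection, lieForm, map_smul, map_smul, Pi.smul_apply]
    have h1 := CliffordAlgebra.contractLeft_ι (Q := (0 : QuadraticForm ℝ (E →L[ℝ] ℝ)))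
      (ContinuousLinearMap.apply ℝ ℝ (fundamentalField I ζ x)).toLinearMap
      (LinearMap.toContinuousLinearMap (l ∘ₗ η.toFun x))
    refine (congrArg (f.toFun x • ·) h1).trans ?_
    change f.toFun x • algebraMap ℝ (CotangentAlgebra E) (l (η.toFun x (fundamentalField I ζ x))) =
      l ζ • algebraMap ℝ (CotangentAlgebra E) (f.toFun x)
    rw [Algebra.smul_def, Algebra.smul_def, ← map_mul, ← map_mul]
    congr 1
    by_cases hx : x ∈ freeLocus G W
    · rw [η.vertical x hx, mul_comm]
    · rw [f.eq_zero hx, zero_mul, mul_zero]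

lemma translateForm_degenerateConnection (g : G) (l : Module.Dual ℝ (LieAlg EG G)) :
    translateForm EG I W g (degenerateConnection η f l) =
      degenerateConnection η f (l ∘ₗ Ad g⁻¹) :=
  DifferentialForm.ext fun x => by
    change pullbackCovector (tangentMapAt I (fun y : W => g⁻¹ • y) x)
      ((degenerateConnection η f l).val (g⁻¹ • x)) = _
    rw [val_degenerateConnection, val_degenerateConnection, map_smul, f.invariant]
    by_cases hx : x ∈ freeLocus G W
    · rw [lieForm, lieForm, pullbackCovector_ι]
      congr 2
      ext v
      exact congrArg l (η.equivariant x hx g⁻¹ v)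
    · rw [f.eq_zero hx, zero_smul, zero_smul]

lemma lieDeriv_degenerateConnection [T2Space G] {m : ℕ} (ξ : Module.Basis (Fin m) ℝ (LieAlg EG G))
    (ζ : LieAlg EG G) (a : Fin m) :
    lieDeriv I W ζ (degenerateConnection η f (ξ.coord a)) =
      -∑ e, ξ.coord a ⁅ζ, ξ e⁆ • degenerateConnection η f (ξ.coord e) :=
  DifferentialForm.ext fun x => by
    have h1 := hasDerivOne_translateForm ζ (degenerateConnection η f (ξ.coord a)) x
    have hl : ∀ l : Module.Dual ℝ (LieAlg EG G), l = ∑ e, l (ξ e) • ξ.coord e := fun l =>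
      (ξ.sum_dual_apply_smul_coord l).symm
    have e : (fun g : G => (translateForm EG I W g (degenerateConnection η f (ξ.coord a))).val x) =
        fun g => ∑ e, (LinearMap.toSpanSingleton ℝ (CotangentAlgebra E)
          ((degenerateConnection η f (ξ.coord e)).val x)) (ξ.coord a (Ad g⁻¹ (ξ e))) := by
      ext g
      rw [translateForm_degenerateConnection, hl (ξ.coord a ∘ₗ Ad g⁻¹)]
      simp [map_sum]
    have h2 : HasDerivOne (fun g => ∑ e, (LinearMap.toSpanSingleton ℝ (CotangentAlgebra E)
          ((degenerateConnection η f (ξ.coord e)).val x)) (ξ.coord a (Ad g⁻¹ (ξ e))))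
        (∑ e, (LinearMap.toSpanSingleton ℝ (CotangentAlgebra E)
          ((degenerateConnection η f (ξ.coord e)).val x)) (-ξ.coord a ⁅ζ, ξ e⁆)) ζ :=
      HasDerivOne.sum _ fun i _ => (HasDerivOne.real
        (derivOne_Ad_inv_apply (LinearMap.toContinuousLinearMap (E := EG) (ξ.coord a)) ζ (ξ i)).1
        (derivOne_Ad_inv_apply (LinearMap.toContinuousLinearMap (E := EG) (ξ.coord a)) ζ (ξ i)).2).map _
    rw [e] at h1
    rw [h1.unique h2]
    simp [map_sum]

end Connection

end Action

section SymDerivation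

variable {V : Type*} [AddCommGroup V] [Module ℝ V]

/-- The algebra homomorphism `s ↦ s + ε ∂s` that defines `symDerivation`. -/
def symDerivationHom (A : V →ₗ[ℝ] SymmetricAlgebra ℝ V) :
    SymmetricAlgebra ℝ V →ₐ[ℝ] TrivSqZeroExt (SymmetricAlgebra ℝ V) (SymmetricAlgebra ℝ V) :=
  SymmetricAlgebra.lift
    { toFun := fun l => TrivSqZeroExt.inl (SymmetricAlgebra.ι ℝ V l) + TrivSqZeroExt.inr (A l)
      map_add' := fun l l' => by ext <;> simp
      map_smul' := fun r l => by ext <;> simp }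

/-- The derivation of the symmetric algebra that is given by `A` on the generators. -/
def symDerivation (A : V →ₗ[ℝ] SymmetricAlgebra ℝ V) :
    SymmetricAlgebra ℝ V →ₗ[ℝ] SymmetricAlgebra ℝ V where
  toFun s := (symDerivationHom A s).snd
  map_add' s t := by simp
  map_smul' r s := by simp

variable (A : V →ₗ[ℝ] SymmetricAlgebra ℝ V)

@[simp] lemma symDerivation_ι (l : V) : symDerivation A (SymmetricAlgebra.ι ℝ V l) = A l := by
  simp [symDerivation, symDerivationHom]

lemma symDerivation_mul (s t : SymmetricAlgebra ℝ V) :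
    symDerivation A (s * t) = symDerivation A s * t + s * symDerivation A t := by
  have h : ∀ s, (symDerivationHom A s).fst = s := fun s => by
    refine DFunLike.congr_fun (SymmetricAlgebra.algHom_ext
      (F := (TrivSqZeroExt.fstHom ℝ _ _).comp (symDerivationHom A)) (G := AlgHom.id ℝ _) ?_) s
    ext l
    simp [symDerivationHom]
  change (symDerivationHom A (s * t)).snd = (symDerivationHom A s).snd * t +
    s * (symDerivationHom A t).snd
  rw [map_mul, TrivSqZeroExt.snd_mul, h, h, smul_eq_mul, op_smul_eq_mul]
  ring

lemma symDerivation_one : symDerivation A 1 = 0 := by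
  simpa using symDerivation_mul A 1 1

end SymDerivation

section LieBasis
set_option linter.unusedSectionVars false

variable {EG : Type*} [NormedAddCommGroup EG] [NormedSpace ℝ EG] [FiniteDimensional ℝ EG]
  {G : Type*} [TopologicalSpace G] [ChartedSpace EG G] [Group G] [LieGroup 𝓘(ℝ, EG) ∞ G]
  [T2Space G] {m : ℕ} (ξ : Module.Basis (Fin m) ℝ (LieAlg EG G))

lemma lie_sum_right {ι : Type*} (s : Finset ι) (ζ : LieAlg EG G) (r : ι → ℝ)
    (χ : ι → LieAlg EG G) : ⁅ζ, ∑ i ∈ s, r i • χ i⁆ = ∑ i ∈ s, r i • ⁅ζ, χ i⁆ := by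
  have : CompleteSpace EG := FiniteDimensional.complete ℝ EG
  have i3 : LieGroup 𝓘(ℝ, EG) (minSmoothness ℝ 3) G :=
    LieGroup.of_le (n := ∞) (by simp only [minSmoothness_of_isRCLikeNormedField]; exact ENat.LEInfty.out)
  rw [lie_sum]
  exact Finset.sum_congr rfl fun i _ => lie_smul _ _ _

lemma lie_swap (ζ χ : LieAlg EG G) : ⁅ζ, χ⁆ = -⁅χ, ζ⁆ := by
  have : CompleteSpace EG := FiniteDimensional.complete ℝ EG
  have i3 : LieGroup 𝓘(ℝ, EG) (minSmoothness ℝ 3) G :=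
    LieGroup.of_le (n := ∞) (by simp only [minSmoothness_of_isRCLikeNormedField]; exact ENat.LEInfty.out)
  exact (lie_skew ζ χ).symm

lemma lie_jacobi' (ζ χ υ : LieAlg EG G) :
    ⁅ζ, ⁅χ, υ⁆⁆ + ⁅χ, ⁅υ, ζ⁆⁆ + ⁅υ, ⁅ζ, χ⁆⁆ = 0 := by
  have : CompleteSpace EG := FiniteDimensional.complete ℝ EG
  have i3 : LieGroup 𝓘(ℝ, EG) (minSmoothness ℝ 3) G :=
    LieGroup.of_le (n := ∞) (by simp only [minSmoothness_of_isRCLikeNormedField]; exact ENat.LEInfty.out)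
  exact lie_jacobi ζ χ υ

lemma lie_sum_left {ι : Type*} (s : Finset ι) (χ : LieAlg EG G) (r : ι → ℝ)
    (ζ : ι → LieAlg EG G) : ⁅∑ i ∈ s, r i • ζ i, χ⁆ = ∑ i ∈ s, r i • ⁅ζ i, χ⁆ := by
  rw [lie_swap, lie_sum_right, ← Finset.sum_neg_distrib]
  exact Finset.sum_congr rfl fun i _ => by rw [lie_swap χ, smul_neg, neg_neg]

lemma sum_coord_smul (ζ : LieAlg EG G) : ∑ e, ξ.coord e ζ • ξ e = ζ := ξ.sum_repr ζ

/-- The structure constants. -/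
def structureConst (a b e : Fin m) : ℝ := ξ.coord a ⁅ξ b, ξ e⁆

lemma sum_structureConst_mul (a b : Fin m) (ζ : LieAlg EG G) :
    ∑ e, structureConst ξ a b e * ξ.coord e ζ = ξ.coord a ⁅ξ b, ζ⁆ := by
  conv_rhs => rw [← sum_coord_smul ξ ζ, lie_sum_right, map_sum]
  exact Finset.sum_congr rfl fun e _ => by rw [map_smul, smul_eq_mul, mul_comm]; rfl

lemma structureConst_jacobi (a b p q : Fin m) :
    ∑ e, (structureConst ξ a b e * structureConst ξ e p q +
      structureConst ξ a p e * structureConst ξ e q b +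
      structureConst ξ a q e * structureConst ξ e b p) = 0 := by
  rw [Finset.sum_add_distrib, Finset.sum_add_distrib]
  refine (congrArg₂ (· + ·) (congrArg₂ (· + ·) (sum_structureConst_mul ξ a b ⁅ξ p, ξ q⁆)
    (sum_structureConst_mul ξ a p ⁅ξ q, ξ b⁆)) (sum_structureConst_mul ξ a q ⁅ξ b, ξ p⁆)).trans ?_
  rw [← map_add, ← map_add, lie_jacobi', map_zero]

lemma structureConst_Ad (g : G) (a p q : Fin m) :
    ∑ b, ∑ e, structureConst ξ a b e * (ξ.coord b (Ad g (ξ p)) * ξ.coord e (Ad g (ξ q))) =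
      ∑ d, ξ.coord a (Ad g (ξ d)) * structureConst ξ d p q := by
  have h1 : ∀ b, ∑ e, structureConst ξ a b e *
      (ξ.coord b (Ad g (ξ p)) * ξ.coord e (Ad g (ξ q))) =
      ξ.coord b (Ad g (ξ p)) * ξ.coord a ⁅ξ b, Ad g (ξ q)⁆ := fun b => by
    rw [← sum_structureConst_mul, Finset.mul_sum]
    exact Finset.sum_congr rfl fun e _ => by ring
  have h2 : ∑ b, ξ.coord b (Ad g (ξ p)) * ξ.coord a ⁅ξ b, Ad g (ξ q)⁆ =
      ξ.coord a ⁅Ad g (ξ p), Ad g (ξ q)⁆ := by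
    conv_rhs => rw [← sum_coord_smul ξ (Ad g (ξ p)), lie_sum_left, map_sum]
    exact Finset.sum_congr rfl fun e _ => by rw [map_smul, smul_eq_mul]
  rw [Finset.sum_congr rfl fun b _ => h1 b, h2, ← Ad_lie]
  conv_lhs => rw [← sum_coord_smul ξ ⁅ξ p, ξ q⁆, map_sum, map_sum]
  exact Finset.sum_congr rfl fun e _ => by
    rw [map_smul, map_smul, smul_eq_mul, mul_comm]; rfl

end LieBasis

section Calculus
set_option linter.unusedSectionVars false

variable {EG : Type*} [NormedAddCommGroup EG] [NormedSpace ℝ EG] [FiniteDimensional ℝ EG]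
  {G : Type*} [TopologicalSpace G] [ChartedSpace EG G] [Group G] [LieGroup 𝓘(ℝ, EG) ∞ G]
  [T2Space G] {E : Type*} [NormedAddCommGroup E] [NormedSpace ℝ E] [FiniteDimensional ℝ E]
  {H : Type*} [TopologicalSpace H] (I : ModelWithCorners ℝ E H)
  (W : Type*) [TopologicalSpace W] [ChartedSpace H W] [IsManifold I ∞ W]
  [MulAction G W] [ContMDiffSMul 𝓘(ℝ, EG) I ∞ G W] [T2Space W] [CompactSpace W]
  {m : ℕ} (ξ : Module.Basis (Fin m) ℝ (LieAlg EG G))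

/-- The derivative of the coadjoint action in the direction `ζ`. -/
def coadjointDeriv (ζ : LieAlg EG G) : SymDual EG G →ₗ[ℝ] SymDual EG G :=
  symDerivation (-∑ e, (LinearMap.toSpanSingleton ℝ (SymDual EG G) (polyGen ξ e)) ∘ₗ
    { toFun := fun l : Module.Dual ℝ (LieAlg EG G) => l ⁅ζ, ξ e⁆
      map_add' := fun _ _ => rfl
      map_smul' := fun _ _ => rfl })

/-- The derivation `∂/∂Θ^a` of `S(𝔤*)`. -/
def polyDeriv (a : Fin m) : SymDual EG G →ₗ[ℝ] SymDual EG G :=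
  symDerivation (Algebra.linearMap ℝ (SymDual EG G) ∘ₗ Module.Dual.eval ℝ _ (ξ a))

lemma coadjointDeriv_ι (ζ : LieAlg EG G) (l : Module.Dual ℝ (LieAlg EG G)) :
    coadjointDeriv ξ ζ (SymmetricAlgebra.ι ℝ _ l) = -∑ e, l ⁅ζ, ξ e⁆ • polyGen ξ e := by
  rw [coadjointDeriv, symDerivation_ι]
  simp

lemma polyDeriv_polyGen (b a : Fin m) :
    polyDeriv ξ b (polyGen ξ a) = if b = a then 1 else 0 := by
  rw [polyDeriv, polyGen, symDerivation_ι]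
  simp [Finsupp.single_apply]

/-- The Lie derivative on `S(𝔤*) ⊗ Ω(W)`. -/
def totalLieDeriv (ζ : LieAlg EG G) : PolyForms EG G I W →ₗ[ℝ] PolyForms EG G I W :=
  (coadjointDeriv ξ ζ).rTensor (DifferentialForm I W) + (lieDeriv I W ζ).lTensor (SymDual EG G)

lemma cartanD_eq : cartanD I W ξ = (extDeriv I W).lTensor (SymDual EG G) +
    -∑ a, LinearMap.mulLeft ℝ (polyGen ξ a ⊗ₜ[ℝ] (1 : DifferentialForm I W)) ∘ₗ
      (fundamentalContract I (ξ a)).lTensor (SymDual EG G) := by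
  rw [← sub_eq_add_neg]
  refine congrArg₂ (· - ·) rfl (Finset.sum_congr rfl fun a _ => ?_)
  exact TensorProduct.ext' fun s α => by simp

lemma cartanD_one_tmul (α : DifferentialForm I W) :
    cartanD I W ξ ((1 : SymDual EG G) ⊗ₜ[ℝ] α) = 1 ⊗ₜ extDeriv I W α -
      ∑ a, polyGen ξ a ⊗ₜ fundamentalContract I (ξ a) α := by
  simp [cartanD]

lemma totalLieDeriv_one_tmul (ζ : LieAlg EG G) (α : DifferentialForm I W) :
    totalLieDeriv I W ξ ζ ((1 : SymDual EG G) ⊗ₜ[ℝ] α) = 1 ⊗ₜ lieDeriv I W ζ α := by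
  simp [totalLieDeriv, coadjointDeriv, symDerivation_one]

variable {I W} in
lemma lieDeriv_ofFun (ζ : LieAlg EG G) (h : W → ℝ) (hh : ContMDiff I 𝓘(ℝ, ℝ) ∞ h) :
    lieDeriv I W ζ (ofFun h hh) = ofFun (fun x => differential I h x (fundamentalField I ζ x))
      ((smoothVectorField_fundamentalField I ζ).contMDiff hh) := by
  rw [lieDeriv, LinearMap.add_apply, LinearMap.comp_apply, LinearMap.comp_apply,
    fundamentalContract, contract_ofFun, contract_extDeriv_ofFun, map_zero, zero_add]

variable {I W} in
lemma lieDeriv_extDeriv (ζ : LieAlg EG G) (α : DifferentialForm I W) :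
    lieDeriv I W ζ (extDeriv I W α) = extDeriv I W (lieDeriv I W ζ α) := by
  rw [lieDeriv, LinearMap.add_apply, LinearMap.add_apply, map_add]
  simp [extDeriv_extDeriv]

lemma differential_fundamentalField_sum {h : W → ℝ} (hh : ContMDiff I 𝓘(ℝ, ℝ) ∞ h)
    {ι : Type*} (s : Finset ι) (r : ι → ℝ) (ζ : ι → LieAlg EG G) (x : W) :
    differential I h x (fundamentalField I (∑ i ∈ s, r i • ζ i) x) =
      ∑ i ∈ s, r i * differential I h x (fundamentalField I (ζ i) x) := by
  simp only [differential_fundamentalField hh]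
  refine (map_sum (derivOne EG fun g : G => h (g⁻¹ • x)) _ s).trans ?_
  exact Finset.sum_congr rfl fun i _ => map_smul _ _ _

variable {I W} in
lemma lieDeriv_comm_ofFun (a b : Fin m) (h : W → ℝ) (hh : ContMDiff I 𝓘(ℝ, ℝ) ∞ h) :
    lieDeriv I W (ξ a) (lieDeriv I W (ξ b) (ofFun h hh)) -
      lieDeriv I W (ξ b) (lieDeriv I W (ξ a) (ofFun h hh)) =
      ∑ e, structureConst ξ e a b • lieDeriv I W (ξ e) (ofFun h hh) :=
  DifferentialForm.ext fun x => by
    simp only [lieDeriv_ofFun, map_sub, map_sum, map_smul, val_ofFun, Pi.sub_apply,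
      Finset.sum_apply, Pi.smul_apply, funForm]
    rw [← map_sub, ← fundamentalField_lie hh]
    conv_lhs => rw [← sum_coord_smul ξ ⁅ξ a, ξ b⁆, differential_fundamentalField_sum I W hh]
    rw [map_sum]
    exact Finset.sum_congr rfl fun e _ => by rw [map_mul, Algebra.smul_def]; rfl

lemma adjoin_polyForms : Algebra.adjoin ℝ (Set.range (fun a => polyGen ξ a ⊗ₜ[ℝ]
    (1 : DifferentialForm I W)) ∪ (fun α => (1 : SymDual EG G) ⊗ₜ[ℝ] α) '' functionForms I W ∪
    (fun α => (1 : SymDual EG G) ⊗ₜ[ℝ] extDeriv I W α) '' functionForms I W) = ⊤ := by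
  set 𝒮 := Algebra.adjoin ℝ (Set.range (fun a => polyGen ξ a ⊗ₜ[ℝ]
    (1 : DifferentialForm I W)) ∪ (fun α => (1 : SymDual EG G) ⊗ₜ[ℝ] α) '' functionForms I W ∪
    (fun α => (1 : SymDual EG G) ⊗ₜ[ℝ] extDeriv I W α) '' functionForms I W) with h𝒮
  have h1 : ∀ s : SymDual EG G, s ⊗ₜ[ℝ] (1 : DifferentialForm I W) ∈ 𝒮 := fun s => by
    change s ∈ 𝒮.comap
      (Algebra.TensorProduct.includeLeft : SymDual EG G →ₐ[ℝ] PolyForms EG G I W)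
    induction s using SymmetricAlgebra.induction with
    | algebraMap r => exact algebraMap_mem _ r
    | mul s t hs ht => exact mul_mem hs ht
    | add s t hs ht => exact add_mem hs ht
    | ι l =>
      have hl : SymmetricAlgebra.ι ℝ _ l = ∑ a, l (ξ a) • polyGen ξ a := by
        conv_lhs => rw [← ξ.sum_dual_apply_smul_coord l, map_sum]
        simp only [map_smul]; rfl
      rw [hl]
      refine Subalgebra.sum_mem _ fun a _ => Subalgebra.smul_mem _ ?_ _
      exact Algebra.subset_adjoin (Or.inl (Or.inl ⟨a, rfl⟩))
  have h2 : ∀ α : DifferentialForm I W, (1 : SymDual EG G) ⊗ₜ[ℝ] α ∈ 𝒮 := fun α => by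
    have : (⊤ : Subalgebra ℝ (DifferentialForm I W)) ≤ 𝒮.comap
        (Algebra.TensorProduct.includeRight : DifferentialForm I W →ₐ[ℝ] PolyForms EG G I W) := by
      rw [← adjoin_functionForms, Algebra.adjoin_le_iff]
      rintro β (hβ | ⟨β, hβ, rfl⟩)
      · exact Algebra.subset_adjoin (Or.inl (Or.inr ⟨β, hβ, rfl⟩))
      · exact Algebra.subset_adjoin (Or.inr ⟨β, hβ, rfl⟩)
    exact this (Algebra.mem_top (x := α))
  rw [eq_top_iff]
  rintro z -
  induction z using TensorProduct.induction_on with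
  | zero => exact zero_mem _
  | add x y hx hy => exact add_mem hx hy
  | tmul s α =>
    have : s ⊗ₜ[ℝ] α = s ⊗ₜ[ℝ] (1 : DifferentialForm I W) * (1 : SymDual EG G) ⊗ₜ[ℝ] α := by simp
    rw [this]
    exact mul_mem (h1 s) (h2 α)

lemma cartanD_function {α : DifferentialForm I W} (hα : α ∈ functionForms I W) :
    cartanD I W ξ ((1 : SymDual EG G) ⊗ₜ[ℝ] α) = 1 ⊗ₜ extDeriv I W α := by
  obtain ⟨h, hh, rfl⟩ := hα
  rw [cartanD_one_tmul]
  simp [fundamentalContract, contract_ofFun]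

lemma fundamentalContract_extDeriv_function (ζ : LieAlg EG G) {α : DifferentialForm I W}
    (hα : α ∈ functionForms I W) :
    fundamentalContract I ζ (extDeriv I W α) = lieDeriv I W ζ α := by
  obtain ⟨h, hh, rfl⟩ := hα
  simp [lieDeriv, fundamentalContract, contract_ofFun]

lemma even_functionForm {α : DifferentialForm I W} (hα : α ∈ functionForms I W) :
    EvenElement (grading I W) α := by
  obtain ⟨h, hh, rfl⟩ := hα
  exact even_ofFun h hh

lemma lieDeriv_mem_functionForms (ζ : LieAlg EG G) {α : DifferentialForm I W}
    (hα : α ∈ functionForms I W) : lieDeriv I W ζ α ∈ functionForms I W := by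
  obtain ⟨h, hh, rfl⟩ := hα
  exact ⟨_, _, lieDeriv_ofFun ζ h hh⟩

lemma even_one : EvenElement (grading I W) (1 : DifferentialForm I W) :=
  ⟨map_one _, fun α => by rw [one_mul, mul_one]⟩

/-- The Cartan calculus on `S(𝔤*) ⊗ Ω(W)`. -/
def cartanCalculus : CartanCalculus (PolyForms EG G I W) m where
  τ := extendAlg (SymDual EG G) (grading I W)
  D := cartanD I W ξ
  ι a := (fundamentalContract I (ξ a)).lTensor (SymDual EG G)
  L a := totalLieDeriv I W ξ (ξ a)
  dd a := (polyDeriv ξ a).rTensor (DifferentialForm I W)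
  Θ a := polyGen ξ a ⊗ₜ 1
  c := structureConst ξ
  functions := (fun α => (1 : SymDual EG G) ⊗ₜ[ℝ] α) '' functionForms I W
  τ_τ := extendAlg_involutive grading_grading
  antiderivation_D := by
    rw [cartanD_eq]
    exact (antiderivation_extDeriv I W).lTensor.add (IsAntiderivation.sum _ fun a _ =>
      (antiderivation_fundamentalContract (ξ a)).lTensor.mul_left_even
        ((even_one I W).tmul (polyGen ξ a))).neg
  antiderivation_ι a := (antiderivation_fundamentalContract (ξ a)).lTensor
  leibniz_L a x y := by
    simp only [totalLieDeriv, LinearMap.add_apply]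
    rw [leibniz_rTensor (δ := coadjointDeriv ξ (ξ a)) (symDerivation_mul _),
      leibniz_lTensor (lieDeriv_mul (ξ a)), add_mul, mul_add]
    abel
  leibniz_dd a := leibniz_rTensor (symDerivation_mul _)
  even_Θ a := (even_one I W).tmul _
  D_Θ a := by
    simp [cartanD, (antiderivation_extDeriv I W).map_one,
      (antiderivation_fundamentalContract _).map_one]
  ι_Θ b a := by simp [(antiderivation_fundamentalContract _).map_one]
  L_Θ b a := by
    have h1 : lieDeriv I W (ξ b) 1 = 0 := by
      simp [lieDeriv, (antiderivation_extDeriv I W).map_one,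
        (antiderivation_fundamentalContract _).map_one]
    rw [totalLieDeriv, LinearMap.add_apply, LinearMap.lTensor_tmul, LinearMap.rTensor_tmul, h1,
      TensorProduct.tmul_zero, add_zero, polyGen, coadjointDeriv_ι, TensorProduct.neg_tmul,
      TensorProduct.sum_tmul]
    simp only [← TensorProduct.smul_tmul', structureConst]
  dd_Θ b a := by
    rw [LinearMap.rTensor_tmul, polyDeriv_polyGen]
    split_ifs
    · rfl
    · exact TensorProduct.zero_tmul _ _
  even_function := by
    rintro _ ⟨α, hα, rfl⟩
    exact (even_functionForm I W hα).tmul _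
  ι_function := by
    rintro a _ ⟨_, ⟨h, hh, rfl⟩, rfl⟩
    simp [fundamentalContract, contract_ofFun]
  dd_function := by
    rintro a _ ⟨α, hα, rfl⟩
    simp [polyDeriv, symDerivation_one]
  L_function := by
    rintro a _ ⟨α, hα, rfl⟩
    exact ⟨_, lieDeriv_mem_functionForms I W (ξ a) hα, (totalLieDeriv_one_tmul I W ξ _ _).symm⟩
  ι_D := by
    rintro a _ ⟨α, hα, rfl⟩
    simp only [cartanD_function I W ξ hα, totalLieDeriv_one_tmul, LinearMap.lTensor_tmul,
      fundamentalContract_extDeriv_function I W _ hα]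
  dd_D := by
    rintro a _ ⟨α, hα, rfl⟩
    simp [cartanD_function I W ξ hα, polyDeriv, symDerivation_one]
  L_D := by
    rintro a _ ⟨α, hα, rfl⟩
    simp only [cartanD_function I W ξ hα, totalLieDeriv_one_tmul, lieDeriv_extDeriv,
      cartanD_function I W ξ (lieDeriv_mem_functionForms I W (ξ a) hα)]
  D_D := by
    rintro _ ⟨α, hα, rfl⟩
    simp only [cartanD_function I W ξ hα, totalLieDeriv_one_tmul, cartanD_one_tmul,
      extDeriv_extDeriv, fundamentalContract_extDeriv_function I W _ hα,
      TensorProduct.tmul_zero, zero_sub, Algebra.TensorProduct.tmul_mul_tmul, one_mul, mul_one]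
  L_L := by
    rintro a b _ ⟨_, ⟨h, hh, rfl⟩, rfl⟩
    simp only [totalLieDeriv_one_tmul, ← TensorProduct.tmul_sub, lieDeriv_comm_ofFun ξ a b,
      TensorProduct.tmul_sum, TensorProduct.tmul_smul]
  antisymm a b e := by
    rw [structureConst, lie_swap, map_neg]; rfl
  jacobi := structureConst_jacobi ξ
  generates := by
    refine Eq.trans ?_ (adjoin_polyForms I W ξ)
    congr 2
    rw [Set.image_image]
    exact Set.image_congr fun α hα => cartanD_function I W ξ hα

end Calculus

section Invariants
set_option linter.unusedSectionVars false

variable {EG : Type*} [NormedAddCommGroup EG] [NormedSpace ℝ EG] [FiniteDimensional ℝ EG]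
  {G : Type*} [TopologicalSpace G] [ChartedSpace EG G] [Group G] [LieGroup 𝓘(ℝ, EG) ∞ G]
  [T2Space G] {E : Type*} [NormedAddCommGroup E] [NormedSpace ℝ E] [FiniteDimensional ℝ E]
  {H : Type*} [TopologicalSpace H] {I : ModelWithCorners ℝ E H}
  {W : Type*} [TopologicalSpace W] [ChartedSpace H W] [IsManifold I ∞ W]
  [MulAction G W] [ContMDiffSMul 𝓘(ℝ, EG) I ∞ G W] [T2Space W] [CompactSpace W]
  {m : ℕ} (ξ : Module.Basis (Fin m) ℝ (LieAlg EG G))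

/-- The evaluation of polynomial functions on `𝔤`. -/
def polyEval (X : LieAlg EG G) : SymDual EG G →ₐ[ℝ] ℝ :=
  SymmetricAlgebra.lift (Module.Dual.eval ℝ _ X)

@[simp] lemma polyEval_ι (X : LieAlg EG G) (l : Module.Dual ℝ (LieAlg EG G)) :
    polyEval X (SymmetricAlgebra.ι ℝ _ l) = l X := by simp [polyEval]

@[simp] lemma coadjoint_ι (g : G) (l : Module.Dual ℝ (LieAlg EG G)) :
    coadjoint g (SymmetricAlgebra.ι ℝ _ l) = SymmetricAlgebra.ι ℝ _ (l ∘ₗ Ad g⁻¹) := by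
  simp [coadjoint]; rfl

lemma coadjoint_one (s : SymDual EG G) : coadjoint (1 : G) s = s := by
  induction s using SymmetricAlgebra.induction with
  | algebraMap r => exact AlgHom.commutes _ r
  | ι l =>
    have : l ∘ₗ Ad (1 : G)⁻¹ = l := LinearMap.ext fun X => by
      rw [LinearMap.comp_apply, inv_one, Ad_one]
    rw [coadjoint_ι, this]
  | mul s t hs ht => rw [map_mul, hs, ht]
  | add s t hs ht => rw [map_add, hs, ht]

lemma coadjointDeriv_mul (ζ : LieAlg EG G) (s t : SymDual EG G) : coadjointDeriv ξ ζ (s * t) =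
    coadjointDeriv ξ ζ s * t + s * coadjointDeriv ξ ζ t := symDerivation_mul _ s t

lemma hasDerivOne_coadjoint (ζ X : LieAlg EG G) (s : SymDual EG G) :
    HasDerivOne (fun g : G => polyEval X (coadjoint g s)) (polyEval X (coadjointDeriv ξ ζ s)) ζ := by
  induction s using SymmetricAlgebra.induction with
  | algebraMap r =>
    have : coadjointDeriv ξ ζ (algebraMap ℝ _ r) = 0 := by
      rw [Algebra.algebraMap_eq_smul_one, map_smul, coadjointDeriv, symDerivation_one, smul_zero]
    simp only [AlgHom.commutes, this, map_zero]
    exact HasDerivOne.const _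
  | ι l =>
    have e : (fun g : G => polyEval X (coadjoint g (SymmetricAlgebra.ι ℝ _ l))) =
        fun g => ∑ e, LinearMap.mulLeft ℝ (ξ.coord e X) (l (Ad g⁻¹ (ξ e))) := by
      ext g
      rw [coadjoint_ι, polyEval_ι, LinearMap.comp_apply]
      conv_lhs => rw [← sum_coord_smul ξ X, map_sum, map_sum]
      simp
    have e2 : polyEval X (coadjointDeriv ξ ζ (SymmetricAlgebra.ι ℝ _ l)) =
        ∑ e, LinearMap.mulLeft ℝ (ξ.coord e X) (-l ⁅ζ, ξ e⁆) := by
      rw [coadjointDeriv_ι, map_neg, map_sum, ← Finset.sum_neg_distrib]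
      refine Finset.sum_congr rfl fun e _ => ?_
      rw [map_smul, polyGen, polyEval_ι, LinearMap.mulLeft_apply, smul_eq_mul]
      ring
    rw [e, e2]
    refine HasDerivOne.sum _ fun e _ => HasDerivOne.map (V := ℝ) (V' := ℝ) ?_ _
    exact HasDerivOne.real
      (derivOne_Ad_inv_apply (LinearMap.toContinuousLinearMap (E := EG) l) ζ (ξ e)).1
      (derivOne_Ad_inv_apply (LinearMap.toContinuousLinearMap (E := EG) l) ζ (ξ e)).2
  | mul s t hs ht =>
    have := hs.mul ht
    simp only [coadjoint_one] at this
    simpa only [coadjointDeriv_mul, map_add, map_mul] using this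
  | add s t hs ht => simpa only [map_add] using hs.add ht

/-- The value at `x` of the form that corresponds to a polynomial on `𝔤`, evaluated at `X`. -/
def polyFormEval (X : LieAlg EG G) (x : W) : PolyForms EG G I W →ₗ[ℝ] CotangentAlgebra E :=
  TensorProduct.lift ((LinearMap.lsmul ℝ (CotangentAlgebra E)).compl₁₂
    (polyEval X).toLinearMap (LinearMap.proj x ∘ₗ DifferentialForm.val.toLinearMap))

@[simp] lemma polyFormEval_tmul (X : LieAlg EG G) (x : W) (s : SymDual EG G)
    (α : DifferentialForm I W) :
    polyFormEval X x (s ⊗ₜ[ℝ] α) = polyEval X s • α.val x := rfl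

lemma hasDerivOne_translate (ζ X : LieAlg EG G) (x : W) (z : PolyForms EG G I W) :
    HasDerivOne (fun g : G => polyFormEval X x (translate EG I W g z))
      (polyFormEval X x (totalLieDeriv I W ξ ζ z)) ζ := by
  induction z using TensorProduct.induction_on with
  | zero => simpa using HasDerivOne.const (EG := EG) (G := G) (ζ := ζ) (0 : CotangentAlgebra E)
  | add y z hy hz => simpa only [map_add] using hy.add hz
  | tmul s α =>
    have := (hasDerivOne_coadjoint ξ ζ X s).smul (hasDerivOne_translateForm ζ α x)
    simp only [coadjoint_one, translateForm_one] at this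
    exact this

lemma polyEval_basis (X : LieAlg EG G) (K : Fin m →₀ ℕ) :
    polyEval X (ξ.dualBasis.symmetricAlgebra K) =
      MvPolynomial.eval (fun a => ξ.coord a X) (MvPolynomial.monomial K 1) := by
  have h : (polyEval X).comp (SymmetricAlgebra.equivMvPolynomial ξ.dualBasis).symm.toAlgHom =
      MvPolynomial.aeval (fun a => ξ.coord a X) := by
    refine MvPolynomial.algHom_ext fun a => ?_
    simp
  have := DFunLike.congr_fun h (MvPolynomial.monomial K 1)
  rw [← MvPolynomial.coe_aeval_eq_eval]
  refine Eq.trans ?_ this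
  simp [Module.Basis.symmetricAlgebra]

lemma eq_zero_of_polyFormEval {m : ℕ} (ξ : Module.Basis (Fin m) ℝ (LieAlg EG G))
    {z : PolyForms EG G I W}
    (h : ∀ (X : LieAlg EG G) (x : W), polyFormEval X x z = 0) : z = 0 := by
  set b := ξ.dualBasis.symmetricAlgebra with hb
  set e := TensorProduct.equivFinsuppOfBasisLeft (N := DifferentialForm I W) b with he
  have hz : z = (e z).sum fun K α => b K ⊗ₜ α := by
    rw [← TensorProduct.equivFinsuppOfBasisLeft_symm_apply, LinearEquiv.symm_apply_apply]
  suffices e z = 0 from (LinearEquiv.map_eq_zero_iff e).mp this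
  ext K
  refine DifferentialForm.ext fun x => ?_
  rw [Finsupp.coe_zero, Pi.zero_apply, map_zero, Pi.zero_apply]
  refine (Module.forall_dual_apply_eq_zero_iff ℝ _).mp fun μ => ?_
  set p : MvPolynomial (Fin m) ℝ := (e z).sum fun K α => MvPolynomial.monomial K (μ (α.val x)) with hp
  have hp0 : p = 0 := by
    refine MvPolynomial.funext fun v => ?_
    have h1 := congrArg μ (h (∑ a, v a • ξ a) x)
    rw [hz, Finsupp.sum, map_sum, map_sum, map_zero] at h1
    rw [map_zero, hp, Finsupp.sum, map_sum, ← h1]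
    refine Finset.sum_congr rfl fun K _ => ?_
    rw [polyFormEval_tmul, map_smul, hb, polyEval_basis]
    have hv : (fun a => ξ.coord a (∑ a, v a • ξ a)) = v := by
      ext a
      simp [Finsupp.single_apply]
    rw [hv, MvPolynomial.eval_monomial, MvPolynomial.eval_monomial, smul_eq_mul, one_mul, mul_comm]
  have h2 : MvPolynomial.coeff K p = μ ((e z K).val x) := by
    rw [hp, Finsupp.sum, MvPolynomial.coeff_sum]
    simp only [MvPolynomial.coeff_monomial]
    rw [Finset.sum_ite_eq']
    split_ifs with hK
    · rfl
    · rw [Finsupp.notMem_support_iff.mp hK]; simp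
  rw [← h2, hp0, MvPolynomial.coeff_zero]

/-- The Lie derivatives of equivariant forms vanish. -/
theorem totalLieDeriv_eq_zero {z : PolyForms EG G I W} (hz : z ∈ equivariantForms EG G I W)
    (ζ : LieAlg EG G) : totalLieDeriv I W ξ ζ z = 0 :=
  eq_zero_of_polyFormEval ξ fun X x => by
    have h := hasDerivOne_translate ξ ζ X x z
    have hz' : ∀ g : G, translate EG I W g z = z := hz
    simp only [hz'] at h
    exact h.unique (HasDerivOne.const _)

lemma isConnectionForm (η : Connection EG G I W) (f : CutOff G I W) :
    (cartanCalculus I W ξ).IsConnectionForm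
      (fun a => (1 : SymDual EG G) ⊗ₜ[ℝ] degenerateConnection η f (ξ.coord a)) where
  odd a := (odd_degenerateConnection η f _).tmul _
  L_eq b a := by
    change totalLieDeriv I W ξ (ξ b) _ = _
    rw [totalLieDeriv_one_tmul, lieDeriv_degenerateConnection η f ξ, TensorProduct.tmul_neg,
      TensorProduct.tmul_sum]
    simp only [TensorProduct.tmul_smul]
    rfl

lemma coord_comp_Ad (g : G) (a : Fin m) :
    ξ.coord a ∘ₗ Ad g = ∑ b, ξ.coord a (Ad g (ξ b)) • ξ.coord b :=
  (ξ.sum_dual_apply_smul_coord _).symm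

lemma polyDeriv_coadjoint (g : G) (a : Fin m) (s : SymDual EG G) :
    polyDeriv ξ a (coadjoint g s) =
      ∑ b, ξ.coord b (Ad g⁻¹ (ξ a)) • coadjoint g (polyDeriv ξ b s) := by
  have hm : ∀ a (s t : SymDual EG G), polyDeriv ξ a (s * t) =
      polyDeriv ξ a s * t + s * polyDeriv ξ a t := fun a => symDerivation_mul _
  induction s using SymmetricAlgebra.induction with
  | algebraMap r =>
    have h0 : ∀ a, polyDeriv ξ a (algebraMap ℝ (SymDual EG G) r) = 0 := fun a => by
      rw [Algebra.algebraMap_eq_smul_one, map_smul, polyDeriv, symDerivation_one, smul_zero]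
    simp [h0]
  | ι l =>
    simp only [coadjoint_ι, polyDeriv, symDerivation_ι, LinearMap.comp_apply,
      Algebra.linearMap_apply, AlgHom.commutes, Module.Dual.eval_apply]
    conv_lhs => rw [← sum_coord_smul ξ (Ad g⁻¹ (ξ a)), map_sum, map_sum]
    exact Finset.sum_congr rfl fun b _ => by
      rw [map_smul, smul_eq_mul, map_mul, ← Algebra.smul_def]
  | mul s t hs ht =>
    simp only [map_mul, hm, hs, ht, map_add, smul_add, Finset.sum_add_distrib, Finset.sum_mul,
      Finset.mul_sum, smul_mul_assoc, mul_smul_comm]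
  | add s t hs ht => simp only [map_add, hs, ht, smul_add, Finset.sum_add_distrib]

lemma translateForm_extDeriv (g : G) (α : DifferentialForm I W) :
    translateForm EG I W g (extDeriv I W α) = extDeriv I W (translateForm EG I W g α) :=
  pullback_extDeriv _ α

lemma fundamentalContract_translateForm (g : G) (a : Fin m) (α : DifferentialForm I W) :
    fundamentalContract I (ξ a) (translateForm EG I W g α) =
      ∑ b, ξ.coord b (Ad g⁻¹ (ξ a)) • translateForm EG I W g (fundamentalContract I (ξ b) α) := by
  have hi : ∀ ζ : LieAlg EG G, IsAntiderivation (grading I W) (fundamentalContract I ζ) :=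
    antiderivation_fundamentalContract
  have h := forms_ext_of_twisted_leibniz (u := translateForm EG I W g)
    (v := (translateForm EG I W g).comp (grading I W))
    (Φ := fundamentalContract I (ξ a) ∘ₗ (translateForm EG I W g).toLinearMap)
    (Ψ := ∑ b, ξ.coord b (Ad g⁻¹ (ξ a)) •
      (translateForm EG I W g).toLinearMap ∘ₗ fundamentalContract I (ξ b)) ?_ ?_ ?_ ?_ α
  · simpa [LinearMap.sum_apply] using h
  · intro x y
    have : grading I W (translateForm EG I W g x) = translateForm EG I W g (grading I W x) :=
      (pullback_grading _ x).symm
    simp only [LinearMap.comp_apply, AlgHom.toLinearMap_apply, map_mul, (hi _).leibniz, this,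
      AlgHom.comp_apply]
  · intro x y
    simp only [LinearMap.sum_apply, LinearMap.smul_apply, LinearMap.comp_apply,
      AlgHom.toLinearMap_apply, (hi _).leibniz, map_add, map_mul, AlgHom.comp_apply, smul_add,
      Finset.sum_add_distrib, Finset.sum_mul, Finset.mul_sum, smul_mul_assoc, mul_smul_comm]
  · intro h hh
    simp only [LinearMap.sum_apply, LinearMap.smul_apply, LinearMap.comp_apply,
      AlgHom.toLinearMap_apply, translateForm_ofFun, fundamentalContract, contract_ofFun, map_zero,
      smul_zero, Finset.sum_const_zero]
  · intro h hh
    refine DifferentialForm.ext fun x => ?_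
    simp only [LinearMap.sum_apply, LinearMap.smul_apply, LinearMap.comp_apply,
      AlgHom.toLinearMap_apply, translateForm_extDeriv_ofFun, fundamentalContract,
      contract_extDeriv_ofFun, translateForm_ofFun, map_sum, map_smul, Finset.sum_apply,
      Pi.smul_apply, val_ofFun, funForm, fundamentalField_equivariant hh]
    conv_lhs => rw [← sum_coord_smul ξ (Ad g⁻¹ (ξ a)), differential_fundamentalField_sum I W hh]
    rw [map_sum]
    exact Finset.sum_congr rfl fun e _ => by rw [map_mul, Algebra.smul_def]

lemma translate_one_tmul (g : G) (α : DifferentialForm I W) :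
    translate EG I W g ((1 : SymDual EG G) ⊗ₜ[ℝ] α) = 1 ⊗ₜ translateForm EG I W g α := by
  simp [translate]

lemma coadjoint_polyGen (g : G) (a : Fin m) :
    coadjoint g (polyGen ξ a) = ∑ b, ξ.coord a (Ad g⁻¹ (ξ b)) • polyGen ξ b := by
  rw [polyGen, coadjoint_ι, coord_comp_Ad, map_sum]
  simp only [map_smul]
  rfl

lemma translate_cartanD (g : G) (z : PolyForms EG G I W) :
    translate EG I W g (cartanD I W ξ z) = cartanD I W ξ (translate EG I W g z) := by
  induction z using TensorProduct.induction_on with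
  | zero => simp
  | add x y hx hy => simp only [map_add, hx, hy]
  | tmul s α =>
    have e : ∀ (s : SymDual EG G) (α : DifferentialForm I W), cartanD I W ξ (s ⊗ₜ α) =
        s ⊗ₜ extDeriv I W α - ∑ a, (polyGen ξ a * s) ⊗ₜ fundamentalContract I (ξ a) α :=
      fun s α => by simp [cartanD]
    have t : ∀ (s : SymDual EG G) (α : DifferentialForm I W), translate EG I W g (s ⊗ₜ α) =
        coadjoint g s ⊗ₜ translateForm EG I W g α := fun s α => rfl
    rw [e, t, e, map_sub, map_sum, t, translateForm_extDeriv]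
    congr 1
    simp only [t, map_mul, coadjoint_polyGen, fundamentalContract_translateForm ξ,
      TensorProduct.tmul_sum, TensorProduct.tmul_smul, Finset.sum_mul, TensorProduct.sum_tmul,
      smul_mul_assoc, TensorProduct.smul_tmul']
    exact Finset.sum_comm

lemma isSymmetry (η : Connection EG G I W) (f : CutOff G I W) (g : G) :
    (cartanCalculus I W ξ).IsSymmetry
      (fun a => (1 : SymDual EG G) ⊗ₜ[ℝ] degenerateConnection η f (ξ.coord a))
      (fun a b => ξ.coord a (Ad g⁻¹ (ξ b))) (translate EG I W g) where
  D := translate_cartanD ξ g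
  Θ a := by
    change coadjoint g (polyGen ξ a) ⊗ₜ translateForm EG I W g 1 = _
    rw [coadjoint_polyGen, map_one, TensorProduct.sum_tmul]
    simp only [← TensorProduct.smul_tmul']
    rfl
  connection a := by
    rw [translate_one_tmul, translateForm_degenerateConnection, coord_comp_Ad, map_sum,
      TensorProduct.tmul_sum]
    simp only [map_smul, TensorProduct.tmul_smul]
  mem_functions := by
    rintro _ ⟨_, ⟨h, hh, rfl⟩, rfl⟩
    refine ⟨_, ?_, (translate_one_tmul g _).symm⟩
    exact ⟨_, _, translateForm_ofFun g h hh⟩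
  L := by
    rintro a _ ⟨_, ⟨h, hh, rfl⟩, rfl⟩
    have hf : ofFun h hh ∈ functionForms I W := ⟨h, hh, rfl⟩
    have hf' : translateForm EG I W g (ofFun h hh) ∈ functionForms I W :=
      ⟨_, _, translateForm_ofFun g h hh⟩
    change totalLieDeriv I W ξ (ξ a) _ = ∑ b, _ • translate EG I W g (totalLieDeriv I W ξ (ξ b) _)
    simp only [translate_one_tmul, totalLieDeriv_one_tmul]
    simp only [← fundamentalContract_extDeriv_function I W _ hf,
      ← fundamentalContract_extDeriv_function I W _ hf', ← translateForm_extDeriv,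
      fundamentalContract_translateForm ξ, TensorProduct.tmul_sum, TensorProduct.tmul_smul]
  dd a z := by
    induction z using TensorProduct.induction_on with
    | zero => simp
    | add x y hx hy => simp only [map_add, hx, hy, smul_add, Finset.sum_add_distrib]
    | tmul s α =>
      change polyDeriv ξ a (coadjoint g s) ⊗ₜ translateForm EG I W g α = ∑ b, _ •
        (coadjoint g (polyDeriv ξ b s) ⊗ₜ translateForm EG I W g α)
      rw [polyDeriv_coadjoint, TensorProduct.sum_tmul]
      simp only [TensorProduct.smul_tmul']
  bracket := structureConst_Ad ξ g⁻¹

end Invariants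

section Shift

variable {B : Type*} [Ring B] [Algebra ℝ B] {τ : B →ₐ[ℝ] B}

/-- The algebra homomorphism `1 - x ι`, for an odd element `x` and an antiderivation `ι`. -/
def shift {x : B} {ι : B →ₗ[ℝ] B} (hτ : ∀ z, τ (τ z) = z) (hx : OddElement τ x)
    (hι : IsAntiderivation τ ι) : B →ₐ[ℝ] B :=
  AlgHom.ofLinearMap (1 - LinearMap.mulLeft ℝ x ∘ₗ ι)
    (by simp [hι.map_one]) fun z w => by
      have h1 : ∀ z, z * x = x * τ z := fun z => by rw [hx.comm, hτ]
      have h2 : ∀ z w, x * z * (x * w) = 0 := fun z w => by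
        rw [hx.comm z, mul_assoc, ← mul_assoc x x, hx.mul_self, zero_mul, mul_zero]
      simp only [LinearMap.sub_apply, Module.End.one_apply, LinearMap.comp_apply,
        LinearMap.mulLeft_apply, hι.leibniz, mul_sub, sub_mul, h2, mul_add, sub_zero]
      rw [← mul_assoc z x, h1]
      noncomm_ring

variable {m : ℕ} {x : Fin m → B} {ι : Fin m → B →ₗ[ℝ] B} (hτ : ∀ z, τ (τ z) = z)
  (hx : ∀ a, OddElement τ (x a)) (hι : ∀ a, IsAntiderivation τ (ι a))

lemma shift_apply (a : Fin m) (z : B) : shift hτ (hx a) (hι a) z = z - x a * ι a z := rfl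

/-- The composition of the homomorphisms `1 - x_a ι_a`. -/
def shiftAll : B →ₐ[ℝ] B := (List.ofFn fun a => shift hτ (hx a) (hι a)).prod

lemma shift_list_apply {z : B} (h : ∀ a b, a ≠ b → ι b (x a * ι a z) = 0) {l : List (Fin m)}
    (hl : l.Nodup) : (l.map fun a => shift hτ (hx a) (hι a)).prod z =
      z - (l.map fun a => x a * ι a z).sum := by
  induction l with
  | nil => simp
  | cons b l ih =>
    rw [List.nodup_cons] at hl
    rw [List.map_cons, List.prod_cons, List.map_cons, List.sum_cons, AlgHom.mul_apply, ih hl.2,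
      shift_apply, map_sub, map_list_sum, List.map_map]
    have : (l.map (ι b ∘ fun a => x a * ι a z)).sum = 0 := by
      refine List.sum_eq_zero fun y hy => ?_
      obtain ⟨a, ha, rfl⟩ := List.mem_map.mp hy
      exact h a b fun e => hl.1 (e ▸ ha)
    rw [this]
    noncomm_ring

lemma shiftAll_apply {z : B} (h : ∀ a b, a ≠ b → ι b (x a * ι a z) = 0) :
    shiftAll hτ hx hι z = z - ∑ a, x a * ι a z := by
  rw [shiftAll, List.ofFn_eq_map, shift_list_apply hτ hx hι h (List.nodup_finRange m),
    ← List.ofFn_eq_map, List.sum_ofFn]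

lemma shiftAll_apply_of_eq_zero {z : B} (h : ∀ a, ι a z = 0) : shiftAll hτ hx hι z = z := by
  rw [shiftAll_apply hτ hx hι fun a b _ => by rw [h, mul_zero, map_zero]]
  simp [h]

end Shift

section CentralLift

variable {V T : Type*} [AddCommGroup V] [Module ℝ V] [Ring T] [Algebra ℝ T]

/-- The algebra homomorphism on the symmetric algebra given by a linear map with central values. -/
def centralLift (F : V →ₗ[ℝ] T) (hF : ∀ v z, F v * z = z * F v) : SymmetricAlgebra ℝ V →ₐ[ℝ] T :=
  (Subalgebra.center ℝ T).val.comp (SymmetricAlgebra.lift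
    { toFun := fun v => (⟨F v, Subalgebra.mem_center_iff.mpr fun z => (hF v z).symm⟩ :
        Subalgebra.center ℝ T)
      map_add' := fun v w => Subtype.ext (map_add F v w)
      map_smul' := fun r v => Subtype.ext (map_smul F r v) })

variable (F : V →ₗ[ℝ] T) (hF : ∀ v z, F v * z = z * F v)

lemma centralLift_ι (v : V) : centralLift F hF (SymmetricAlgebra.ι ℝ V v) = F v := by
  rw [centralLift, AlgHom.comp_apply, SymmetricAlgebra.lift_ι_apply]
  rfl

lemma centralLift_comm (s : SymmetricAlgebra ℝ V) (z : T) : Commute (centralLift F hF s) z := by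
  rw [centralLift, AlgHom.comp_apply]
  exact (Subalgebra.mem_center_iff.mp (Subtype.prop _) z).symm

lemma constr_comm {κ : Type*} [Fintype κ] (b : Module.Basis κ ℝ V) {c : κ → T}
    (hc : ∀ a z, c a * z = z * c a) (v : V) (z : T) : b.constr ℝ c v * z = z * b.constr ℝ c v := by
  rw [Module.Basis.constr_apply_fintype, Finset.sum_mul, Finset.mul_sum]
  exact Finset.sum_congr rfl fun a _ => by rw [smul_mul_assoc, mul_smul_comm, hc]

lemma algHom_one_mul {S : Type*} [Semiring S] [Algebra ℝ S] (φ : S →ₐ[ℝ] T) (z : T) :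
    φ 1 * z = z := by
  rw [map_one, one_mul]

lemma mul_algHom_one {S : Type*} [Semiring S] [Algebra ℝ S] (φ : S →ₐ[ℝ] T) (z : T) :
    z * φ 1 = z := by
  rw [map_one, mul_one]

end CentralLift

section Twist
set_option linter.unusedSectionVars false

variable {EG : Type*} [NormedAddCommGroup EG] [NormedSpace ℝ EG] [FiniteDimensional ℝ EG]
  {G : Type*} [TopologicalSpace G] [ChartedSpace EG G] [Group G] [LieGroup 𝓘(ℝ, EG) ∞ G]
  [T2Space G] {E : Type*} [NormedAddCommGroup E] [NormedSpace ℝ E] [FiniteDimensional ℝ E]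
  {H : Type*} [TopologicalSpace H] {I : ModelWithCorners ℝ E H}
  {W : Type*} [TopologicalSpace W] [ChartedSpace H W] [IsManifold I ∞ W]
  [MulAction G W] [ContMDiffSMul 𝓘(ℝ, EG) I ∞ G W] [T2Space W] [CompactSpace W]
  {m : ℕ} (ξ : Module.Basis (Fin m) ℝ (LieAlg EG G))
  (η : Connection EG G I W) (f : CutOff G I W)

/-- The components of the degenerate connection in `S(𝔤*) ⊗ Ω(W)`. -/
def connectionElement (a : Fin m) : PolyForms EG G I W :=
  1 ⊗ₜ degenerateConnection η f (ξ.coord a)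

lemma ι_connectionElement (b a : Fin m) : (cartanCalculus I W ξ).ι b (connectionElement ξ η f a) =
    if a = b then 1 ⊗ₜ f.form else 0 := by
  change (1 : SymDual EG G) ⊗ₜ fundamentalContract I (ξ b)
    (degenerateConnection η f (ξ.coord a)) = _
  rw [contract_degenerateConnection]
  by_cases h : a = b
  · simp [h]
  · simp [h]

open Polynomial in
/-- The element `X Dη^a + ½ X² [η, η]^a + Θ^a` of `ℝ[X] ⊗ S(𝔤*) ⊗ Ω(W)`. -/
def curvaturePath (a : Fin m) : ℝ[X] ⊗[ℝ] PolyForms EG G I W :=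
  X ⊗ₜ cartanD I W ξ (connectionElement ξ η f a) +
    (X ^ 2) ⊗ₜ ((1 / 2 : ℝ) • ∑ b, ∑ e, structureConst ξ a b e •
      (connectionElement ξ η f b * connectionElement ξ η f e)) + 1 ⊗ₜ (polyGen ξ a ⊗ₜ 1)

open Polynomial in
lemma even_curvaturePath (a : Fin m) :
    EvenElement (extendAlg ℝ[X] (cartanCalculus I W ξ).τ) (curvaturePath ξ η f a) :=
  ((((isConnectionForm ξ η f).even_D a).tmul X).add
    ((((isConnectionForm ξ η f).even_bracket a).smul (1 / 2)).tmul (X ^ 2))).add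
    (((cartanCalculus I W ξ).even_Θ a).tmul 1)

lemma twist_τ_τ (z : Polynomial ℝ ⊗[ℝ] PolyForms EG G I W) :
    extendAlg (Polynomial ℝ) (cartanCalculus I W ξ).τ
      (extendAlg (Polynomial ℝ) (cartanCalculus I W ξ).τ z) = z :=
  extendAlg_involutive (cartanCalculus I W ξ).τ_τ z

lemma twist_odd (a : Fin m) : OddElement (extendAlg (Polynomial ℝ) (cartanCalculus I W ξ).τ)
    (Polynomial.X ⊗ₜ[ℝ] connectionElement ξ η f a) :=
  ((isConnectionForm ξ η f).odd a).tmul _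

lemma twist_antiderivation (a : Fin m) :
    IsAntiderivation (extendAlg (Polynomial ℝ) (cartanCalculus I W ξ).τ)
      (((cartanCalculus I W ξ).ι a).lTensor (Polynomial ℝ)) :=
  ((cartanCalculus I W ξ).antiderivation_ι a).lTensor

/-- The substitution `Θ^a ↦ X Dη^a + ½ X² [η, η]^a + Θ^a`. -/
def twistSym : SymDual EG G →ₐ[ℝ] Polynomial ℝ ⊗[ℝ] PolyForms EG G I W :=
  centralLift (ξ.dualBasis.constr ℝ (curvaturePath ξ η f))
    (constr_comm _ fun a z => (even_curvaturePath ξ η f a).comm z)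

lemma twistSym_polyGen (a : Fin m) : twistSym ξ η f (polyGen ξ a) = curvaturePath ξ η f a := by
  rw [twistSym, polyGen, centralLift_ι]
  have : ξ.coord a = ξ.dualBasis a := by rw [Module.Basis.coe_dualBasis]
  rw [this, Module.Basis.constr_basis]

/-- The family of algebra homomorphisms that joins the identity to `rMap`. -/
def twist : PolyForms EG G I W →ₐ[ℝ] Polynomial ℝ ⊗[ℝ] PolyForms EG G I W :=
  Algebra.TensorProduct.lift (twistSym ξ η f)
    ((shiftAll (twist_τ_τ ξ) (twist_odd ξ η f) (twist_antiderivation ξ)).comp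
      (Algebra.TensorProduct.includeRight.comp Algebra.TensorProduct.includeRight))
    fun _ _ => centralLift_comm _ _ _ _

lemma twist_tmul (s : SymDual EG G) (α : DifferentialForm I W) :
    twist ξ η f (s ⊗ₜ α) = twistSym ξ η f s *
      shiftAll (twist_τ_τ ξ) (twist_odd ξ η f) (twist_antiderivation ξ) (1 ⊗ₜ (1 ⊗ₜ α)) :=
  Algebra.TensorProduct.lift_tmul _ _ _ _ _

lemma twist_one_tmul (α : DifferentialForm I W) : twist ξ η f (1 ⊗ₜ α) =
    shiftAll (twist_τ_τ ξ) (twist_odd ξ η f) (twist_antiderivation ξ) (1 ⊗ₜ (1 ⊗ₜ α)) :=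
  (twist_tmul ξ η f 1 α).trans <| by
    have h := algHom_one_mul (twistSym ξ η f)
      (shiftAll (twist_τ_τ ξ) (twist_odd ξ η f) (twist_antiderivation ξ) (1 ⊗ₜ (1 ⊗ₜ α)))
    exact h

/-- `ι_b (η^a * y) = 0` for `a ≠ b` and `ι_b y = 0`. -/
lemma ι_connectionElement_mul {a b : Fin m} (hab : a ≠ b) {y : PolyForms EG G I W}
    (hy : (cartanCalculus I W ξ).ι b y = 0) :
    (cartanCalculus I W ξ).ι b (connectionElement ξ η f a * y) = 0 := by
  rw [((cartanCalculus I W ξ).antiderivation_ι b).leibniz, ι_connectionElement, if_neg hab, hy,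
    zero_mul, mul_zero, add_zero]

lemma ι_L_function (a b : Fin m) {g : PolyForms EG G I W}
    (hg : g ∈ (cartanCalculus I W ξ).functions) :
    (cartanCalculus I W ξ).ι b ((cartanCalculus I W ξ).L a g) = 0 :=
  (cartanCalculus I W ξ).ι_function b _ ((cartanCalculus I W ξ).L_function a g hg)

open Polynomial in
lemma isTwist : (cartanCalculus I W ξ).IsTwist (connectionElement ξ η f) (twist ξ η f) where
  Θ a := by
    change twist ξ η f (polyGen ξ a ⊗ₜ 1) = _
    rw [twist_tmul, twistSym_polyGen]
    have h1 : (1 : ℝ[X]) ⊗ₜ[ℝ] ((1 : SymDual EG G) ⊗ₜ[ℝ] (1 : DifferentialForm I W)) = 1 := rfl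
    rw [h1]
    exact mul_algHom_one
      (shiftAll (twist_τ_τ ξ) (twist_odd ξ η f) (twist_antiderivation ξ)) (curvaturePath ξ η f a)
  function := by
    rintro _ ⟨α, hα, rfl⟩
    rw [twist_one_tmul, shiftAll_apply_of_eq_zero]
    intro a
    rw [LinearMap.lTensor_tmul, (cartanCalculus I W ξ).ι_function a _ ⟨α, hα, rfl⟩,
      TensorProduct.tmul_zero]
  D := by
    rintro _ ⟨α, hα, rfl⟩
    set g : PolyForms EG G I W := 1 ⊗ₜ α with hg
    have hgf : g ∈ (cartanCalculus I W ξ).functions := ⟨α, hα, rfl⟩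
    have hD : (cartanCalculus I W ξ).D g = 1 ⊗ₜ extDeriv I W α := cartanD_function I W ξ hα
    have hι : ∀ a, (cartanCalculus I W ξ).ι a (1 ⊗ₜ extDeriv I W α) = (cartanCalculus I W ξ).L a g :=
      fun a => by rw [← hD]; exact (cartanCalculus I W ξ).ι_D a g hgf
    rw [hD, twist_one_tmul, shiftAll_apply]
    · simp only [LinearMap.lTensor_tmul, hι, Algebra.TensorProduct.tmul_mul_tmul, mul_one,
        TensorProduct.tmul_sum]
      rfl
    · intro a b hab
      rw [LinearMap.lTensor_tmul, Algebra.TensorProduct.tmul_mul_tmul, LinearMap.lTensor_tmul, hι,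
        ι_connectionElement_mul ξ η f hab (ι_L_function ξ a b hgf), TensorProduct.tmul_zero]

end Twist

section EvalShift

open Polynomial CartanCalculus

variable {A : Type*} [Ring A] [Algebra ℝ A] {τ : A →ₐ[ℝ] A}

lemma evalAt_one_shift {T : ℝ[X] ⊗[ℝ] A →ₐ[ℝ] ℝ[X] ⊗[ℝ] A} {x : A} {ι : A →ₗ[ℝ] A}
    (hT : ∀ z, T (T z) = z) (hX : OddElement T (X ⊗ₜ[ℝ] x))
    (hι' : IsAntiderivation T (ι.lTensor ℝ[X]))
    (hτ : ∀ z, τ (τ z) = z) (hx : OddElement τ x) (hι : IsAntiderivation τ ι) (z : ℝ[X] ⊗[ℝ] A) :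
    evalAt A 1 (shift hT hX hι' z) = shift hτ hx hι (evalAt A 1 z) := by
  change evalAt A 1 (z - X ⊗ₜ x * ι.lTensor ℝ[X] z) =
    evalAt A 1 z - x * ι (evalAt A 1 z)
  rw [map_sub, map_mul, evalAt_lTensor, evalAt_tmul, eval_X, one_smul]

variable {m : ℕ} {T : ℝ[X] ⊗[ℝ] A →ₐ[ℝ] ℝ[X] ⊗[ℝ] A} {x : Fin m → A} {ι : Fin m → A →ₗ[ℝ] A}
  (hT : ∀ z, T (T z) = z) (hX : ∀ a, OddElement T (X ⊗ₜ[ℝ] x a))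
  (hι' : ∀ a, IsAntiderivation T ((ι a).lTensor ℝ[X]))
  (hτ : ∀ z, τ (τ z) = z) (hx : ∀ a, OddElement τ (x a)) (hι : ∀ a, IsAntiderivation τ (ι a))

lemma evalAt_one_shiftAll (z : A) :
    evalAt A 1 (shiftAll hT hX hι' (1 ⊗ₜ z)) = shiftAll hτ hx hι z := by
  have h : ∀ (l : List (Fin m)) (w : ℝ[X] ⊗[ℝ] A),
      evalAt A 1 ((l.map fun a => shift hT (hX a) (hι' a)).prod w) =
        (l.map fun a => shift hτ (hx a) (hι a)).prod (evalAt A 1 w) := by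
    intro l
    induction l with
    | nil => intro w; rfl
    | cons a l ih =>
      intro w
      rw [List.map_cons, List.prod_cons, AlgHom.mul_apply, List.map_cons, List.prod_cons,
        AlgHom.mul_apply, evalAt_one_shift (hτ := hτ) (hx := hx a) (hι := hι a), ih]
  rw [shiftAll, List.ofFn_eq_map, h, shiftAll, List.ofFn_eq_map, evalAt_tmul, eval_one, one_smul]

end EvalShift

section SymmetricBasis

lemma symmetricAlgebra_basis_apply {V : Type*} [AddCommGroup V] [Module ℝ V] {m : ℕ}
    (b : Module.Basis (Fin m) ℝ V) (K : Fin m →₀ ℕ) :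
    b.symmetricAlgebra K = (List.ofFn fun a => SymmetricAlgebra.ι ℝ V (b a) ^ K a).prod := by
  have h : b.symmetricAlgebra K =
      (SymmetricAlgebra.equivMvPolynomial b).symm (MvPolynomial.monomial K 1) := by
    rw [Module.Basis.symmetricAlgebra, Module.Basis.map_apply, MvPolynomial.coe_basisMonomials]
    rfl
  rw [h, MvPolynomial.monomial_eq, map_one, one_mul, Finsupp.prod_fintype _ _ fun _ => pow_zero _,
    List.prod_ofFn]
  refine (map_prod (SymmetricAlgebra.equivMvPolynomial b).symm _ _).trans ?_
  refine Finset.prod_congr rfl fun a _ => ?_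
  rw [map_pow, SymmetricAlgebra.equivMvPolynomial_symm_X]

end SymmetricBasis

section RMap
set_option linter.unusedSectionVars false

open CartanCalculus

variable {EG : Type*} [NormedAddCommGroup EG] [NormedSpace ℝ EG] [FiniteDimensional ℝ EG]
  {G : Type*} [TopologicalSpace G] [ChartedSpace EG G] [Group G] [LieGroup 𝓘(ℝ, EG) ∞ G]
  [T2Space G] {E : Type*} [NormedAddCommGroup E] [NormedSpace ℝ E] [FiniteDimensional ℝ E]
  {H : Type*} [TopologicalSpace H] {I : ModelWithCorners ℝ E H}
  {W : Type*} [TopologicalSpace W] [ChartedSpace H W] [IsManifold I ∞ W]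
  [MulAction G W] [ContMDiffSMul 𝓘(ℝ, EG) I ∞ G W] [T2Space W] [CompactSpace W]
  {m : ℕ} (ξ : Module.Basis (Fin m) ℝ (LieAlg EG G))
  (η : Connection EG G I W) (f : CutOff G I W)

lemma evalAt_curvaturePath (a : Fin m) :
    evalAt (PolyForms EG G I W) 1 (curvaturePath ξ η f a) = degenerateCurvature ξ η f a := by
  have h1 : evalAt (PolyForms EG G I W) 1 (curvaturePath ξ η f a) =
      cartanD I W ξ (connectionElement ξ η f a) +
        (1 / 2 : ℝ) • ∑ b, ∑ e, structureConst ξ a b e •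
          (connectionElement ξ η f b * connectionElement ξ η f e) + polyGen ξ a ⊗ₜ 1 := by
    rw [curvaturePath]
    refine (map_add (evalAt (PolyForms EG G I W) 1) _ _).trans
      (congrArg₂ _ ((map_add (evalAt (PolyForms EG G I W) 1) _ _).trans (congrArg₂ _ ?_ ?_)) ?_)
    · rw [evalAt_tmul]; simp
    · rw [evalAt_tmul]; simp
    · rw [evalAt_tmul]; simp
  have h2 : cartanD I W ξ (connectionElement ξ η f a) =
      1 ⊗ₜ extDeriv I W (degenerateConnection η f (ξ.coord a)) - polyGen ξ a ⊗ₜ f.form := by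
    rw [connectionElement, cartanD_one_tmul]
    refine congrArg _ ((Finset.sum_eq_single_of_mem a (Finset.mem_univ a) fun b _ hb => ?_).trans ?_)
    · rw [contract_degenerateConnection, Module.Basis.coord_apply, Module.Basis.repr_self,
        Finsupp.single_eq_of_ne (Ne.symm hb), zero_smul, TensorProduct.tmul_zero]
    · rw [contract_degenerateConnection, Module.Basis.coord_apply, Module.Basis.repr_self,
        Finsupp.single_eq_same, one_smul]
  rw [h1, h2, degenerateCurvature]
  simp only [connectionElement, Algebra.TensorProduct.tmul_mul_tmul, mul_one, structureConst,
    TensorProduct.tmul_add, TensorProduct.tmul_smul, TensorProduct.tmul_sum, TensorProduct.tmul_neg]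
  abel

/-- The substitution `Θ^a ↦ (Ω_f^G)^a` is the value at `1` of `twistSym`. -/
lemma evalAt_twistSym (s : SymDual EG G) :
    evalAt (PolyForms EG G I W) 1 (twistSym ξ η f s) = chernWeilSym ξ η f s := by
  have : ((evalAt (PolyForms EG G I W) 1).comp (twistSym ξ η f)).toLinearMap =
      chernWeilSym ξ η f := by
    refine ξ.dualBasis.symmetricAlgebra.ext fun K => ?_
    rw [chernWeilSym, Module.Basis.constr_basis, symmetricAlgebra_basis_apply]
    refine (map_list_prod ((evalAt (PolyForms EG G I W) 1).comp (twistSym ξ η f)) _).trans ?_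
    rw [List.map_ofFn]
    congr 2
    funext a
    have h : ξ.dualBasis a = ξ.coord a := by rw [Module.Basis.coe_dualBasis]
    refine (map_pow ((evalAt (PolyForms EG G I W) 1).comp (twistSym ξ η f)) _ _).trans ?_
    congr 1
    rw [h, ← evalAt_curvaturePath, ← twistSym_polyGen]
    rfl
  exact DFunLike.congr_fun this s

lemma chernWeilSym_comm (s : SymDual EG G) (z : PolyForms EG G I W) :
    chernWeilSym ξ η f s * z = z * chernWeilSym ξ η f s := by
  rw [← evalAt_twistSym]
  have h := congrArg (evalAt (PolyForms EG G I W) 1)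
    (centralLift_comm _ _ s (1 ⊗ₜ z) : twistSym ξ η f s * 1 ⊗ₜ z = 1 ⊗ₜ z * twistSym ξ η f s)
  have e : evalAt (PolyForms EG G I W) 1 (1 ⊗ₜ z) = z := by
    rw [evalAt_tmul, Polynomial.eval_one, one_smul]
  have h1 := (map_mul (evalAt (PolyForms EG G I W) 1) (twistSym ξ η f s) (1 ⊗ₜ z)).symm.trans
    (h.trans (map_mul (evalAt (PolyForms EG G I W) 1) (1 ⊗ₜ z) (twistSym ξ η f s)))
  rwa [e] at h1

lemma chernWeilExterior_involute
    (θ : ExteriorAlgebra ℝ (Module.Dual ℝ (LieAlg EG G))) :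
    chernWeilExterior η f (CliffordAlgebra.involute θ) =
      (cartanCalculus I W ξ).τ (chernWeilExterior η f θ) := by
  have : (chernWeilExterior η f).comp CliffordAlgebra.involute =
      (cartanCalculus I W ξ).τ.comp (chernWeilExterior η f) := by
    apply ExteriorAlgebra.hom_ext
    ext l : 1
    have h1 : CliffordAlgebra.involute (ExteriorAlgebra.ι ℝ l) = - ExteriorAlgebra.ι ℝ l :=
      CliffordAlgebra.involute_ι _
    have h2 : chernWeilExterior η f (ExteriorAlgebra.ι ℝ l) =
        1 ⊗ₜ degenerateConnection η f l := ExteriorAlgebra.lift_ι_apply ℝ _ _ _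
    change chernWeilExterior η f (CliffordAlgebra.involute (ExteriorAlgebra.ι ℝ l)) =
      (cartanCalculus I W ξ).τ (chernWeilExterior η f (ExteriorAlgebra.ι ℝ l))
    rw [h1, map_neg, h2]
    exact ((odd_degenerateConnection η f l).tmul (1 : SymDual EG G)).grade.symm
  exact DFunLike.congr_fun this θ

/-- `HorizontalPair ξ η f s l w z` says that `z` represents `w`, and that the coefficients in the
exterior algebra are killed by the `ι_b` with `b ∉ l`. -/
inductive HorizontalPair (s : SymDual EG G) (l : List (Fin m)) :
    WeilForms EG G I W → PolyForms EG G I W → Prop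
  | tmul (θ : ExteriorAlgebra ℝ (Module.Dual ℝ (LieAlg EG G))) (β : DifferentialForm I W)
      (h : ∀ b, b ∉ l → (cartanCalculus I W ξ).ι b (chernWeilExterior η f θ) = 0) :
      HorizontalPair s l (θ ⊗ₜ (s ⊗ₜ β)) (chernWeilExterior η f θ * 1 ⊗ₜ β)
  | sub {w w' : WeilForms EG G I W} {z z' : PolyForms EG G I W} (h : HorizontalPair s l w z)
      (h' : HorizontalPair s l w' z') : HorizontalPair s l (w - w') (z - z')

variable {ξ η f}

lemma HorizontalPair.chernWeil_eq {s : SymDual EG G} {l : List (Fin m)}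
    {w : WeilForms EG G I W} {z : PolyForms EG G I W} (h : HorizontalPair ξ η f s l w z) :
    chernWeil ξ η f w = chernWeilSym ξ η f s * z := by
  induction h with
  | tmul θ β h =>
    change chernWeilExterior η f θ * (chernWeilSym ξ η f s * 1 ⊗ₜ β) = _
    rw [← mul_assoc, ← chernWeilSym_comm, mul_assoc]
  | sub h h' ih ih' => rw [map_sub, ih, ih', mul_sub]

lemma HorizontalPair.step {s : SymDual EG G} {l : List (Fin m)}
    {w : WeilForms EG G I W} {z : PolyForms EG G I W} (h : HorizontalPair ξ η f s l w z)
    {a : Fin m} (ha : a ∉ l) :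
    HorizontalPair ξ η f s (a :: l) ((1 - thetaContract I W ξ a) w)
      (z - connectionElement ξ η f a * (cartanCalculus I W ξ).ι a z) := by
  induction h with
  | tmul θ β h =>
    have h1 : (cartanCalculus I W ξ).ι a (chernWeilExterior η f θ * 1 ⊗ₜ β) =
        (cartanCalculus I W ξ).τ (chernWeilExterior η f θ) * 1 ⊗ₜ fundamentalContract I (ξ a) β := by
      rw [((cartanCalculus I W ξ).antiderivation_ι a).leibniz, h a ha, zero_mul, zero_add]
      rfl
    have h2 : chernWeilExterior η f
        (ExteriorAlgebra.ι ℝ (ξ.coord a) * CliffordAlgebra.involute θ) =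
          connectionElement ξ η f a * (cartanCalculus I W ξ).τ (chernWeilExterior η f θ) := by
      rw [map_mul, chernWeilExterior_involute ξ]
      congr 1
      exact ExteriorAlgebra.lift_ι_apply ℝ _ _ _
    have h3 := HorizontalPair.sub
      (.tmul (ξ := ξ) (η := η) (f := f) (s := s) (l := a :: l) θ β fun b hb =>
        h b fun hb' => hb (List.mem_cons_of_mem a hb'))
      (.tmul (ξ := ξ) (η := η) (f := f) (s := s) (l := a :: l)
        (ExteriorAlgebra.ι ℝ (ξ.coord a) * CliffordAlgebra.involute θ)
        (fundamentalContract I (ξ a) β) fun b hb => by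
          rw [List.mem_cons, not_or] at hb
          rw [h2]
          refine ι_connectionElement_mul ξ η f (Ne.symm hb.1) ?_
          rw [((cartanCalculus I W ξ).antiderivation_ι b).grade, h b hb.2, map_zero, neg_zero])
    rw [h2] at h3
    rw [h1, ← mul_assoc]
    exact h3
  | @sub w w' z z' h h' ih ih' =>
    have h4 := ih.sub ih'
    rw [map_sub, map_sub, mul_sub]
    convert h4 using 1
    abel

variable (ξ η f)

lemma rMap_eq_evalAt_twist (z : PolyForms EG G I W) :
    rMap ξ η f z = evalAt (PolyForms EG G I W) 1 (twist ξ η f z) := by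
  have hpair : ∀ (s : SymDual EG G) (β : DifferentialForm I W) (l : List (Fin m)), l.Nodup →
      HorizontalPair ξ η f s l ((l.map fun a => 1 - thetaContract I W ξ a).prod (1 ⊗ₜ (s ⊗ₜ β)))
        ((l.map fun a => shift (cartanCalculus I W ξ).τ_τ ((isConnectionForm ξ η f).odd a)
          ((cartanCalculus I W ξ).antiderivation_ι a)).prod (1 ⊗ₜ β)) := by
    intro s β l
    induction l with
    | nil =>
      intro _
      have := HorizontalPair.tmul (ξ := ξ) (η := η) (f := f) (s := s) (l := []) 1 β fun b _ => by
        rw [map_one, ((cartanCalculus I W ξ).antiderivation_ι b).map_one]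
      rw [map_one, one_mul] at this
      exact this
    | cons a l ih =>
      intro hl
      rw [List.nodup_cons] at hl
      exact (ih hl.2).step hl.1
  induction z using TensorProduct.induction_on with
  | zero => rw [map_zero, map_zero, map_zero]
  | add x y hx hy =>
    rw [map_add, hx, hy, map_add]
    exact (map_add (evalAt (PolyForms EG G I W) 1) _ _).symm
  | tmul s β =>
    have h1 : rMap ξ η f (s ⊗ₜ β) = chernWeil ξ η f (((List.finRange m).map fun a =>
        1 - thetaContract I W ξ a).prod (1 ⊗ₜ (s ⊗ₜ β))) := by
      rw [← List.ofFn_eq_map]; rfl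
    rw [h1, (hpair s β _ (List.nodup_finRange m)).chernWeil_eq, twist_tmul]
    refine Eq.trans ?_ (map_mul (evalAt (PolyForms EG G I W) 1) _ _).symm
    have h2 : evalAt (PolyForms EG G I W) 1
        (shiftAll (twist_τ_τ ξ) (twist_odd ξ η f) (twist_antiderivation ξ) (1 ⊗ₜ (1 ⊗ₜ β))) =
        shiftAll (cartanCalculus I W ξ).τ_τ (isConnectionForm ξ η f).odd
          (cartanCalculus I W ξ).antiderivation_ι (1 ⊗ₜ β) :=
      evalAt_one_shiftAll _ _ _ _ _ _ _
    rw [evalAt_twistSym, h2, shiftAll, List.ofFn_eq_map]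

end RMap

section Cohomology
set_option linter.unusedSectionVars false

open CartanCalculus

variable {EG : Type*} [NormedAddCommGroup EG] [NormedSpace ℝ EG] [FiniteDimensional ℝ EG]
  {G : Type*} [TopologicalSpace G] [ChartedSpace EG G] [Group G] [LieGroup 𝓘(ℝ, EG) ∞ G]
  [T2Space G] {E : Type*} [NormedAddCommGroup E] [NormedSpace ℝ E] [FiniteDimensional ℝ E]
  {H : Type*} [TopologicalSpace H] {I : ModelWithCorners ℝ E H}
  {W : Type*} [TopologicalSpace W] [ChartedSpace H W] [IsManifold I ∞ W]
  [MulAction G W] [ContMDiffSMul 𝓘(ℝ, EG) I ∞ G W] [T2Space W] [CompactSpace W]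
  {m : ℕ} (ξ : Module.Basis (Fin m) ℝ (LieAlg EG G))
  (η : Connection EG G I W) (f : CutOff G I W)

/-- `rMap` is an endomorphism of the Cartan complex. -/
theorem isCochainMap_rMap : IsCochainMap ξ (rMap ξ η f) where
  map_mem α hα g := by
    rw [rMap_eq_evalAt_twist,
      ← (isSymmetry ξ η f g).evalAt_comm (isTwist ξ η f) 1 α, hα g]
  comm α hα := by
    rw [rMap_eq_evalAt_twist, rMap_eq_evalAt_twist]
    exact (isTwist ξ η f).evalAt_D_comm (isConnectionForm ξ η f) 1
      fun a => totalLieDeriv_eq_zero ξ hα (ξ a)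

/-- A chain homotopy between `rMap` and the identity of the Cartan complex. -/
def rMapHomotopy : PolyForms EG G I W →ₗ[ℝ] PolyForms EG G I W :=
  integrate _ ∘ₗ (cartanCalculus I W ξ).homotopyIntegrand (connectionElement ξ η f) (twist ξ η f)

lemma rMapHomotopy_mem {α : PolyForms EG G I W} (hα : α ∈ equivariantForms EG G I W) :
    rMapHomotopy ξ η f α ∈ equivariantForms EG G I W := fun g =>
  ((isSymmetry ξ η f g).homotopy_comm (isTwist ξ η f) α).symm.trans
    (congrArg (rMapHomotopy ξ η f) (hα g))

lemma rMap_sub_self {α : PolyForms EG G I W} (hα : α ∈ equivariantForms EG G I W) :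
    rMap ξ η f α - α =
      cartanD I W ξ (rMapHomotopy ξ η f α) + rMapHomotopy ξ η f (cartanD I W ξ α) := by
  rw [rMap_eq_evalAt_twist]
  exact (isTwist ξ η f).homotopy (isConnectionForm ξ η f)
    fun a => totalLieDeriv_eq_zero ξ hα (ξ a)

/-- `rMap` induces the identity on equivariant cohomology. -/
theorem cohomologyMap_rMap (h : IsCochainMap ξ (rMap ξ η f)) : h.cohomologyMap = LinearMap.id := by
  refine LinearMap.ext fun c => ?_
  obtain ⟨α, rfl⟩ := Submodule.Quotient.mk_surjective _ c
  refine (Submodule.Quotient.eq _).mpr ?_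
  refine ⟨rMapHomotopy ξ η f α, rMapHomotopy_mem ξ η f α.2.1, ?_⟩
  have h1 := rMap_sub_self ξ η f α.2.1
  rw [show cartanD I W ξ α = 0 from α.2.2, map_zero, add_zero] at h1
  exact h1.symm

end Cohomology

end DegenerateChernWeil

end

theorem theorem2p4
    {EG : Type*} [NormedAddCommGroup EG] [NormedSpace ℝ EG]
    {G : Type*} [TopologicalSpace G] [ChartedSpace EG G] [Group G]
    [LieGroup 𝓘(ℝ, EG) ∞ G] [CompactSpace G] [ConnectedSpace G] [T2Space G]
    {E : Type*} [NormedAddCommGroup E] [NormedSpace ℝ E] [FiniteDimensional ℝ E]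
    {H : Type*} [TopologicalSpace H] (I : ModelWithCorners ℝ E H)
    {W : Type*} [TopologicalSpace W] [ChartedSpace H W] [IsManifold I ∞ W]
    [CompactSpace W] [T2Space W]
    [MulAction G W] [ContMDiffSMul 𝓘(ℝ, EG) I ∞ G W]
    (hbd : I.boundary W ⊆ freeLocus G W)
    {m : ℕ} (ξ : Module.Basis (Fin m) ℝ (LieAlg EG G))
    (η₀ η₁ : Connection EG G I W) (f₀ f₁ : CutOff G I W) :
    ∃ (h₀ : IsCochainMap ξ (rMap ξ η₀ f₀)) (h₁ : IsCochainMap ξ (rMap ξ η₁ f₁)),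
      h₀.cohomologyMap = h₁.cohomologyMap := by
  have : FiniteDimensional ℝ EG := Module.Finite.of_basis (M := LieAlg EG G) ξ
  exact ⟨isCochainMap_rMap ξ η₀ f₀, isCochainMap_rMap ξ η₁ f₁,
    (cohomologyMap_rMap ξ η₀ f₀ _).trans (cohomologyMap_rMap ξ η₁ f₁ _).symm⟩
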